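/- **Setting.** Let $M\in\mathbb{R}^{m\times n}$ have rank $r\ge 1$ and singular values $\sigma_1\ge\sigma_2\ge\cdots$, let $\mathcal{A}:\mathbb{R}^{m\times n}\to\mathbb{R}^p$ be linear with spectral norm $\|\mathcal{A}\|$ (with respect to the Frobenius and Euclidean norms), let $\nu,\mu>0$, and let $\kappa$ be a nonnegative integer. Put $f(X)=\frac12\|\mathcal{A}(X)-\mathcal{A}(M)\|^2$, let $\mathcal{X}^*$ be the set of global minimizers of $X\mapsto \nu f(X)+\mathrm{rank}(X)$ on $\mathbb{R}^{m\times n}$, and let $\Omega_\kappa=\{X:\mathrm{rank}(X)\le\kappa\}$. Write $\|Z\|_{2,0}$ for the number of nonzero columns of $Z$, $Z_j$ for its $j$-th column, and $$\mathcal{W}^*=\{(\overline U,\overline V)\in\mathbb{R}^{m\times\kappa}\times\mathbb{R}^{n\times\kappa}:\ \overline U\,\overline V^{T}\in\mathcal{X}^*\cap\Omega_\kappa,\ \overline U^T\overline U=\overline V^T\overline V,\ \|\overline U\|_{2,0}=\|\overline V\|_{2,0}=\mathrm{rank}(\overline U\,\overline V^T)\}.$$ Let $\alpha$ and $\beta$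 be the minimum and the maximum of $\|\mathcal{A}(X)\|^2$ over all $X$ with $\mathrm{rank}(X)\le 2r$ and $\|X\|_F=1$. Let $\phi:\mathbb{R}\to(-\infty,+\infty]$ be proper, lower semicontinuous and convex with $[0,1]\subseteq\mathrm{int}(\mathrm{dom}\,\phi)$, $\phi(1)=1$ and $\min_{[0,1]}\phi=0$. Let $\psi=\phi$ on $[0,1]$ and $\psi=+\infty$ elsewhere, let $\psi^*$ be the convex conjugate of $\psi$, and let $\theta(t)=|t|-\psi^*(|t|)$. Assume that $\theta$ is concave and nondecreasing on $[0,\infty)$ and that there are constants $\varpi>0$ and $c>0$ such that $\theta$ is differentiable on $(0,\varpi)$ with $\theta'(t)\ge c$ for all $t\in(0,\varpi)$. For $\rho>0$ put $$\Theta_\rho(U,V)=\nu f(UV^T)+\frac{\mu}{4}\|U^TU-V^TV\|_F^2+\frac12\sum_{j=1}^{\kappa}\big[\theta(\rho\|U_j\|)+\theta(\rho\|V_j\|)\big],\qquad (U,V)\in\mathbb{R}^{m\times\kappa}\times\mathbb{R}^{n\times\kappa}.$$ Below, $\partial$ is the limiting (Mordukhovich) subdifferential, $\mathrm{dist}(0,\emptyset)=+\infty$,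 and $\mathbb{R}^{m\times\kappa}\times\mathbb{R}^{n\times\kappa}$ carries the norm $\|(U,V)\|_F=(\|U\|_F^2+\|V\|_F^2)^{1/2}$. **Theorem.** Suppose that $\mathcal{X}^*\cap\Omega_\kappa\neq\emptyset$, $$\frac{\beta}{\alpha}<\frac{128\sigma_1^2(4\sigma_1+\sigma_r)^2+\sigma_r^4}{128\sigma_1^2(4\sigma_1+\sigma_r)^2-\sigma_r^4},\qquad \alpha>\frac{4}{\nu\sigma_r^2},$$ and $$\rho>\overline\rho:=\max\Big(1,\ \frac{\sqrt{\nu}\,\|\mathcal{A}\|\sqrt{\kappa}}{\sqrt{\nu\alpha}\,\sigma_r-\sqrt2}\sqrt{1+\frac{2\sqrt r}{\sqrt\mu}}\Big)\,\phi'_-(1),$$ where $\phi'_-(1)$ is the left derivative of $\phi$ at $1$. Put $$\gamma'=\min\Big(\frac{\nu}{\beta}\Big[\frac{(\beta+\alpha)\sigma_r^4}{128\sqrt{\sigma_1^3}\,(4\sigma_1+\sigma_r)^2}-\sqrt{\sigma_1}(\beta-\alpha)\Big]^2,\ 2\mu\sigma_r,\ \frac{c^2\rho^2}{8}\Big),\qquad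 R=\min\Big(\frac{\sqrt{\sigma_r}}{4},\ \frac{\varpi}{\rho},\ \frac{c\rho}{4\sqrt\nu\,\|\mathcal{A}\|+16\mu\sigma_1}\Big).$$ Then $\gamma'>0$ and $R>0$, and for every $(\overline U,\overline V)\in\mathcal{W}^*$ and every $(U,V)$ with $0<\Theta_\rho(U,V)-\Theta_\rho(\overline U,\overline V)<\frac12$ and $\|(U-\overline U,V-\overline V)\|_F<R$, $$\mathrm{dist}^2\big(0,\partial\Theta_\rho(U,V)\big)\ \ge\ \gamma'\big(\Theta_\rho(U,V)-\Theta_\rho(\overline U,\overline V)\big).$$ Moreover, $\Theta_\rho$ has the Kurdyka–Łojasiewicz property of exponent $1/2$ at each of its global minimizers $\overline w$: $\partial\Theta_\rho(\overline w)\ne\emptyset$ and there are $a>0$, $\eta\in(0,+\infty]$ and a neighbourhood $N$ of $\overline w$ such that, with $\varphi(s)=a\sqrt s$, $\varphi'(\Theta_\rho(w)-\Theta_\rho(\overline w))\,\mathrm{dist}(0,\partial\Theta_\rho(w))\ge1$ for all $w\in N$ with $\Theta_\rho(\overline w)<\Theta_\rho(w)<\Theta_\rho(\overline w)+\eta$.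 -/

import Mathlib

open Set Filter Topology

noncomputable section

namespace LowRankKL

/-! ### Subdifferentials and the KL property of exponent 1/2 -/

section Subdifferential

variable {E : Type*} [NormedAddCommGroup E] [InnerProductSpace ℝ E]

/-- The regular (Fréchet) subdifferential of a finite-valued `g` at `x`: all `v` with
`liminf_{x' → x, x' ≠ x} (g x' - g x - ⟪v, x' - x⟫) / ‖x' - x‖ ≥ 0`. -/
def regularSubdiff (g : E → ℝ) (x : E) : Set E :=
  {v | ∀ ε : ℝ, 0 < ε → ∀ᶠ x' in 𝓝 x, -ε * ‖x' - x‖ ≤ g x' - g x - inner ℝ v (x' - x)}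

/-- The limiting subdifferential: limits of regular subgradients `v k` at points `x k → x`
with `g (x k) → g x`. -/
def limitingSubdiff (g : E → ℝ) (x : E) : Set E :=
  {v | ∃ (xs vs : ℕ → E), Tendsto xs atTop (𝓝 x) ∧ Tendsto (fun k => g (xs k)) atTop (𝓝 (g x)) ∧
    (∀ k, vs k ∈ regularSubdiff g (xs k)) ∧ Tendsto vs atTop (𝓝 v)}

/-- `dist(0, ∂g(x))`, with the convention that the distance to the empty set is `∞`. -/
def distSubdiff (g : E → ℝ) (x : E) : ENNReal :=
  Metric.infEDist 0 (limitingSubdiff g x)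

/-- The KL property at `x₀` with the desingularizing function `s ↦ a * √s`, `a > 0`. -/
def HasKLExponentHalf (g : E → ℝ) (x₀ : E) : Prop :=
  (limitingSubdiff g x₀).Nonempty ∧
    ∃ a : ℝ, 0 < a ∧ ∃ η : ENNReal, 0 < η ∧ ∃ N ∈ 𝓝 x₀, ∀ x ∈ N,
      g x₀ < g x → ENNReal.ofReal (g x - g x₀) < η →
        1 ≤ ENNReal.ofReal (deriv (fun s : ℝ => a * Real.sqrt s) (g x - g x₀)) * distSubdiff g x

end Subdifferential

/-! ### The family of convex functions and the associated function `θ` -/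

/-- The family of proper lsc convex `φ : ℝ → (-∞, ∞]` with `[0,1] ⊆ int (dom φ)`, `φ 1 = 1` and
minimum value `0` on `[0,1]`. Convexity is convexity of the epigraph. -/
structure IsPenaltyGenerator (φ : ℝ → EReal) : Prop where
  ne_bot : ∀ t, φ t ≠ ⊥
  exists_ne_top : ∃ t, φ t ≠ ⊤
  lsc : LowerSemicontinuous φ
  convex_epigraph : Convex ℝ {q : ℝ × ℝ | φ q.1 ≤ (q.2 : EReal)}
  subset_interior_dom : Icc (0 : ℝ) 1 ⊆ interior {t | φ t < ⊤}
  map_one : φ 1 = 1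
  exists_argmin : ∃ t ∈ Icc (0 : ℝ) 1, φ t = 0 ∧ ∀ s ∈ Icc (0 : ℝ) 1, φ t ≤ φ s

/-- `φ'₋(1)`, the left derivative of `φ` at `1` (where `φ` is finite nearby). -/
def leftDerivAtOne (φ : ℝ → EReal) : ℝ :=
  derivWithin (fun t => (φ t).toReal) (Iio 1) 1

open Classical in
/-- `ψ = φ` on `[0,1]` and `ψ = ∞` elsewhere. -/
def psi (φ : ℝ → EReal) (t : ℝ) : EReal :=
  if t ∈ Icc (0 : ℝ) 1 then φ t else ⊤

/-- The convex conjugate `g*(s) = sup_t (s t - g t)`. -/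
def conjugate (g : ℝ → EReal) (s : ℝ) : EReal :=
  ⨆ t : ℝ, ((s * t : ℝ) : EReal) - g t

/-- `θ(t) = |t| - ψ*(|t|)`; the conjugate `ψ*` is finite everywhere for `φ` in the family. -/
def theta (φ : ℝ → EReal) (t : ℝ) : ℝ :=
  |t| - (conjugate (psi φ) |t|).toReal

/-- `θ` is concave and nondecreasing on `[0, ∞)`, and differentiable with `θ' ≥ c` on `(0, ϖ)`,
for the constants `ϖ, c > 0`. -/
structure SlopeAssumption (φ : ℝ → EReal) (ϖ c : ℝ) : Prop where
  concave : ConcaveOn ℝ (Ici 0) (theta φ)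
  monotone : MonotoneOn (theta φ) (Ici 0)
  ϖ_pos : 0 < ϖ
  c_pos : 0 < c
  differentiable : ∀ t ∈ Ioo 0 ϖ, DifferentiableAt ℝ (theta φ) t
  le_deriv : ∀ t ∈ Ioo 0 ϖ, c ≤ deriv (theta φ) t

/-! ### Matrices -/

/-- The entries of a matrix as a vector; the Euclidean norm becomes the Frobenius norm. -/
def matVec (m n : ℕ) : Matrix (Fin m) (Fin n) ℝ ≃ₗ[ℝ] EuclideanSpace ℝ (Fin m × Fin n) where
  toFun X := WithLp.toLp 2 (fun q => X q.1 q.2)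
  invFun x := Matrix.of (fun i j => x (i, j))
  map_add' _ _ := rfl
  map_smul' _ _ := rfl
  left_inv _ := rfl
  right_inv _ := rfl

/-- The Frobenius norm. -/
def frobNorm {m n : ℕ} (X : Matrix (Fin m) (Fin n) ℝ) : ℝ := ‖matVec m n X‖

/-- The Euclidean norm of the `j`-th column. -/
def colNorm {m n : ℕ} (X : Matrix (Fin m) (Fin n) ℝ) (j : Fin n) : ℝ :=
  ‖(WithLp.toLp 2 (fun i => X i j) : EuclideanSpace ℝ (Fin m))‖

/-- `‖X‖_{2,0}`, the number of nonzero columns. -/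
def normTwoZero {m n : ℕ} (X : Matrix (Fin m) (Fin n) ℝ) : ℕ :=
  Set.ncard {j : Fin n | X.col j ≠ 0}

/-- The `i`-th largest singular value, counted from `i = 1`. -/
def singVal {m n : ℕ} (X : Matrix (Fin m) (Fin n) ℝ) (i : ℕ) : ℝ :=
  (Matrix.toEuclideanLin X).singularValues (i - 1)

/-! ### Sampling operators -/

/-- A linear operator from `m × n` matrices to `ℝ^p`. -/
abbrev SamplingOp (m n p : ℕ) : Type :=
  Matrix (Fin m) (Fin n) ℝ →ₗ[ℝ] EuclideanSpace ℝ (Fin p)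

variable {m n p : ℕ}

/-- The spectral norm `‖𝒜‖`, with respect to the Frobenius and Euclidean norms. -/
def opNorm (A : SamplingOp m n p) : ℝ :=
  ‖LinearMap.toContinuousLinearMap (A ∘ₗ (matVec m n).symm.toLinearMap)‖

/-- The `k`-restricted smallest eigenvalue of `𝒜*𝒜`. -/
def restrictedEigMin (A : SamplingOp m n p) (k : ℕ) : ℝ :=
  sInf ((fun X => ‖A X‖ ^ 2) '' {X | X.rank ≤ k ∧ frobNorm X = 1})

/-- The `k`-restricted largest eigenvalue of `𝒜*𝒜`. -/
def restrictedEigMax (A : SamplingOp m n p) (k : ℕ) : ℝ :=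
  sSup ((fun X => ‖A X‖ ^ 2) '' {X | X.rank ≤ k ∧ frobNorm X = 1})

/-- The least squares loss `f(X) = ½ ‖𝒜(X) - b‖²`. -/
def lsLoss (A : SamplingOp m n p) (b : EuclideanSpace ℝ (Fin p))
    (X : Matrix (Fin m) (Fin n) ℝ) : ℝ :=
  1 / 2 * ‖A X - b‖ ^ 2

/-- `𝒳*`, the set of global minimizers of `X ↦ ν f(X) + rank X`. -/
def rankRegSolutions (f : Matrix (Fin m) (Fin n) ℝ → ℝ) (ν : ℝ) :
    Set (Matrix (Fin m) (Fin n) ℝ) :=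
  {X | ∀ Y, ν * f X + X.rank ≤ ν * f Y + Y.rank}

/-! ### The factored problems -/

/-- `𝒲*`, the balanced factor pairs `(U, V)` of the elements of `𝒳*` of rank at most `κ` whose
numbers of nonzero columns are equal to the rank. -/
def balancedSolutions (f : Matrix (Fin m) (Fin n) ℝ → ℝ) (ν : ℝ) (κ : ℕ) :
    Set (Matrix (Fin m) (Fin κ) ℝ × Matrix (Fin n) (Fin κ) ℝ) :=
  {W | W.1 * W.2.transpose ∈ rankRegSolutions f ν ∩ {X | X.rank ≤ κ} ∧
    W.1.transpose * W.1 = W.2.transpose * W.2 ∧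
    normTwoZero W.1 = (W.1 * W.2.transpose).rank ∧
    normTwoZero W.2 = (W.1 * W.2.transpose).rank}

/-- The Euclidean space `ℝ^{m×κ} × ℝ^{n×κ}` of factor pairs, with squared norm
`‖U‖_F² + ‖V‖_F²`. -/
abbrev FactorSpace (m n κ : ℕ) : Type :=
  WithLp 2 (EuclideanSpace ℝ (Fin m × Fin κ) × EuclideanSpace ℝ (Fin n × Fin κ))

/-- The pair `(U, V)` as a point of the Euclidean space of factor pairs. -/
def toFactor {κ : ℕ} (U : Matrix (Fin m) (Fin κ) ℝ) (V : Matrix (Fin n) (Fin κ) ℝ) :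
    FactorSpace m n κ :=
  WithLp.toLp 2 (matVec m κ U, matVec n κ V)

/-- `F(U,V) = ν f(U Vᵀ) + (μ/4) ‖Uᵀ U - Vᵀ V‖_F²`. -/
def smoothPart (f : Matrix (Fin m) (Fin n) ℝ → ℝ) (ν μ : ℝ) {κ : ℕ}
    (U : Matrix (Fin m) (Fin κ) ℝ) (V : Matrix (Fin n) (Fin κ) ℝ) : ℝ :=
  ν * f (U * V.transpose) + μ / 4 * frobNorm (U.transpose * U - V.transpose * V) ^ 2

/-- `Θ_ρ(U,V) = F(U,V) + ½ ∑_j [θ(ρ‖U_j‖) + θ(ρ‖V_j‖)]`, on the space of factor pairs. -/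
def Theta (f : Matrix (Fin m) (Fin n) ℝ → ℝ) (ν μ : ℝ) (φ : ℝ → EReal) (ρ : ℝ) (κ : ℕ)
    (w : FactorSpace m n κ) : ℝ :=
  smoothPart f ν μ ((matVec m κ).symm w.fst) ((matVec n κ).symm w.snd) +
    1 / 2 * ∑ j : Fin κ, (theta φ (ρ * colNorm ((matVec m κ).symm w.fst) j) +
      theta φ (ρ * colNorm ((matVec n κ).symm w.snd) j))

/-- The exact penalty threshold
`ρ̄ = max(1, √ν ‖𝒜‖ √κ / (√(να) σ_r - √2) · √(1 + 2√r/√μ)) φ'₋(1)`. -/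
def penaltyThreshold (φ : ℝ → EReal) (ν μ α σr normA : ℝ) (κ r : ℕ) : ℝ :=
  max 1 (Real.sqrt ν * normA * Real.sqrt κ / (Real.sqrt (ν * α) * σr - Real.sqrt 2) *
    Real.sqrt (1 + 2 * Real.sqrt r / Real.sqrt μ)) * leftDerivAtOne φ

/-- The KL constant
`γ' = min(ν/β [(β+α)σ_r⁴ / (128 √(σ₁³) (4σ₁+σ_r)²) - √σ₁ (β-α)]², 2μσ_r, c²ρ²/8)`. -/
def klConstant (ν μ ρ c α β σ₁ σr : ℝ) : ℝ :=
  min (min (ν / β * ((β + α) * σr ^ 4 / (128 * Real.sqrt (σ₁ ^ 3) * (4 * σ₁ + σr) ^ 2)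
      - Real.sqrt σ₁ * (β - α)) ^ 2) (2 * μ * σr))
    (c ^ 2 * ρ ^ 2 / 8)

/-- The radius `min(√σ_r/4, ϖ/ρ, cρ/(4√ν‖𝒜‖ + 16μσ₁))`. -/
def klRadius (ν μ ρ ϖ c σ₁ σr normA : ℝ) : ℝ :=
  min (min (Real.sqrt σr / 4) (ϖ / ρ)) (c * ρ / (4 * Real.sqrt ν * normA + 16 * μ * σ₁))

end LowRankKL

end

open Set Filter Topology

noncomputable section

/-! Since `ν α σ_r² > 4`, giving up rank costs more in the loss than it saves, so `M` is the only
element of `𝒳*` (`eq_of_mem_rankRegSolutions`). Hence `𝒲*` consists of the balanced factorizations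
of `M` with exactly `r` nonzero columns, and `Θ_ρ = r` there, because `θ(0) = 0` and `θ = 1` beyond
`φ'₋(1)`.

Fix such a pair, with column support `J`, and a point within distance `R` of it. The columns in `J`
keep penalty one (`leftDeriv_le_mul_sub_klRadius`), which leaves two cases. If some column outside
`J` is nonzero, scaling it changes the penalty at rate at least `cρ/2` per unit length, while the
smooth part changes at rate at most `cρ/4`. Regular subgradients then have norm at least `cρ/4`,
which suffices because the gap is below `1/2`. If all columns outside `J` vanish, then `Θ_ρ - r` is
the smooth part, and the claim is an error bound for balanced factorization
(`klConstant_mul_smoothPart_le`). There the gradients of the loss and of the balancing term are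
orthogonal. Restricted isometry compares the loss gradient with `D V` and `Dᵀ U`, where `D = U Vᵀ -
M`, and these products control `D` (`mul_frobNorm_residual_sq_le`). A regular subgradient is only
ever tested against a direction along which `Θ_ρ` is differentiable, and the bound passes to
limiting subgradients.

For the last claim, an exact penalty argument (`mem_balancedSolutions_of_Theta_le`) shows that every
global minimizer of `Θ_ρ` lies in `𝒲*`: using fewer than `r` substantial columns leaves a residual
too expensive to repair with columns of small norm. -/

namespace LowRankKL

/-! ### Properties of `θ` derived from convexity of `φ`. -/

section PenaltyFunction

variable {φ : ℝ → EReal}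

lemma IsPenaltyGenerator.convexOn_toReal (hφ : IsPenaltyGenerator φ) :
    ConvexOn ℝ {t | φ t < ⊤} (fun t => (φ t).toReal) := by
  have key : ∀ ⦃x : ℝ⦄, φ x < ⊤ → ∀ ⦃y : ℝ⦄, φ y < ⊤ → ∀ ⦃a b : ℝ⦄, 0 ≤ a → 0 ≤ b → a + b = 1 →
      φ (a * x + b * y) ≤ ((a * (φ x).toReal + b * (φ y).toReal : ℝ) : EReal) := by
    intro x hx y hy a b ha hb hab
    have h1 : ((x, (φ x).toReal) : ℝ × ℝ) ∈ {q : ℝ × ℝ | φ q.1 ≤ (q.2 : EReal)} := by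
      simp [EReal.coe_toReal hx.ne (hφ.ne_bot x)]
    have h2 : ((y, (φ y).toReal) : ℝ × ℝ) ∈ {q : ℝ × ℝ | φ q.1 ≤ (q.2 : EReal)} := by
      simp [EReal.coe_toReal hy.ne (hφ.ne_bot y)]
    simpa using hφ.convex_epigraph h1 h2 ha hb hab
  refine ⟨fun x hx y hy a b ha hb hab => ?_, fun x hx y hy a b ha hb hab => ?_⟩
  · exact (key hx hy ha hb hab).trans_lt (EReal.coe_lt_top _)
  · have := EReal.toReal_le_toReal (key hx hy ha hb hab) (hφ.ne_bot _) (EReal.coe_ne_top _)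
    rwa [EReal.toReal_coe] at this

lemma IsPenaltyGenerator.lt_top (hφ : IsPenaltyGenerator φ) {t : ℝ} (ht : t ∈ Icc (0 : ℝ) 1) :
    φ t < ⊤ := by
  have : t ∈ {t | φ t < ⊤} := interior_subset (hφ.subset_interior_dom ht)
  exact this

lemma IsPenaltyGenerator.nonneg (hφ : IsPenaltyGenerator φ) {t : ℝ} (ht : t ∈ Icc (0 : ℝ) 1) :
    0 ≤ φ t := by
  obtain ⟨t₀, -, h0, h⟩ := hφ.exists_argmin
  exact h0 ▸ h t ht

/-- By convexity the chord from `t` to `1` has slope at most the left derivative at `1`. -/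
lemma IsPenaltyGenerator.slope_le (hφ : IsPenaltyGenerator φ) {t : ℝ} (ht : t ∈ Icc (0 : ℝ) 1) :
    1 - (φ t).toReal ≤ leftDerivAtOne φ * (1 - t) := by
  rcases ht.2.eq_or_lt with rfl | h1
  · simp [hφ.map_one]
  have := hφ.convexOn_toReal.slope_le_leftDeriv_of_mem_interior (hφ.lt_top ht)
    (hφ.subset_interior_dom ⟨zero_le_one, le_rfl⟩) h1
  rw [slope_def_field, div_le_iff₀ (by linarith)] at this
  simpa [hφ.map_one, leftDerivAtOne] using this

lemma IsPenaltyGenerator.leftDerivAtOne_pos (hφ : IsPenaltyGenerator φ) :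
    0 < leftDerivAtOne φ := by
  obtain ⟨t₀, ht, h0, -⟩ := hφ.exists_argmin
  have := hφ.slope_le ht
  rw [h0] at this
  simp only [EReal.toReal_zero, sub_zero] at this
  by_contra! h
  nlinarith [ht.2]

lemma conjugate_psi_le_iff (hφ : IsPenaltyGenerator φ) (s a : ℝ) :
    conjugate (psi φ) s ≤ (a : EReal) ↔
      ∀ t ∈ Icc (0 : ℝ) 1, s * t - (φ t).toReal ≤ a := by
  simp only [conjugate, iSup_le_iff]
  refine forall_congr' fun t => ?_
  by_cases ht : t ∈ Icc (0 : ℝ) 1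
  · simp only [psi, ht, if_true, forall_true_left]
    rw [← EReal.coe_toReal (hφ.lt_top ht).ne (hφ.ne_bot t), ← EReal.coe_sub,
      EReal.coe_le_coe_iff, EReal.toReal_coe]
  · simp [psi, ht]

lemma le_conjugate_psi (hφ : IsPenaltyGenerator φ) (s : ℝ) {t : ℝ} (ht : t ∈ Icc (0 : ℝ) 1) :
    ((s * t - (φ t).toReal : ℝ) : EReal) ≤ conjugate (psi φ) s := by
  refine le_trans (le_of_eq ?_) (le_iSup _ t)
  simp only [psi, ht, if_true]
  rw [EReal.coe_sub, EReal.coe_toReal (hφ.lt_top ht).ne (hφ.ne_bot t)]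

lemma conjugate_psi_le_self (hφ : IsPenaltyGenerator φ) {s : ℝ} (hs : 0 ≤ s) :
    conjugate (psi φ) s ≤ (s : EReal) := by
  rw [conjugate_psi_le_iff hφ]
  intro t ht
  have := EReal.toReal_nonneg (hφ.nonneg ht)
  nlinarith [ht.2]

lemma coe_toReal_conjugate_psi (hφ : IsPenaltyGenerator φ) {s : ℝ} (hs : 0 ≤ s) :
    ((conjugate (psi φ) s).toReal : EReal) = conjugate (psi φ) s := by
  refine EReal.coe_toReal ((conjugate_psi_le_self hφ hs).trans_lt (EReal.coe_lt_top _)).ne ?_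
  exact ((EReal.bot_lt_coe _).trans_le (le_conjugate_psi hφ s ⟨zero_le_one, le_rfl⟩)).ne'

/-- The point `1` in the supremum gives `ψ*(s) ≥ s - φ(1) = s - 1`. -/
lemma theta_le_one (hφ : IsPenaltyGenerator φ) (t : ℝ) : theta φ t ≤ 1 := by
  have h := le_conjugate_psi hφ |t| ⟨zero_le_one, le_rfl⟩
  rw [← coe_toReal_conjugate_psi hφ (abs_nonneg t), EReal.coe_le_coe_iff, hφ.map_one] at h
  simp only [mul_one, EReal.toReal_one] at h
  unfold theta
  linarith

lemma theta_zero (hφ : IsPenaltyGenerator φ) : theta φ 0 = 0 := by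
  obtain ⟨t₀, ht, h0, -⟩ := hφ.exists_argmin
  have h := le_conjugate_psi hφ 0 ht
  have h' := conjugate_psi_le_self hφ le_rfl
  rw [← coe_toReal_conjugate_psi hφ le_rfl, EReal.coe_le_coe_iff] at h h'
  simp only [h0, EReal.toReal_zero] at h
  simp only [theta, abs_zero]
  linarith

/-- For slopes `t ≥ φ'₋(1)` the supremum defining `ψ*(t)` is attained at the endpoint `1`. -/
lemma theta_eq_one (hφ : IsPenaltyGenerator φ) {t : ℝ} (ht : leftDerivAtOne φ ≤ t) :
    theta φ t = 1 := by
  have hpos := hφ.leftDerivAtOne_pos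
  refine le_antisymm (theta_le_one hφ t) ?_
  have ht0 : 0 ≤ t := by linarith
  have h : conjugate (psi φ) t ≤ ((t - 1 : ℝ) : EReal) := by
    rw [conjugate_psi_le_iff hφ]
    intro s hs
    have := hφ.slope_le hs
    nlinarith [hs.2]
  rw [← coe_toReal_conjugate_psi hφ ht0, EReal.coe_le_coe_iff] at h
  simp only [theta, abs_of_nonneg ht0]
  linarith

lemma theta_nonneg (hφ : IsPenaltyGenerator φ) {ϖ c : ℝ} (hθ : SlopeAssumption φ ϖ c) {t : ℝ}
    (ht : 0 ≤ t) : 0 ≤ theta φ t := by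
  rw [← theta_zero hφ]
  exact hθ.monotone self_mem_Ici ht ht

/-- Below `φ'₋(1)`, concavity puts `θ` above its chord from `(0, 0)` to `(φ'₋(1), 1)`. -/
lemma min_le_theta (hφ : IsPenaltyGenerator φ) {ϖ c : ℝ} (hθ : SlopeAssumption φ ϖ c) {t : ℝ}
    (ht : 0 ≤ t) : min 1 (t / leftDerivAtOne φ) ≤ theta φ t := by
  have hpos := hφ.leftDerivAtOne_pos
  rcases le_total (leftDerivAtOne φ) t with h | h
  · exact (min_le_left _ _).trans (theta_eq_one hφ h).ge
  · refine (min_le_right _ _).trans ?_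
    have h1 : t / leftDerivAtOne φ ≤ 1 := (div_le_one hpos).2 h
    have := hθ.concave.2 (x := 0) (y := leftDerivAtOne φ) self_mem_Ici hpos.le
      (sub_nonneg.2 h1) (div_nonneg ht hpos.le) (by ring)
    simpa [theta_zero hφ, theta_eq_one hφ le_rfl, div_mul_cancel₀ _ hpos.ne'] using this

lemma SlopeAssumption.mul_le_theta (hφ : IsPenaltyGenerator φ) {ϖ c : ℝ}
    (hθ : SlopeAssumption φ ϖ c) {t : ℝ} (ht : t ∈ Ioo 0 ϖ) : c * t ≤ theta φ t := by
  have hc : ContinuousOn (theta φ) (Ioo 0 ϖ) := fun x hx =>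
    (hθ.differentiable x hx).continuousAt.continuousWithinAt
  have key : ∀ s ∈ Ioo 0 t, c * (t - s) ≤ theta φ t := by
    intro s hs
    have h1 : Icc s t ⊆ Ioo 0 ϖ := fun x hx => ⟨hs.1.trans_le hx.1, hx.2.trans_lt ht.2⟩
    have := (convex_Icc s t).mul_sub_le_image_sub_of_le_deriv (C := c)
      (hc.mono h1)
      (fun x hx => (hθ.differentiable x (h1 (interior_subset hx))).differentiableWithinAt)
      (fun x hx => hθ.le_deriv x (h1 (interior_subset hx)))
      s (left_mem_Icc.2 hs.2.le) t (right_mem_Icc.2 hs.2.le) hs.2.le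
    have h2 := theta_nonneg hφ hθ hs.1.le
    linarith
  by_contra! h
  have hcp := hθ.c_pos
  have hn := theta_nonneg hφ hθ ht.1.le
  -- The estimate on `[s, t]` loses only `c s`. This `s` makes the loss half of the supposed
  -- deficit, so continuity of `θ` at `0` is not needed.
  have := key ((c * t - theta φ t) / (2 * c)) ⟨div_pos (by linarith) (by positivity), by
    rw [div_lt_iff₀ (by positivity)]; nlinarith [mul_pos hcp ht.1]⟩
  have h3 : c * ((c * t - theta φ t) / (2 * c)) = (c * t - theta φ t) / 2 := by field_simp
  linarith

/-- `θ` stays below `1` while growing at rate at least `c` on `(0, ϖ)`. This links the entries `ϖ/ρ`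
and `cρ/(…)` of the radius. -/
lemma SlopeAssumption.mul_le_one (hφ : IsPenaltyGenerator φ) {ϖ c : ℝ}
    (hθ : SlopeAssumption φ ϖ c) : c * ϖ ≤ 1 := by
  by_contra! h
  have hcp := hθ.c_pos
  have h1 : 1 / c < ϖ := by rw [div_lt_iff₀ hcp]; linarith
  obtain ⟨t, ht1, ht2⟩ := exists_between h1
  have h2 := hθ.mul_le_theta hφ ⟨(one_div_pos.2 hcp).trans ht1, ht2⟩
  rw [div_lt_iff₀ hcp] at ht1
  linarith [theta_le_one hφ t]

end PenaltyFunction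

/-! ### Singular values of a linear map via the eigenbasis of `T* T`. -/

section SingularValues

variable {E F : Type*} [NormedAddCommGroup E] [InnerProductSpace ℝ E] [FiniteDimensional ℝ E]
  [NormedAddCommGroup F] [InnerProductSpace ℝ F] [FiniteDimensional ℝ F] (T : E →ₗ[ℝ] F)

/-- An orthonormal basis of right singular vectors. -/
def rightSingularBasis : OrthonormalBasis (Fin (Module.finrank ℝ E)) ℝ E :=
  T.isSymmetric_adjoint_comp_self.eigenvectorBasis rfl

lemma inner_map_rightSingularBasis (i : Fin (Module.finrank ℝ E)) (x : E) :
    inner ℝ (T (rightSingularBasis T i)) (T x) =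
      T.singularValues i ^ 2 * inner ℝ (rightSingularBasis T i) x := by
  rw [← LinearMap.adjoint_inner_left, ← LinearMap.comp_apply, rightSingularBasis,
    T.isSymmetric_adjoint_comp_self.apply_eigenvectorBasis rfl i, T.sq_singularValues_fin rfl i,
    inner_smul_left]
  simp

lemma norm_map_rightSingularBasis (i : Fin (Module.finrank ℝ E)) :
    ‖T (rightSingularBasis T i)‖ = T.singularValues i := by
  have h := inner_map_rightSingularBasis T i (rightSingularBasis T i)
  rw [real_inner_self_eq_norm_sq, real_inner_self_eq_norm_sq,
    (rightSingularBasis T).norm_eq_one] at h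
  exact (sq_eq_sq₀ (norm_nonneg _) (T.singularValues_nonneg _)).1 (by linarith)

lemma norm_map_sq_eq_sum (x : E) :
    ‖T x‖ ^ 2 = ∑ i : Fin (Module.finrank ℝ E),
      T.singularValues i ^ 2 * inner ℝ (rightSingularBasis T i) x ^ 2 := by
  rw [← real_inner_self_eq_norm_sq]
  conv_lhs => enter [2]; rw [← (rightSingularBasis T).sum_repr' x]
  rw [map_sum, sum_inner]
  refine Finset.sum_congr rfl fun i _ => ?_
  rw [map_smul, real_inner_smul_left, inner_map_rightSingularBasis]
  ring

lemma norm_sq_eq_sum_inner_rightSingularBasis (x : E) :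
    ‖x‖ ^ 2 = ∑ i : Fin (Module.finrank ℝ E), inner ℝ (rightSingularBasis T i) x ^ 2 := by
  rw [← (rightSingularBasis T).sum_sq_norm_inner_right x]
  simp

lemma norm_map_le_singularValues_zero (x : E) : ‖T x‖ ≤ T.singularValues 0 * ‖x‖ := by
  have h0 := T.singularValues_nonneg 0
  refine abs_le_of_sq_le_sq' ?_ (by positivity) |>.2
  rw [norm_map_sq_eq_sum, mul_pow, norm_sq_eq_sum_inner_rightSingularBasis T, Finset.mul_sum]
  refine Finset.sum_le_sum fun i _ => mul_le_mul_of_nonneg_right ?_ (sq_nonneg _)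
  exact pow_le_pow_left₀ (T.singularValues_nonneg _) (T.singularValues_antitone (Nat.zero_le _)) 2

/-- Indexing starts at `0`, so index `r - 1` is the last nonzero singular value. Basis vectors of
index at least `r` lie in the kernel and contribute nothing to `x`. -/
lemma singularValues_mul_norm_le {r : ℕ} (hr : Module.finrank ℝ T.range = r) {x : E}
    (hx : x ∈ T.kerᗮ) : T.singularValues (r - 1) * ‖x‖ ≤ ‖T x‖ := by
  refine abs_le_of_sq_le_sq' ?_ (by positivity) |>.2
  rw [norm_map_sq_eq_sum, mul_pow, norm_sq_eq_sum_inner_rightSingularBasis T, Finset.mul_sum]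
  refine Finset.sum_le_sum fun i _ => ?_
  rcases lt_or_ge (i : ℕ) r with hi | hi
  · refine mul_le_mul_of_nonneg_right ?_ (sq_nonneg _)
    exact pow_le_pow_left₀ (T.singularValues_nonneg _) (T.singularValues_antitone (by omega)) 2
  · have h0 : T.singularValues i = 0 := T.singularValues_eq_zero_iff_le_finrank_range.2 (hr ▸ hi)
    have h1 : rightSingularBasis T i ∈ T.ker := by
      rw [LinearMap.mem_ker, ← norm_eq_zero, norm_map_rightSingularBasis, h0]
    rw [(Submodule.mem_orthogonal _ _).1 hx _ h1]
    simp

end SingularValues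

/-! ### Low-rank approximation and balanced factorizations. -/

section Matrices

variable {m n k : ℕ}

/-- A coordinate vector, as a point of Euclidean space. -/
abbrev evec (x : Fin k → ℝ) : EuclideanSpace ℝ (Fin k) := WithLp.toLp 2 x

lemma inner_evec (x y : Fin k → ℝ) : inner ℝ (evec x) (evec y) = x ⬝ᵥ y := by
  simp [PiLp.inner_apply, dotProduct, mul_comm]

lemma norm_evec_sq (x : Fin k → ℝ) : ‖evec x‖ ^ 2 = x ⬝ᵥ x := by
  rw [← real_inner_self_eq_norm_sq, inner_evec]

lemma finrank_range_toEuclideanLin (X : Matrix (Fin m) (Fin n) ℝ) :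
    Module.finrank ℝ (Matrix.toEuclideanLin X).range = X.rank := by
  rw [Matrix.toEuclideanLin_eq_toLin_orthonormal]
  exact (Matrix.rank_eq_finrank_range_toLin X _ _).symm

/-- The Frobenius inner product. -/
def frobInner (X Y : Matrix (Fin m) (Fin n) ℝ) : ℝ := inner ℝ (matVec m n X) (matVec m n Y)

lemma frobInner_eq_sum (X Y : Matrix (Fin m) (Fin n) ℝ) :
    frobInner X Y = ∑ i, ∑ j, X i j * Y i j := by
  have h : frobInner X Y = ∑ q : Fin m × Fin n, Y q.1 q.2 * X q.1 q.2 := rfl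
  simp only [h, Fintype.sum_prod_type, mul_comm]

lemma frobNorm_sq (X : Matrix (Fin m) (Fin n) ℝ) : frobNorm X ^ 2 = frobInner X X := by
  rw [frobNorm, frobInner, real_inner_self_eq_norm_sq]

lemma frobNorm_nonneg (X : Matrix (Fin m) (Fin n) ℝ) : 0 ≤ frobNorm X := norm_nonneg _

lemma frobInner_le (X Y : Matrix (Fin m) (Fin n) ℝ) :
    frobInner X Y ≤ frobNorm X * frobNorm Y := real_inner_le_norm _ _

lemma frobNorm_sq_eq_sum_row (X : Matrix (Fin m) (Fin n) ℝ) :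
    frobNorm X ^ 2 = ∑ i, ‖evec (X i)‖ ^ 2 := by
  rw [frobNorm_sq, frobInner_eq_sum]
  simp only [norm_evec_sq, dotProduct]

lemma frobNorm_sq_eq_sum_col (X : Matrix (Fin m) (Fin n) ℝ) :
    frobNorm X ^ 2 = ∑ j, colNorm X j ^ 2 := by
  rw [frobNorm_sq, frobInner_eq_sum, Finset.sum_comm]
  refine Finset.sum_congr rfl fun j _ => ?_
  exact (norm_evec_sq fun i => X i j).symm

/-- Bessel's inequality, applied to each row of `X`. -/
lemma sum_norm_map_sq_le_frobNorm_sq (X : Matrix (Fin m) (Fin n) ℝ) {ι : Type*} [Fintype ι]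
    {e : ι → EuclideanSpace ℝ (Fin n)} (he : Orthonormal ℝ e) :
    ∑ l, ‖Matrix.toEuclideanLin X (e l)‖ ^ 2 ≤ frobNorm X ^ 2 := by
  rw [frobNorm_sq_eq_sum_row]
  have h : ∀ l, ‖Matrix.toEuclideanLin X (e l)‖ ^ 2 =
      ∑ i, ‖inner ℝ (e l) (evec (X i))‖ ^ 2 := fun l => by
    rw [EuclideanSpace.norm_sq_eq]
    refine Finset.sum_congr rfl fun i _ => ?_
    rw [real_inner_comm, ← WithLp.toLp_ofLp 2 (e l)]
    congr 2
    exact (inner_evec (X i) (e l).ofLp).symm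
  simp only [h]
  rw [Finset.sum_comm]
  exact Finset.sum_le_sum fun i _ => he.sum_inner_products_le _

/-- The distance from a matrix of rank `r` to the matrices of rank at most `k`. -/
lemma sq_singVal_mul_le_frobNorm_sub_sq {M X : Matrix (Fin m) (Fin n) ℝ} {r : ℕ}
    (hM : M.rank = r) (hX : X.rank ≤ k) :
    singVal M r ^ 2 * ((r : ℝ) - k) ≤ frobNorm (X - M) ^ 2 := by
  set T := Matrix.toEuclideanLin M
  set S := Matrix.toEuclideanLin X
  have hT : Module.finrank ℝ T.range = r := by rw [finrank_range_toEuclideanLin, hM]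
  have hS : Module.finrank ℝ S.range ≤ k := by rwa [finrank_range_toEuclideanLin]
  -- On `W`, of dimension at least `r - k`, the map `X - M` acts as `-M` and stretches every vector
  -- by at least `σ_r`. Summing over an orthonormal basis of `W` gives the bound.
  set W := S.ker ⊓ T.kerᗮ
  have hW : (r : ℝ) - k ≤ Module.finrank ℝ W := by
    have h1 := Submodule.finrank_sup_add_finrank_inf_eq S.ker T.kerᗮ
    have h2 := Submodule.finrank_le (S.ker ⊔ T.kerᗮ)
    have h3 := S.finrank_range_add_finrank_ker
    have h4 := T.finrank_range_add_finrank_ker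
    have h5 := T.ker.finrank_add_finrank_orthogonal
    have h6 : r ≤ Module.finrank ℝ W + k := by
      change _ + Module.finrank ℝ W = _ at h1
      omega
    have : (r : ℝ) ≤ Module.finrank ℝ W + k := by exact_mod_cast h6
    linarith
  let e := stdOrthonormalBasis ℝ W
  have he : Orthonormal ℝ fun l => (e l : EuclideanSpace ℝ (Fin n)) :=
    e.orthonormal.comp_linearIsometry W.subtypeₗᵢ
  refine le_trans ?_ (sum_norm_map_sq_le_frobNorm_sq (X - M) he)
  have key : ∀ l, singVal M r ^ 2 ≤ ‖Matrix.toEuclideanLin (X - M) (e l)‖ ^ 2 := fun l => by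
    have h1 : S (e l) = 0 := (e l).2.1
    have h2 := singularValues_mul_norm_le T hT (e l).2.2
    have h3 : ‖(e l : EuclideanSpace ℝ (Fin n))‖ = 1 := he.1 l
    rw [h3, mul_one] at h2
    rw [map_sub, LinearMap.sub_apply, norm_sub_rev]
    change _ ≤ ‖T (e l) - S (e l)‖ ^ 2
    rw [h1, sub_zero]
    exact pow_le_pow_left₀ (T.singularValues_nonneg _) h2 2
  refine le_trans ?_ (Finset.sum_le_sum fun l _ => key l)
  rw [Finset.sum_const, nsmul_eq_mul, mul_comm]
  simpa using mul_le_mul_of_nonneg_right hW (sq_nonneg (singVal M r))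

lemma norm_mulVec_le_singVal_one (M : Matrix (Fin m) (Fin n) ℝ) (x : Fin n → ℝ) :
    ‖evec (M.mulVec x)‖ ≤ singVal M 1 * ‖evec x‖ :=
  norm_map_le_singularValues_zero (Matrix.toEuclideanLin M) (evec x)

lemma singVal_mul_norm_le {M : Matrix (Fin m) (Fin n) ℝ} {r : ℕ} (hM : M.rank = r)
    {x : Fin n → ℝ} (hx : ∀ y, M.mulVec y = 0 → y ⬝ᵥ x = 0) :
    singVal M r * ‖evec x‖ ≤ ‖evec (M.mulVec x)‖ := by
  refine singularValues_mul_norm_le (Matrix.toEuclideanLin M)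
    (by rw [finrank_range_toEuclideanLin, hM]) ((Submodule.mem_orthogonal _ _).2 fun y hy => ?_)
  have h : M.mulVec y.ofLp = 0 := congrArg WithLp.ofLp hy
  exact (inner_evec y.ofLp x).trans (hx _ h)

lemma singVal_pos {M : Matrix (Fin m) (Fin n) ℝ} {r : ℕ} (hr : 1 ≤ r) (hM : M.rank = r) :
    0 < singVal M r := by
  rw [singVal, LinearMap.singularValues_pos_iff_lt_finrank_range, finrank_range_toEuclideanLin]
  omega

lemma singVal_le_singVal_one (M : Matrix (Fin m) (Fin n) ℝ) (r : ℕ) :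
    singVal M r ≤ singVal M 1 :=
  (Matrix.toEuclideanLin M).singularValues_antitone (Nat.zero_le _)

/-- Balanced factors with only `M.rank` nonzero columns. -/
lemma exists_balanced_factors {κ : ℕ} (M : Matrix (Fin m) (Fin n) ℝ) (hκ : M.rank ≤ κ) :
    ∃ (U : Matrix (Fin m) (Fin κ) ℝ) (V : Matrix (Fin n) (Fin κ) ℝ),
      U * V.transpose = M ∧ U.transpose * U = V.transpose * V ∧
        ∀ j : Fin κ, M.rank ≤ j → (∀ i, U i j = 0) ∧ ∀ i, V i j = 0 := by
  set T := Matrix.toEuclideanLin M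
  have hn : Module.finrank ℝ (EuclideanSpace ℝ (Fin n)) = n := by simp
  have hrn : M.rank ≤ n := by simpa using M.rank_le_card_width
  have hr : ∀ i, M.rank ≤ i → T.singularValues i = 0 := fun i hi => by
    rwa [T.singularValues_eq_zero_iff_le_finrank_range, finrank_range_toEuclideanLin]
  -- Padding the singular basis by zero allows `κ` to be smaller or larger than `n`.
  let e : ℕ → EuclideanSpace ℝ (Fin n) := fun i =>
    if h : i < Module.finrank ℝ (EuclideanSpace ℝ (Fin n)) then rightSingularBasis T ⟨i, h⟩ else 0
  have he : ∀ j : Fin (Module.finrank ℝ (EuclideanSpace ℝ (Fin n))),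
      e j = rightSingularBasis T j := fun j => dif_pos j.2
  have he0 : ∀ i, ¬ i < Module.finrank ℝ (EuclideanSpace ℝ (Fin n)) → e i = 0 :=
    fun i hi => dif_neg hi
  have hTe : ∀ i k, inner ℝ (T (e i)) (T (e k)) = T.singularValues i ^ 2 * inner ℝ (e i) (e k) := by
    intro i k
    by_cases h : i < Module.finrank ℝ (EuclideanSpace ℝ (Fin n))
    · rw [he ⟨i, h⟩]
      exact inner_map_rightSingularBasis T ⟨i, h⟩ _
    · rw [he0 i h, map_zero, inner_zero_left, inner_zero_left, mul_zero]
  have horth : ∀ i k, i ≠ k → inner ℝ (e i) (e k) = 0 := by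
    intro i k hik
    by_cases h : i < Module.finrank ℝ (EuclideanSpace ℝ (Fin n))
    · by_cases h' : k < Module.finrank ℝ (EuclideanSpace ℝ (Fin n))
      · rw [he ⟨i, h⟩, he ⟨k, h'⟩]
        exact (rightSingularBasis T).inner_eq_zero (by simpa using hik)
      · rw [he0 k h', inner_zero_right]
    · rw [he0 i h, inner_zero_left]
  have hzero : ∀ i, T.singularValues i = 0 → T (e i) = 0 := fun i hi => by
    have := hTe i i
    rw [hi] at this
    simpa using this
  have hcol : ∀ (l : Fin n) (i : Fin m), M i l = T (EuclideanSpace.single l 1) i := fun l i => by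
    simp [T, Matrix.toEuclideanLin]
  -- The columns are `σ_j^{-1/2} M v_j` and `σ_j^{1/2} v_j`. Both vanish when `σ_j = 0`, because
  -- `0⁻¹ = 0`.
  refine ⟨Matrix.of fun i j => (√(T.singularValues j))⁻¹ * T (e j) i,
    Matrix.of fun i j => √(T.singularValues j) * e j i, ?_, ?_, ?_⟩
  · ext i l
    have h1 : ∀ j : ℕ, ((√(T.singularValues j))⁻¹ * T (e j) i) * (√(T.singularValues j) * e j l) =
        T (e j) i * e j l := fun j => by
      by_cases hj : T.singularValues j = 0
      · simp [hzero j hj]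
      · have : √(T.singularValues j) ≠ 0 :=
          (Real.sqrt_pos.2 ((T.singularValues_pos_iff_ne_zero j).2 hj)).ne'
        field_simp
    simp only [Matrix.mul_apply, Matrix.of_apply, Matrix.transpose_apply, h1]
    -- Terms beyond the rank vanish, so the sums over `κ` and over `n` indices agree.
    have h2 : ∀ N, M.rank ≤ N → ∑ j ∈ Finset.range N, T (e j) i * e j l =
        ∑ j ∈ Finset.range M.rank, T (e j) i * e j l := fun N hN => by
      refine (Finset.sum_subset (Finset.range_mono hN) fun j _ hj => ?_).symm
      rw [hzero j (hr j (by simpa using hj))]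
      simp
    rw [Fin.sum_univ_eq_sum_range (fun j => T (e j) i * e j l), h2 κ hκ, ← h2 _ (hrn.trans hn.ge),
      ← Fin.sum_univ_eq_sum_range (fun j => T (e j) i * e j l), hcol]
    conv_rhs => rw [← (rightSingularBasis T).sum_repr' (EuclideanSpace.single l 1)]
    rw [map_sum, WithLp.ofLp_sum, Finset.sum_apply]
    refine Finset.sum_congr rfl fun j _ => ?_
    rw [he]
    simp [EuclideanSpace.inner_single_right, mul_comm]
  · ext j k
    have h2 : ∀ (q : ℕ) (a b : ℝ) (x y : EuclideanSpace ℝ (Fin q)),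
        ∑ i, a * x i * (b * y i) = a * b * inner ℝ x y := fun q a b x y => by
      simp only [PiLp.inner_apply, Finset.mul_sum, RCLike.inner_apply, conj_trivial]
      exact Finset.sum_congr rfl fun i _ => by ring
    simp only [Matrix.mul_apply, Matrix.of_apply, Matrix.transpose_apply, h2, hTe]
    by_cases hjk : (j : ℕ) = k
    · rw [← hjk, ← mul_assoc]
      congr 1
      by_cases hj : T.singularValues j = 0
      · simp [hj]
      · rw [← mul_inv, Real.mul_self_sqrt (T.singularValues_nonneg _)]
        field_simp
    · simp [horth _ _ hjk]
  · intro j hj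
    simp [hr j hj]

end Matrices

/-! ### Frobenius and column norms, products and ranks. -/

section FrobeniusNorm

variable {m n k : ℕ}

lemma colNorm_mul (U : Matrix (Fin m) (Fin k) ℝ) (Y : Matrix (Fin k) (Fin n) ℝ) (j : Fin n) :
    colNorm (U * Y) j = ‖evec (U.mulVec (Y.col j))‖ := rfl

lemma frobNorm_mul_le {U : Matrix (Fin m) (Fin k) ℝ} {u : ℝ} (hu : 0 ≤ u)
    (h : ∀ x, ‖evec (U.mulVec x)‖ ≤ u * ‖evec x‖) (Y : Matrix (Fin k) (Fin n) ℝ) :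
    frobNorm (U * Y) ≤ u * frobNorm Y := by
  refine abs_le_of_sq_le_sq' ?_ (mul_nonneg hu (frobNorm_nonneg _)) |>.2
  rw [mul_pow, frobNorm_sq_eq_sum_col, frobNorm_sq_eq_sum_col, Finset.mul_sum]
  refine Finset.sum_le_sum fun j _ => ?_
  rw [colNorm_mul, ← mul_pow]
  exact pow_le_pow_left₀ (norm_nonneg _) (h _) 2

/-- The lower bound is asked only on the columns of `Y`, so `U` may have zero columns as long as `Y`
avoids them. -/
lemma le_frobNorm_mul {U : Matrix (Fin m) (Fin k) ℝ} {l : ℝ} (hl : 0 ≤ l)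
    {Y : Matrix (Fin k) (Fin n) ℝ}
    (h : ∀ j, l * ‖evec (Y.col j)‖ ≤ ‖evec (U.mulVec (Y.col j))‖) :
    l * frobNorm Y ≤ frobNorm (U * Y) := by
  refine abs_le_of_sq_le_sq' ?_ (frobNorm_nonneg _) |>.2
  rw [mul_pow, frobNorm_sq_eq_sum_col, frobNorm_sq_eq_sum_col, Finset.mul_sum]
  refine Finset.sum_le_sum fun j _ => ?_
  rw [colNorm_mul, ← mul_pow]
  exact pow_le_pow_left₀ (mul_nonneg hl (norm_nonneg _)) (h _) 2

lemma frobInner_transpose (X Y : Matrix (Fin m) (Fin n) ℝ) :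
    frobInner X.transpose Y.transpose = frobInner X Y := by
  rw [frobInner_eq_sum, frobInner_eq_sum, Finset.sum_comm]
  rfl

lemma frobNorm_transpose (X : Matrix (Fin m) (Fin n) ℝ) : frobNorm X.transpose = frobNorm X := by
  rw [← sq_eq_sq₀ (frobNorm_nonneg _) (frobNorm_nonneg _), frobNorm_sq, frobNorm_sq,
    frobInner_transpose]

lemma frobInner_eq_trace (X Y : Matrix (Fin m) (Fin n) ℝ) :
    frobInner X Y = (X.transpose * Y).trace := by
  rw [frobInner_eq_sum, Finset.sum_comm]
  rfl

lemma frobInner_mul_left (U : Matrix (Fin m) (Fin k) ℝ) (Y : Matrix (Fin k) (Fin n) ℝ)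
    (X : Matrix (Fin m) (Fin n) ℝ) :
    frobInner X (U * Y) = frobInner (U.transpose * X) Y := by
  rw [frobInner_eq_trace, frobInner_eq_trace, Matrix.transpose_mul, Matrix.transpose_transpose,
    Matrix.mul_assoc]

lemma frobInner_mul_right (U : Matrix (Fin m) (Fin k) ℝ) (Y : Matrix (Fin k) (Fin n) ℝ)
    (X : Matrix (Fin m) (Fin n) ℝ) :
    frobInner X (U * Y) = frobInner (X * Y.transpose) U := by
  rw [frobInner_eq_trace, frobInner_eq_trace, Matrix.transpose_mul, Matrix.transpose_transpose,
    Matrix.mul_assoc, ← Matrix.mul_assoc, Matrix.trace_mul_comm]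

lemma norm_mulVec_le_frobNorm (X : Matrix (Fin m) (Fin n) ℝ) (x : Fin n → ℝ) :
    ‖evec (X.mulVec x)‖ ≤ frobNorm X * ‖evec x‖ := by
  refine abs_le_of_sq_le_sq' ?_ (mul_nonneg (frobNorm_nonneg _) (norm_nonneg _)) |>.2
  rw [mul_pow, frobNorm_sq_eq_sum_row, Finset.sum_mul, EuclideanSpace.norm_sq_eq]
  refine Finset.sum_le_sum fun i _ => ?_
  rw [← mul_pow, Real.norm_eq_abs, sq_abs]
  refine sq_le_sq' ?_ ?_
  · have := neg_le_of_abs_le (abs_real_inner_le_norm (evec (X i)) (evec x))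
    rwa [inner_evec] at this
  · have := real_inner_le_norm (evec (X i)) (evec x)
    rwa [inner_evec] at this

lemma colNorm_nonneg (X : Matrix (Fin m) (Fin n) ℝ) (j : Fin n) : 0 ≤ colNorm X j :=
  norm_nonneg _

lemma colNorm_le_frobNorm (X : Matrix (Fin m) (Fin n) ℝ) (j : Fin n) :
    colNorm X j ≤ frobNorm X := by
  refine abs_le_of_sq_le_sq' ?_ (frobNorm_nonneg _) |>.2
  rw [frobNorm_sq_eq_sum_col]
  exact Finset.single_le_sum (f := fun j => colNorm X j ^ 2) (fun _ _ => sq_nonneg _)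
    (Finset.mem_univ j)

lemma colNorm_sub_le (X Y : Matrix (Fin m) (Fin n) ℝ) (j : Fin n) :
    colNorm X j - colNorm Y j ≤ colNorm (X - Y) j :=
  norm_sub_norm_le (evec (X.col j)) (evec (Y.col j))

lemma colNorm_eq_zero {X : Matrix (Fin m) (Fin n) ℝ} {j : Fin n} :
    colNorm X j = 0 ↔ ∀ i, X i j = 0 := by
  rw [colNorm, norm_eq_zero]
  constructor
  · intro h i
    exact congrArg (fun x : EuclideanSpace ℝ (Fin m) => x i) h
  · intro h
    ext i
    exact h i

lemma colNorm_sq (X : Matrix (Fin m) (Fin n) ℝ) (j : Fin n) :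
    colNorm X j ^ 2 = (X.transpose * X) j j :=
  norm_evec_sq _

lemma abs_apply_le_frobNorm (X : Matrix (Fin m) (Fin n) ℝ) (i : Fin m) (j : Fin n) :
    |X i j| ≤ frobNorm X :=
  PiLp.norm_apply_le (matVec m n X) (i, j)

lemma frobNorm_eq_zero {X : Matrix (Fin m) (Fin n) ℝ} : frobNorm X = 0 ↔ X = 0 := by
  rw [frobNorm, norm_eq_zero, LinearEquiv.map_eq_zero_iff]

lemma frobNorm_smul (a : ℝ) (X : Matrix (Fin m) (Fin n) ℝ) :
    frobNorm (a • X) = |a| * frobNorm X := by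
  rw [frobNorm, map_smul, norm_smul, Real.norm_eq_abs, frobNorm]

lemma rank_smul_le (a : ℝ) (X : Matrix (Fin m) (Fin n) ℝ) : (a • X).rank ≤ X.rank := by
  have : a • X = (a • (1 : Matrix (Fin m) (Fin m) ℝ)) * X := by simp
  rw [this]
  exact Matrix.rank_mul_le_right _ _

lemma rank_neg (X : Matrix (Fin m) (Fin n) ℝ) : (-X).rank ≤ X.rank := by
  simpa using rank_smul_le (-1) X

lemma rank_add_le (X Y : Matrix (Fin m) (Fin n) ℝ) : (X + Y).rank ≤ X.rank + Y.rank := by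
  have h : (X + Y).mulVecLin.range ≤ X.mulVecLin.range ⊔ Y.mulVecLin.range := by
    rw [Matrix.mulVecLin_add]
    exact LinearMap.range_add_le _ _
  exact (Submodule.finrank_mono h).trans (Submodule.finrank_add_le_finrank_add_finrank _ _)

lemma rank_sub_le (X Y : Matrix (Fin m) (Fin n) ℝ) : (X - Y).rank ≤ X.rank + Y.rank := by
  rw [sub_eq_add_neg]
  exact (rank_add_le _ _).trans (Nat.add_le_add_left (rank_neg Y) _)

/-- The rank is at most the number of columns outside which the matrix vanishes. -/
lemma rank_le_of_zero_columns {X : Matrix (Fin m) (Fin n) ℝ} {J : Finset (Fin n)}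
    (h : ∀ j ∉ J, ∀ i, X i j = 0) : X.rank ≤ J.card := by
  rw [Matrix.rank_eq_finrank_span_cols]
  have hle : Submodule.span ℝ (range X.col) ≤ Submodule.span ℝ ((J.image X.col : Finset _) : Set _) := by
    rw [Submodule.span_le]
    rintro _ ⟨j, rfl⟩
    by_cases hj : j ∈ J
    · exact Submodule.subset_span (by simpa using ⟨j, hj, rfl⟩)
    · have : X.col j = 0 := funext fun i => h j hj i
      rw [this]
      exact Submodule.zero_mem _
  exact (Submodule.finrank_mono hle).trans ((finrank_span_finset_le_card _).trans
    Finset.card_image_le)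

end FrobeniusNorm

/-! ### Restricted isometry estimates. -/

section RestrictedEigenvalues

variable {m n p k : ℕ} (A : SamplingOp m n p)

lemma opNorm_nonneg : 0 ≤ opNorm A := norm_nonneg _

lemma norm_apply_le_opNorm (X : Matrix (Fin m) (Fin n) ℝ) : ‖A X‖ ≤ opNorm A * frobNorm X := by
  have := (LinearMap.toContinuousLinearMap (A ∘ₗ (matVec m n).symm.toLinearMap)).le_opNorm
    (matVec m n X)
  simpa [opNorm, frobNorm] using this

lemma norm_apply_sq_div {X : Matrix (Fin m) (Fin n) ℝ} (hX : X ≠ 0) (hk : X.rank ≤ k) :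
    ‖A X‖ ^ 2 / frobNorm X ^ 2 ∈
      (fun X => ‖A X‖ ^ 2) '' {X | X.rank ≤ k ∧ frobNorm X = 1} := by
  have h : frobNorm X ≠ 0 := frobNorm_eq_zero.not.2 hX
  refine ⟨(frobNorm X)⁻¹ • X, ⟨(rank_smul_le _ _).trans hk, ?_⟩, ?_⟩
  · rw [frobNorm_smul, abs_of_nonneg (inv_nonneg.2 (frobNorm_nonneg _)), inv_mul_cancel₀ h]
  · simp only [map_smul, norm_smul, mul_pow, norm_inv, Real.norm_eq_abs, inv_pow, sq_abs]
    field_simp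

lemma restrictedEigMin_mul_le {X : Matrix (Fin m) (Fin n) ℝ} (hk : X.rank ≤ k) :
    restrictedEigMin A k * frobNorm X ^ 2 ≤ ‖A X‖ ^ 2 := by
  by_cases hX : X = 0
  · simp [hX, frobNorm]
  have h : 0 < frobNorm X := (frobNorm_nonneg X).lt_of_ne' (frobNorm_eq_zero.not.2 hX)
  rw [← le_div_iff₀ (by positivity)]
  refine csInf_le ⟨0, ?_⟩ (norm_apply_sq_div A hX hk)
  rintro _ ⟨Y, -, rfl⟩
  exact sq_nonneg _

lemma le_restrictedEigMax_mul {X : Matrix (Fin m) (Fin n) ℝ} (hk : X.rank ≤ k) :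
    ‖A X‖ ^ 2 ≤ restrictedEigMax A k * frobNorm X ^ 2 := by
  by_cases hX : X = 0
  · simp [hX, frobNorm]
  have h : 0 < frobNorm X := (frobNorm_nonneg X).lt_of_ne' (frobNorm_eq_zero.not.2 hX)
  rw [← div_le_iff₀ (by positivity)]
  refine le_csSup ⟨opNorm A ^ 2, ?_⟩ (norm_apply_sq_div A hX hk)
  rintro _ ⟨Y, hY, rfl⟩
  have := norm_apply_le_opNorm A Y
  rw [hY.2, mul_one] at this
  exact pow_le_pow_left₀ (norm_nonneg _) this 2

/-- A restricted isometry estimate for inner products. -/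
lemma le_inner_apply_of_forall_smul {α β : ℝ} {X Y : Matrix (Fin m) (Fin n) ℝ}
    (hα : ∀ t : ℝ, α * frobNorm (X + t • Y) ^ 2 ≤ ‖A (X + t • Y)‖ ^ 2)
    (hβ : ∀ t : ℝ, ‖A (X + t • Y)‖ ^ 2 ≤ β * frobNorm (X + t • Y) ^ 2) :
    (α + β) / 2 * frobInner X Y - (β - α) / 2 * (frobNorm X * frobNorm Y) ≤
      inner ℝ (A X) (A Y) := by
  by_cases hX : X = 0
  · simp [hX, frobNorm, frobInner]
  by_cases hY : Y = 0
  · simp [hY, frobNorm, frobInner]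
  have hX' : 0 < frobNorm X := (frobNorm_nonneg X).lt_of_ne' (frobNorm_eq_zero.not.2 hX)
  have hY' : 0 < frobNorm Y := (frobNorm_nonneg Y).lt_of_ne' (frobNorm_eq_zero.not.2 hY)
  -- This `t` equalizes `‖X‖` and `‖t Y‖`. The lower bound at `t` minus the upper bound at `-t`
  -- leaves `4 t ⟪A X, A Y⟫`, with an error proportional to `(β - α) ‖X‖ ‖Y‖`.
  set t := frobNorm X / frobNorm Y with ht
  have htpos : 0 < t := by positivity
  have htY : t * frobNorm Y = frobNorm X := div_mul_cancel₀ _ hY'.ne'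
  have expand : ∀ s : ℝ, frobNorm (X + s • Y) ^ 2 =
      frobNorm X ^ 2 + 2 * s * frobInner X Y + s ^ 2 * frobNorm Y ^ 2 := fun s => by
    simp only [frobNorm, frobInner, map_add, map_smul]
    rw [norm_add_sq_real, norm_smul, real_inner_smul_right, mul_pow, Real.norm_eq_abs, sq_abs]
    ring
  have expand' : ∀ s : ℝ, ‖A (X + s • Y)‖ ^ 2 =
      ‖A X‖ ^ 2 + 2 * s * inner ℝ (A X) (A Y) + s ^ 2 * ‖A Y‖ ^ 2 := fun s => by
    simp only [map_add, map_smul]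
    rw [norm_add_sq_real, norm_smul, real_inner_smul_right, mul_pow, Real.norm_eq_abs, sq_abs]
    ring
  have h1 := hα t
  have h2 := hβ (-t)
  rw [expand, expand'] at h1 h2
  have h3 : t * ((α + β) / 2 * frobInner X Y - (β - α) / 2 * (frobNorm X * frobNorm Y)) ≤
      t * inner ℝ (A X) (A Y) := by
    have h4 : t * (frobNorm X * frobNorm Y) = frobNorm X ^ 2 := by rw [← htY]; ring
    have h5 : t ^ 2 * frobNorm Y ^ 2 = frobNorm X ^ 2 := by rw [← htY]; ring
    rw [neg_sq, h5] at h2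
    rw [h5] at h1
    linear_combination (h1 + h2) / 4 - (β - α) / 2 * h4
  exact le_of_mul_le_mul_left h3 htpos

end RestrictedEigenvalues

/-! ### Spectral bounds for the factors of a balanced factorization. -/

section BalancedFactors

variable {m n κ r : ℕ} {M : Matrix (Fin m) (Fin n) ℝ}
  {U : Matrix (Fin m) (Fin κ) ℝ} {V : Matrix (Fin n) (Fin κ) ℝ}

lemma norm_mulVec_eq_of_balanced (hUV : U.transpose * U = V.transpose * V) (x : Fin κ → ℝ) :
    ‖evec (U.mulVec x)‖ = ‖evec (V.mulVec x)‖ := by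
  have h : ∀ {q : ℕ} (W : Matrix (Fin q) (Fin κ) ℝ),
      ‖evec (W.mulVec x)‖ ^ 2 = x ⬝ᵥ (W.transpose * W).mulVec x := fun W => by
    rw [norm_evec_sq, ← Matrix.mulVec_mulVec, Matrix.dotProduct_mulVec x, Matrix.vecMul_transpose]
  rw [← sq_eq_sq₀ (norm_nonneg _) (norm_nonneg _), h, h, hUV]

lemma norm_transpose_mulVec_sq_le (U : Matrix (Fin m) (Fin κ) ℝ) (x : Fin κ → ℝ) :
    ‖evec ((U.transpose * U).mulVec x)‖ ^ 2 ≤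
      ‖evec (U.mulVec ((U.transpose * U).mulVec x))‖ * ‖evec (U.mulVec x)‖ := by
  refine le_trans (le_of_eq ?_) (real_inner_le_norm _ _)
  have h : ∀ y, y ⬝ᵥ (U.transpose * U).mulVec x = U.mulVec y ⬝ᵥ U.mulVec x := fun y => by
    rw [← Matrix.mulVec_mulVec, Matrix.dotProduct_mulVec, Matrix.vecMul_transpose]
  rw [norm_evec_sq, inner_evec, h]

lemma norm_mulVec_sq_le (U : Matrix (Fin m) (Fin κ) ℝ) (x : Fin κ → ℝ) :
    ‖evec (U.mulVec x)‖ ^ 2 ≤ ‖evec x‖ * ‖evec ((U.transpose * U).mulVec x)‖ := by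
  refine le_trans (le_of_eq ?_) (real_inner_le_norm _ _)
  rw [norm_evec_sq, inner_evec, ← Matrix.mulVec_mulVec, Matrix.dotProduct_mulVec x,
    Matrix.vecMul_transpose]

/-- Balance is what lets the singular values of `M` act on the factors: `U Uᵀ U = U Vᵀ V = M V`. -/
lemma mulVec_gram_eq (hM : U * V.transpose = M) (hUV : U.transpose * U = V.transpose * V)
    (x : Fin κ → ℝ) :
    U.mulVec ((U.transpose * U).mulVec x) = M.mulVec (V.mulVec x) := by
  rw [hUV, ← hM, Matrix.mulVec_mulVec, Matrix.mulVec_mulVec, Matrix.mul_assoc]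

/-- With `G = Uᵀ U`, Cauchy–Schwarz gives `‖Ux‖² ≤ ‖x‖ ‖Gx‖` and `‖Gx‖² ≤ ‖UGx‖ ‖Ux‖`. Moreover
`‖UGx‖ = ‖MVx‖ ≤ σ₁ ‖Ux‖`. Eliminating `Gx` leaves the bound. -/
lemma norm_mulVec_le_of_balanced (hM : U * V.transpose = M)
    (hUV : U.transpose * U = V.transpose * V) (x : Fin κ → ℝ) :
    ‖evec (U.mulVec x)‖ ≤ √(singVal M 1) * ‖evec x‖ := by
  have h1 := norm_transpose_mulVec_sq_le U x
  have h2 := norm_mulVec_sq_le U x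
  have h3 := norm_mulVec_le_singVal_one M (V.mulVec x)
  rw [← mulVec_gram_eq hM hUV, ← norm_mulVec_eq_of_balanced hUV] at h3
  have hσ : 0 ≤ singVal M 1 := LinearMap.singularValues_nonneg _ _
  set a := ‖evec (U.mulVec x)‖
  set b := ‖evec (U.mulVec ((U.transpose * U).mulVec x))‖
  set q := ‖evec ((U.transpose * U).mulVec x)‖
  set t := ‖evec x‖
  have ha : 0 ≤ a := norm_nonneg _
  have hq : 0 ≤ q := norm_nonneg _
  have ht : 0 ≤ t := norm_nonneg _
  rcases ha.eq_or_lt with ha0 | ha0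
  · rw [← ha0]; positivity
  refine abs_le_of_sq_le_sq' ?_ (by positivity) |>.2
  rw [mul_pow, Real.sq_sqrt hσ]
  have h4 : q ^ 2 ≤ singVal M 1 * a ^ 2 := by nlinarith
  have h5 : a ^ 2 * a ^ 2 ≤ (singVal M 1 * t ^ 2) * a ^ 2 := by
    calc a ^ 2 * a ^ 2 ≤ (t * q) * (t * q) := by gcongr
      _ = t ^ 2 * q ^ 2 := by ring
      _ ≤ t ^ 2 * (singVal M 1 * a ^ 2) := by gcongr
      _ = _ := by ring
  exact le_of_mul_le_mul_right h5 (by positivity)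

/-- A dimension count: the range of `Uᵀ U` lies in the coordinate subspace of `J` and has dimension
at least `rank M ≥ |J|`. -/
lemma exists_gram_mulVec_eq {J : Finset (Fin κ)} (hM : U * V.transpose = M)
    (hJ : J.card ≤ M.rank) (hU : ∀ j ∉ J, ∀ i, U i j = 0) {z : Fin κ → ℝ}
    (hz : ∀ j ∉ J, z j = 0) : ∃ x, (U.transpose * U).mulVec x = z := by
  let S : Submodule ℝ (Fin κ → ℝ) :=
    { carrier := {z | ∀ j ∉ J, z j = 0}
      add_mem' := fun {a b} ha hb j hj => by simp [ha j hj, hb j hj]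
      zero_mem' := fun _ _ => rfl
      smul_mem' := fun c a ha j hj => by simp [ha j hj] }
  have hS : Module.finrank ℝ S ≤ J.card := by
    let L : S →ₗ[ℝ] (J → ℝ) := (LinearMap.funLeft ℝ ℝ (fun j : J => (j : Fin κ))) ∘ₗ S.subtype
    have hL : Function.Injective L := by
      rw [← LinearMap.ker_eq_bot, LinearMap.ker_eq_bot']
      intro a ha
      ext j
      by_cases hj : j ∈ J
      · exact congrFun ha ⟨j, hj⟩
      · exact a.2 j hj
    simpa using LinearMap.finrank_le_finrank_of_injective hL
  have hle : (U.transpose * U).mulVecLin.range ≤ S := by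
    rintro _ ⟨x, rfl⟩ j hj
    simp only [Matrix.mulVecLin_apply, Matrix.mulVec, dotProduct, Matrix.mul_apply,
      Matrix.transpose_apply, hU j hj, zero_mul, Finset.sum_const_zero]
  have hrank : J.card ≤ (U.transpose * U).rank := by
    rw [Matrix.rank_transpose_mul_self]
    exact hJ.trans (hM ▸ Matrix.rank_mul_le_left _ _)
  have heq := Submodule.eq_of_le_of_finrank_le hle (hS.trans hrank)
  have hzS : z ∈ S := hz
  rw [← heq] at hzS
  exact hzS

/-- Write `z = Uᵀ U x`. Then `‖z‖² ≤ ‖Uz‖ ‖Ux‖`, and `‖Uz‖ = ‖MVx‖ ≥ σ_r ‖Ux‖` because `Vx` is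
orthogonal to `ker M`. -/
lemma le_norm_mulVec_of_balanced {J : Finset (Fin κ)} (hM : U * V.transpose = M)
    (hUV : U.transpose * U = V.transpose * V) (hr : 1 ≤ r) (hMr : M.rank = r)
    (hJ : J.card ≤ r) (hU : ∀ j ∉ J, ∀ i, U i j = 0) {z : Fin κ → ℝ} (hz : ∀ j ∉ J, z j = 0) :
    √(singVal M r) * ‖evec z‖ ≤ ‖evec (U.mulVec z)‖ := by
  obtain ⟨x, rfl⟩ := exists_gram_mulVec_eq hM (hMr ▸ hJ) hU hz
  have h1 := norm_transpose_mulVec_sq_le U x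
  -- If `U Vᵀ y = 0`, then `V Vᵀ y = 0` because the Gram matrices agree, hence `Vᵀ y = 0`.
  have hker : ∀ y, M.mulVec y = 0 → y ⬝ᵥ V.mulVec x = 0 := fun y hy => by
    rw [← hM, ← Matrix.mulVec_mulVec] at hy
    have h2 := norm_mulVec_eq_of_balanced hUV (V.transpose.mulVec y)
    rw [hy, show evec (0 : Fin m → ℝ) = 0 from rfl, norm_zero] at h2
    have h3 : V.mulVec (V.transpose.mulVec y) = 0 :=
      congrArg WithLp.ofLp (norm_eq_zero.1 h2.symm)
    have h4 : V.transpose.mulVec y ⬝ᵥ V.transpose.mulVec y = 0 := by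
      rw [Matrix.dotProduct_mulVec, Matrix.vecMul_transpose, h3, zero_dotProduct]
    rw [Matrix.dotProduct_mulVec, ← Matrix.mulVec_transpose, dotProduct_self_eq_zero.1 h4,
      zero_dotProduct]
  have h3 := singVal_mul_norm_le hMr hker
  rw [← mulVec_gram_eq hM hUV, ← norm_mulVec_eq_of_balanced hUV] at h3
  have hσ := singVal_pos hr hMr
  refine abs_le_of_sq_le_sq' ?_ (norm_nonneg _) |>.2
  rw [mul_pow, Real.sq_sqrt hσ.le]
  have hb := norm_nonneg (evec (U.mulVec ((U.transpose * U).mulVec x)))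
  nlinarith

lemma norm_mulVec_sub_le (W Z : Matrix (Fin m) (Fin κ) ℝ) (x : Fin κ → ℝ) :
    |‖evec (W.mulVec x)‖ - ‖evec (Z.mulVec x)‖| ≤ frobNorm (W - Z) * ‖evec x‖ := by
  refine (abs_norm_sub_norm_le _ _).trans (le_trans (le_of_eq ?_) (norm_mulVec_le_frobNorm _ _))
  rw [Matrix.sub_mulVec]
  rfl

end BalancedFactors

/-! ### Lower bounds for the gradient of the smooth part. -/

section GradientInequality

variable {m n p κ k r : ℕ}

lemma exists_orthogonal_projection (U : Matrix (Fin m) (Fin κ) ℝ) :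
    ∃ P : Matrix (Fin m) (Fin m) ℝ, P.transpose = P ∧ P * P = P ∧ P * U = U ∧
      ∀ y, ∃ x, P.mulVec y = U.mulVec x := by
  set K := (Matrix.toEuclideanLin U).range
  set P := Matrix.toEuclideanLin.symm K.starProjection.toLinearMap with hP
  have hPv : ∀ y : Fin m → ℝ, evec (P.mulVec y) = K.starProjection (evec y) := fun y =>
    LinearMap.congr_fun (Matrix.toEuclideanLin.apply_symm_apply K.starProjection.toLinearMap)
      (evec y)
  have hPK : ∀ x : Fin κ → ℝ, P.mulVec (U.mulVec x) = U.mulVec x := fun x => by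
    have h : evec (U.mulVec x) ∈ K := ⟨evec x, rfl⟩
    exact congrArg WithLp.ofLp ((hPv _).trans (K.starProjection_eq_self_iff.2 h))
  have hrange : ∀ y, ∃ x, P.mulVec y = U.mulVec x := fun y => by
    obtain ⟨x, hx⟩ := K.starProjection_apply_mem (evec y)
    exact ⟨x.ofLp, congrArg WithLp.ofLp ((hPv y).trans hx.symm)⟩
  refine ⟨P, ?_, ?_, ?_, hrange⟩
  · have h : ∀ x y : Fin m → ℝ, P.mulVec x ⬝ᵥ y = x ⬝ᵥ P.mulVec y := fun x y => by
      rw [← inner_evec, ← inner_evec, hPv, hPv, K.inner_starProjection_left_eq_right]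
    ext i j
    simpa using h (Pi.single i 1) (Pi.single j 1)
  · refine Matrix.ext_iff_mulVec.2 fun y => ?_
    obtain ⟨x, hx⟩ := hrange y
    rw [← Matrix.mulVec_mulVec, hx, hPK]
  · refine Matrix.ext_iff_mulVec.2 fun y => ?_
    rw [← Matrix.mulVec_mulVec, hPK]

lemma frobNorm_sq_eq_add_of_projection {P : Matrix (Fin m) (Fin m) ℝ} (hP : P.transpose = P)
    (hPP : P * P = P) (X : Matrix (Fin m) (Fin n) ℝ) :
    frobNorm X ^ 2 = frobNorm (P * X) ^ 2 + frobNorm (X - P * X) ^ 2 := by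
  have h : frobInner (X - P * X) (P * X) = 0 := by
    rw [frobInner_mul_left, hP, Matrix.mul_sub, ← Matrix.mul_assoc, hPP, sub_self]
    simp [frobInner]
  have hX : matVec m n X = matVec m n (X - P * X) + matVec m n (P * X) := by
    rw [← (matVec m n).map_add, sub_add_cancel]
  have := norm_add_sq_real (matVec m n (X - P * X)) (matVec m n (P * X))
  rw [← hX] at this
  simp only [frobInner, frobNorm] at h ⊢
  rw [this, h]
  ring

lemma frobNorm_sq_eq_add_of_projection_right {Q : Matrix (Fin n) (Fin n) ℝ}
    (hQ : Q.transpose = Q) (hQQ : Q * Q = Q) (X : Matrix (Fin m) (Fin n) ℝ) :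
    frobNorm X ^ 2 = frobNorm (X * Q) ^ 2 + frobNorm (X - X * Q) ^ 2 := by
  have := frobNorm_sq_eq_add_of_projection hQ hQQ X.transpose
  rw [← frobNorm_transpose X, ← frobNorm_transpose (X * Q), ← frobNorm_transpose (X - X * Q),
    Matrix.transpose_sub, Matrix.transpose_mul, hQ]
  exact this

lemma mulVec_eq_mulVec_indicator {J : Finset (Fin κ)} {U : Matrix (Fin m) (Fin κ) ℝ}
    (hU : ∀ j ∉ J, ∀ i, U i j = 0) (x : Fin κ → ℝ) :
    U.mulVec x = U.mulVec ((J : Set (Fin κ)).indicator x) := by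
  ext i
  simp only [Matrix.mulVec, dotProduct]
  refine Finset.sum_congr rfl fun j _ => ?_
  by_cases hj : j ∈ J
  · rw [Set.indicator_of_mem (by simpa using hj)]
  · rw [hU j hj, zero_mul, zero_mul]

/-- Each column of `P X` is `U z` with `z` supported on `J`. Combining `‖Uz‖² ≤ ‖z‖ ‖Uᵀ U z‖` with
`l ‖z‖ ≤ ‖Uz‖` gives the bound column by column. -/
lemma mul_frobNorm_projection_le {J : Finset (Fin κ)} {U : Matrix (Fin m) (Fin κ) ℝ}
    {P : Matrix (Fin m) (Fin m) ℝ} {l : ℝ} (hl : 0 < l) (hU : ∀ j ∉ J, ∀ i, U i j = 0)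
    (hlow : ∀ z : Fin κ → ℝ, (∀ j ∉ J, z j = 0) → l * ‖evec z‖ ≤ ‖evec (U.mulVec z)‖)
    (hP : P.transpose = P) (hPU : P * U = U) (hrange : ∀ y, ∃ x, P.mulVec y = U.mulVec x)
    (X : Matrix (Fin m) (Fin n) ℝ) :
    l * frobNorm (P * X) ≤ frobNorm (U.transpose * X) := by
  have h1 : U.transpose * X = U.transpose * (P * X) := by
    rw [← Matrix.mul_assoc]
    conv_lhs => rw [← hPU, Matrix.transpose_mul, hP]
  rw [h1]
  refine le_frobNorm_mul hl.le fun j => ?_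
  obtain ⟨x, hx⟩ := hrange (X.col j)
  rw [mulVec_eq_mulVec_indicator hU] at hx
  set z := (J : Set (Fin κ)).indicator x
  have hz : ∀ j ∉ J, z j = 0 := fun j hj => Set.indicator_of_notMem (by simpa using hj) _
  have h2 := hlow z hz
  have hcol : (P * X).col j = U.mulVec z := hx
  rw [hcol]
  have h3 := norm_mulVec_sq_le U z
  rw [← Matrix.mulVec_mulVec] at h3
  have h4 := norm_nonneg (evec (U.transpose.mulVec (U.mulVec z)))
  rcases (norm_nonneg (evec (U.mulVec z))).eq_or_lt with h0 | h0
  · rw [← h0, mul_zero]; exact h4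
  refine le_of_mul_le_mul_right ?_ h0
  nlinarith

variable {M : Matrix (Fin m) (Fin n) ℝ}
  {Ub U : Matrix (Fin m) (Fin κ) ℝ} {Vb V : Matrix (Fin n) (Fin κ) ℝ} {J : Finset (Fin κ)}

/-- The residual is controlled by its products with nearby factors. -/
lemma mul_frobNorm_residual_sq_le {s : ℝ} (hs : 0 < s) (hM : Ub * Vb.transpose = M)
    (hVb : ∀ j ∉ J, ∀ i, Vb i j = 0)
    (hU : ∀ j ∉ J, ∀ i, U i j = 0) (hV : ∀ j ∉ J, ∀ i, V i j = 0)
    (hUblow : ∀ z : Fin κ → ℝ, (∀ j ∉ J, z j = 0) → s * ‖evec z‖ ≤ ‖evec (Ub.mulVec z)‖)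
    (hUlow : ∀ z : Fin κ → ℝ, (∀ j ∉ J, z j = 0) → 3 / 4 * s * ‖evec z‖ ≤ ‖evec (U.mulVec z)‖)
    (hVlow : ∀ z : Fin κ → ℝ, (∀ j ∉ J, z j = 0) → 3 / 4 * s * ‖evec z‖ ≤ ‖evec (V.mulVec z)‖)
    (hdU : frobNorm (U - Ub) ≤ s / 4) :
    s ^ 2 / 2 * frobNorm (U * V.transpose - M) ^ 2 ≤
      frobNorm ((U * V.transpose - M) * V) ^ 2 +
        frobNorm ((U * V.transpose - M).transpose * U) ^ 2 := by
  obtain ⟨P, hP, hPP, hPU, hPr⟩ := exists_orthogonal_projection U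
  obtain ⟨Q, hQ, hQQ, hQV, hQr⟩ := exists_orthogonal_projection V
  set D := U * V.transpose - M with hD
  have h34 : 0 < 3 / 4 * s := by positivity
  have h1 := mul_frobNorm_projection_le h34 hU hUlow hP hPU hPr D
  have h2 := mul_frobNorm_projection_le h34 hV hVlow hQ hQV hQr D.transpose
  rw [← frobNorm_transpose, ← frobNorm_transpose (V.transpose * D.transpose), Matrix.transpose_mul,
    Matrix.transpose_mul, Matrix.transpose_transpose, Matrix.transpose_transpose, hQ] at h2
  rw [← frobNorm_transpose (U.transpose * D), Matrix.transpose_mul, Matrix.transpose_transpose] at h1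
  have h3 := frobNorm_sq_eq_add_of_projection hP hPP D
  have h4 := frobNorm_sq_eq_add_of_projection_right hQ hQQ (D - P * D)
  have h5 := frobNorm_sq_eq_add_of_projection hP hPP (D * Q)
  have h6 := frobNorm_sq_eq_add_of_projection_right hQ hQQ D
  have hVQ : V.transpose * Q = V.transpose := by
    conv_rhs => rw [← hQV, Matrix.transpose_mul, hQ]
  -- `U Vᵀ` is unchanged by `Q`, so `D (1 - Q)` comes from `M = Ub Vbᵀ` alone.
  set Z := Vb.transpose - Vb.transpose * Q
  have hDQ : D - D * Q = -(Ub * Z) := by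
    simp only [hD, Z, ← hM, Matrix.sub_mul, Matrix.mul_sub, Matrix.mul_assoc, hVQ]
    abel
  have h7 : s * frobNorm Z ≤ frobNorm (D - D * Q) := by
    have : frobNorm (D - D * Q) = frobNorm (Ub * Z) := by
      rw [hDQ, frobNorm, map_neg, norm_neg, frobNorm]
    rw [this]
    refine le_frobNorm_mul hs.le fun i => hUblow _ fun j hj => ?_
    simp [Z, Matrix.col, Matrix.mul_apply, hVb j hj]
  -- `(1 - P) U = 0` allows `Ub` to be replaced by `Ub - U`. The doubly complementary block of `D`
  -- is therefore of second order: its norm is at most `‖D‖ / 4`.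
  have h8 : (D - P * D) - (D - P * D) * Q =
      (U - Ub) * Z - P * ((U - Ub) * Z) := by
    have e1 : ∀ D : Matrix (Fin m) (Fin n) ℝ,
        (D - P * D) - (D - P * D) * Q = (D - D * Q) - P * (D - D * Q) := fun D => by
      simp only [Matrix.sub_mul, Matrix.mul_sub, Matrix.mul_assoc]
      abel
    have e2 : ∀ Z : Matrix (Fin κ) (Fin n) ℝ,
        -(Ub * Z) - P * -(Ub * Z) = (U - Ub) * Z - P * ((U - Ub) * Z) := fun Z => by
      rw [Matrix.sub_mul, Matrix.mul_sub, ← Matrix.mul_assoc P U, hPU, Matrix.mul_neg]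
      abel
    rw [e1, hDQ, e2]
  have h9 := frobNorm_sq_eq_add_of_projection hP hPP ((U - Ub) * Z)
  have h10 := frobNorm_mul_le (frobNorm_nonneg _) (norm_mulVec_le_frobNorm (U - Ub)) Z
  have h11 : frobNorm ((U - Ub) * Z) ≤ 1 / 4 * frobNorm D := by
    have hle : frobNorm (D - D * Q) ≤ frobNorm D := by
      refine abs_le_of_sq_le_sq' ?_ (frobNorm_nonneg _) |>.2
      linarith [sq_nonneg (frobNorm (D * Q))]
    have := mul_le_mul_of_nonneg_right hdU (frobNorm_nonneg Z)
    linarith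
  have h12 : frobNorm ((U - Ub) * Z) ^ 2 ≤ (1 / 4 * frobNorm D) ^ 2 :=
    pow_le_pow_left₀ (frobNorm_nonneg _) h11 2
  have h13 : (D - P * D) * Q = D * Q - P * (D * Q) := by rw [Matrix.sub_mul, Matrix.mul_assoc]
  rw [h8, h13] at h4
  have h14 : 15 / 16 * frobNorm D ^ 2 ≤ frobNorm (P * D) ^ 2 + frobNorm (D * Q) ^ 2 := by
    linarith [sq_nonneg (frobNorm (P * ((U - Ub) * Z))), sq_nonneg (frobNorm (P * (D * Q)))]
  have h15 := pow_le_pow_left₀ (mul_nonneg h34.le (frobNorm_nonneg _)) h1 2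
  have h16 := pow_le_pow_left₀ (mul_nonneg h34.le (frobNorm_nonneg _)) h2 2
  -- The constants close because `(3/4)² · 15/16 = 135/256 ≥ 1/2`.
  have h17 := mul_le_mul_of_nonneg_left h14 (sq_nonneg s)
  linarith [mul_nonneg (sq_nonneg s) (sq_nonneg (frobNorm D))]

/-- `G` is `𝒜* y`. For `y = 𝒜(U Vᵀ - M)` it is the gradient of the loss at `U Vᵀ`. -/
lemma exists_frobInner_eq (A : SamplingOp m n p) (y : EuclideanSpace ℝ (Fin p)) :
    ∃ G : Matrix (Fin m) (Fin n) ℝ, ∀ X, frobInner G X = inner ℝ y (A X) := by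
  set B := A ∘ₗ (matVec m n).symm.toLinearMap
  refine ⟨(matVec m n).symm (LinearMap.adjoint B y), fun X => ?_⟩
  rw [frobInner, LinearEquiv.apply_symm_apply, LinearMap.adjoint_inner_left]
  simp [B]

/-- Lower bound for one block of the gradient of the loss. -/
lemma le_frobNorm_adjoint_mul {A : SamplingOp m n p} {α β u : ℝ} (hαβ : α ≤ β) (hu : 0 ≤ u)
    (hα : ∀ X : Matrix (Fin m) (Fin n) ℝ, X.rank ≤ k → α * frobNorm X ^ 2 ≤ ‖A X‖ ^ 2)
    (hβ : ∀ X : Matrix (Fin m) (Fin n) ℝ, X.rank ≤ k → ‖A X‖ ^ 2 ≤ β * frobNorm X ^ 2)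
    {D G : Matrix (Fin m) (Fin n) ℝ} (hG : ∀ X, frobInner G X = inner ℝ (A D) (A X))
    (hrank : ∀ t : ℝ, (D + t • (D * V * V.transpose)).rank ≤ k)
    (hV : ∀ x, ‖evec (V.mulVec x)‖ ≤ u * ‖evec x‖) :
    (α + β) / 2 * frobNorm (D * V) - (β - α) / 2 * u * frobNorm D ≤ frobNorm (G * V) := by
  -- Testing `G` against `D V Vᵀ` produces `⟪G V, D V⟫` on one side and the main term `‖D V‖²` on
  -- the other. A factor `‖D V‖` is cancelled at the end.
  have h1 := le_inner_apply_of_forall_smul A (fun t => hα _ (hrank t)) (fun t => hβ _ (hrank t))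
  rw [← hG, frobInner_mul_right (D * V), frobInner_mul_right (D * V), Matrix.transpose_transpose,
    ← frobNorm_sq] at h1
  have h2 := frobInner_le (G * V) (D * V)
  have h3 : frobNorm (D * V * V.transpose) ≤ u * frobNorm (D * V) := by
    rw [← frobNorm_transpose, Matrix.transpose_mul, Matrix.transpose_transpose,
      ← frobNorm_transpose (D * V)]
    exact frobNorm_mul_le hu hV _
  have hDV := frobNorm_nonneg (D * V)
  have hGV := frobNorm_nonneg (G * V)
  have hD := frobNorm_nonneg D
  have hβα : 0 ≤ β - α := by linarith
  rcases hDV.eq_or_lt with h0 | h0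
  · rw [← h0, mul_zero, zero_sub]
    have : 0 ≤ (β - α) / 2 * u * frobNorm D := by positivity
    linarith
  refine le_of_mul_le_mul_right ?_ h0
  have h4 : (β - α) / 2 * (frobNorm D * frobNorm (D * V * V.transpose)) ≤
      (β - α) / 2 * (frobNorm D * (u * frobNorm (D * V))) := by gcongr
  nlinarith

lemma frobNorm_sq_add_smul (a b : ℝ) (X Y : Matrix (Fin m) (Fin n) ℝ) :
    frobNorm (a • X + b • Y) ^ 2 =
      a ^ 2 * frobNorm X ^ 2 + 2 * (a * b) * frobInner X Y + b ^ 2 * frobNorm Y ^ 2 := by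
  simp only [frobNorm, frobInner, map_add, map_smul]
  rw [norm_add_sq_real, norm_smul, norm_smul, real_inner_smul_right, real_inner_smul_left, mul_pow,
    mul_pow, Real.norm_eq_abs, sq_abs, Real.norm_eq_abs, sq_abs]
  ring

/-- The gradients of the loss and of the balancing term are orthogonal. -/
lemma frobNorm_gradient_sq_add (ν μ : ℝ) (G : Matrix (Fin m) (Fin n) ℝ)
    {E : Matrix (Fin κ) (Fin κ) ℝ} (hE : E.transpose = E) :
    frobNorm (ν • (G * V) + μ • (U * E)) ^ 2 +
        frobNorm (ν • (G.transpose * U) + (-μ) • (V * E)) ^ 2 =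
      ν ^ 2 * (frobNorm (G * V) ^ 2 + frobNorm (G.transpose * U) ^ 2) +
        μ ^ 2 * (frobNorm (U * E) ^ 2 + frobNorm (V * E) ^ 2) := by
  -- Both sides equal `⟪Uᵀ G V, E⟫` because `E` is symmetric. The opposite signs of `μ` then cancel
  -- the cross terms.
  have h : frobInner (G * V) (U * E) = frobInner (G.transpose * U) (V * E) := by
    rw [frobInner_mul_left, frobInner_mul_left, ← frobInner_transpose, hE]
    simp [Matrix.transpose_mul, Matrix.mul_assoc]
  rw [frobNorm_sq_add_smul, frobNorm_sq_add_smul, h]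
  ring

/-- Here `s₁ = √σ₁` and `s = √σ_r`. One of `a₁`, `a₂` is at least `s d / 2`. The bracket `b` is at
most `(β + α) s / 3 - s₁ (β - α)`, so the corresponding `g` is at least `(3/4) b d`, and `9/16 ≥
1/2`. -/
lemma isotropy_bracket_bound {s₁ s α β g₁ g₂ a₁ a₂ d : ℝ} (hs : 0 < s) (hs₁ : s ≤ s₁)
    (hα : 0 < α) (hαβ : α ≤ β) (hd : 0 ≤ d) (ha₁ : 0 ≤ a₁) (ha₂ : 0 ≤ a₂)
    (hb : 0 ≤ (β + α) * (s ^ 2) ^ 4 / (128 * s₁ ^ 3 * (4 * s₁ ^ 2 + s ^ 2) ^ 2) - s₁ * (β - α))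
    (ha : s ^ 2 / 2 * d ^ 2 ≤ a₁ ^ 2 + a₂ ^ 2)
    (h₁ : (α + β) / 2 * a₁ - (β - α) / 2 * (5 / 4 * s₁) * d ≤ g₁)
    (h₂ : (α + β) / 2 * a₂ - (β - α) / 2 * (5 / 4 * s₁) * d ≤ g₂) :
    ((β + α) * (s ^ 2) ^ 4 / (128 * s₁ ^ 3 * (4 * s₁ ^ 2 + s ^ 2) ^ 2) - s₁ * (β - α)) ^ 2 / 2 *
      d ^ 2 ≤ g₁ ^ 2 + g₂ ^ 2 := by
  have hs₁0 : 0 < s₁ := hs.trans_le hs₁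
  set b := (β + α) * (s ^ 2) ^ 4 / (128 * s₁ ^ 3 * (4 * s₁ ^ 2 + s ^ 2) ^ 2) - s₁ * (β - α)
    with hbdef
  have hq : (s ^ 2) ^ 4 / (128 * s₁ ^ 3 * (4 * s₁ ^ 2 + s ^ 2) ^ 2) ≤ s / 3 := by
    rw [div_le_iff₀ (by positivity)]
    have e1 : s ^ 3 ≤ s₁ ^ 3 := pow_le_pow_left₀ hs.le hs₁ 3
    have e2 : (s ^ 2) ^ 2 ≤ (4 * s₁ ^ 2 + s ^ 2) ^ 2 :=
      pow_le_pow_left₀ (sq_nonneg s) (by nlinarith) 2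
    have e3 : s ^ 3 * (s ^ 2) ^ 2 ≤ s₁ ^ 3 * (4 * s₁ ^ 2 + s ^ 2) ^ 2 := by gcongr
    have e4 : (s ^ 2) ^ 4 = s * (s ^ 3 * (s ^ 2) ^ 2) := by ring
    have e5 := mul_le_mul_of_nonneg_left e3 hs.le
    have e6 : 0 < s ^ 3 * (s ^ 2) ^ 2 := by positivity
    rw [e4]
    nlinarith
  have hble : b ≤ (β + α) * (s / 3) - s₁ * (β - α) := by
    have := mul_le_mul_of_nonneg_left hq (show 0 ≤ β + α by linarith)
    rw [hbdef, mul_div_assoc]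
    linarith
  have key : ∀ a g : ℝ, s / 2 * d ≤ a → (α + β) / 2 * a - (β - α) / 2 * (5 / 4 * s₁) * d ≤ g →
      b ^ 2 / 2 * d ^ 2 ≤ g ^ 2 := by
    intro a g hag hg
    have e1 := mul_le_mul_of_nonneg_left hag (show 0 ≤ (α + β) / 2 by linarith)
    have e2 : 0 ≤ s₁ * (β - α) := mul_nonneg hs₁0.le (by linarith)
    have e3 := mul_le_mul_of_nonneg_right hble hd
    have e4 : 3 / 4 * (b * d) ≤ g := by nlinarith [mul_nonneg e2 hd]
    have e5 : 0 ≤ b * d := mul_nonneg hb hd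
    nlinarith
  rcases le_or_gt (s / 2 * d) a₁ with h | h
  · linarith [key a₁ g₁ h h₁, sq_nonneg g₂]
  · have : s / 2 * d ≤ a₂ := by
      refine abs_le_of_sq_le_sq' ?_ ha₂ |>.2
      nlinarith
    linarith [key a₂ g₂ this h₂, sq_nonneg g₁]

end GradientInequality

/-- The standing assumptions, in the form in which they are used: restricted isometry constants on
the matrices of rank at most `2r`, and a penalty parameter above the threshold. -/
structure PenaltyRegime {m n p : ℕ} (A : SamplingOp m n p) (M : Matrix (Fin m) (Fin n) ℝ)
    (φ : ℝ → EReal) (ν μ ρ α β ϖ c : ℝ) (κ r : ℕ) : Prop where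
  one_le_r : 1 ≤ r
  rank_eq : M.rank = r
  r_le : r ≤ κ
  ν_pos : 0 < ν
  μ_pos : 0 < μ
  generator : IsPenaltyGenerator φ
  slope : SlopeAssumption φ ϖ c
  le_norm : ∀ X : Matrix (Fin m) (Fin n) ℝ, X.rank ≤ 2 * r → α * frobNorm X ^ 2 ≤ ‖A X‖ ^ 2
  norm_le : ∀ X : Matrix (Fin m) (Fin n) ℝ, X.rank ≤ 2 * r → ‖A X‖ ^ 2 ≤ β * frobNorm X ^ 2
  α_large : 4 < ν * α * singVal M r ^ 2
  mem_solutions : ∀ X, X ∈ rankRegSolutions (lsLoss A (A M)) ν ↔ X = M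
  threshold : penaltyThreshold φ ν μ α (singVal M r) (opNorm A) κ r < ρ

/-! ### Uniqueness of the rank-regularized solution. -/

section Solutions

variable {m n p κ r : ℕ} {A : SamplingOp m n p} {M : Matrix (Fin m) (Fin n) ℝ}

/-- With `d = r - rank X`, comparison with `M` gives `ν ‖A(X - M)‖² ≤ 2d`, while the rank deficit
forces `ν ‖A(X - M)‖² ≥ ν α σ_r² d ≥ 4d`. Hence `d = 0`, and then the residual vanishes. -/
lemma eq_of_mem_rankRegSolutions {ν α : ℝ} (hν : 0 < ν) (hM : M.rank = r)
    (hα : ∀ X : Matrix (Fin m) (Fin n) ℝ, X.rank ≤ 2 * r → α * frobNorm X ^ 2 ≤ ‖A X‖ ^ 2)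
    (hlarge : 4 < ν * α * singVal M r ^ 2) {X : Matrix (Fin m) (Fin n) ℝ}
    (hX : X ∈ rankRegSolutions (lsLoss A (A M)) ν) : X = M := by
  have h := hX M
  have hα0 : 0 < ν * α := by
    by_contra! h0
    nlinarith [sq_nonneg (singVal M r)]
  rw [lsLoss, lsLoss, sub_self, norm_zero, hM, ← map_sub] at h
  have hr : X.rank ≤ r := by
    have : (X.rank : ℝ) ≤ r := by nlinarith [mul_nonneg hν.le (sq_nonneg ‖A (X - M)‖)]
    exact_mod_cast this
  have hr' : (X.rank : ℝ) ≤ r := by exact_mod_cast hr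
  have h1 := hα (X - M) ((rank_sub_le _ _).trans (by omega))
  have h2 := sq_singVal_mul_le_frobNorm_sub_sq hM (le_refl X.rank)
  have h3 := mul_le_mul_of_nonneg_left h1 hν.le
  have h4 := mul_le_mul_of_nonneg_left h2 hα0.le
  have h5 := mul_le_mul_of_nonneg_right hlarge.le (sub_nonneg.2 hr')
  have h6 : (X.rank : ℝ) = r := by nlinarith
  have h7 : frobNorm (X - M) ^ 2 ≤ 0 := by
    rw [h6] at h
    by_contra! h8
    nlinarith [mul_pos hα0 h8]
  have h8 : frobNorm (X - M) = 0 := by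
    have := sq_nonneg (frobNorm (X - M))
    exact pow_eq_zero_iff two_ne_zero |>.1 (le_antisymm h7 this)
  exact sub_eq_zero.1 (frobNorm_eq_zero.1 h8)

end Solutions

/-! ### Exactness of the penalty: factor pairs with `Θ_ρ ≤ r`. -/

section ThetaValues

variable {m n p κ r : ℕ} {A : SamplingOp m n p} {M : Matrix (Fin m) (Fin n) ℝ}
  {φ : ℝ → EReal} {ν μ ρ α β ϖ c : ℝ}

lemma Theta_toFactor (f : Matrix (Fin m) (Fin n) ℝ → ℝ) (U : Matrix (Fin m) (Fin κ) ℝ)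
    (V : Matrix (Fin n) (Fin κ) ℝ) :
    Theta f ν μ φ ρ κ (toFactor U V) = smoothPart f ν μ U V +
      ∑ j, 1 / 2 * (theta φ (ρ * colNorm U j) + theta φ (ρ * colNorm V j)) := by
  rw [Theta, ← Finset.mul_sum]
  rfl

lemma smoothPart_lsLoss (U : Matrix (Fin m) (Fin κ) ℝ) (V : Matrix (Fin n) (Fin κ) ℝ) :
    smoothPart (lsLoss A (A M)) ν μ U V = ν / 2 * ‖A (U * V.transpose - M)‖ ^ 2 +
      μ / 4 * frobNorm (U.transpose * U - V.transpose * V) ^ 2 := by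
  rw [smoothPart, lsLoss, map_sub]
  ring

lemma frobNorm_vecMulVec (x : Fin m → ℝ) (y : Fin n → ℝ) :
    frobNorm (Matrix.vecMulVec x y) = ‖evec x‖ * ‖evec y‖ := by
  rw [← sq_eq_sq₀ (frobNorm_nonneg _) (by positivity), mul_pow, norm_evec_sq, norm_evec_sq,
    frobNorm_sq, frobInner_eq_sum, dotProduct, dotProduct, Finset.sum_mul_sum]
  refine Finset.sum_congr rfl fun i _ => Finset.sum_congr rfl fun j _ => ?_
  rw [Matrix.vecMulVec_apply]
  ring

lemma frobNorm_mul_transpose_le (U : Matrix (Fin m) (Fin κ) ℝ) (V : Matrix (Fin n) (Fin κ) ℝ) :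
    frobNorm (U * V.transpose) ≤ ∑ j, colNorm U j * colNorm V j := by
  have h : U * V.transpose = ∑ j, Matrix.vecMulVec (U.col j) (V.col j) := by
    ext i l
    simp [Matrix.mul_apply, Matrix.sum_apply, Matrix.vecMulVec_apply]
  rw [h, frobNorm, map_sum]
  refine (norm_sum_le _ _).trans (le_of_eq (Finset.sum_congr rfl fun j _ => ?_))
  exact frobNorm_vecMulVec _ _

namespace PenaltyRegime

lemma σr_pos (H : PenaltyRegime A M φ ν μ ρ α β ϖ c κ r) :
    0 < singVal M r := singVal_pos H.one_le_r H.rank_eq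

lemma α_pos (H : PenaltyRegime A M φ ν μ ρ α β ϖ c κ r) :
    0 < α := by
  have := H.α_large
  by_contra! h0
  nlinarith [mul_nonneg H.ν_pos.le (sq_nonneg (singVal M r))]

lemma two_lt_sqrt_mul (H : PenaltyRegime A M φ ν μ ρ α β ϖ c κ r) :
    2 < √(ν * α) * singVal M r := by
  have h := H.α_large
  have h0 := mul_pos H.ν_pos H.α_pos
  refine lt_of_pow_lt_pow_left₀ 2 (by have := H.σr_pos; positivity) ?_
  rw [mul_pow, Real.sq_sqrt h0.le]
  linarith

lemma gap_pos (H : PenaltyRegime A M φ ν μ ρ α β ϖ c κ r) :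
    0 < √(ν * α) * singVal M r - √2 := by
  have h := H.two_lt_sqrt_mul
  have : √2 < 2 := by
    rw [Real.sqrt_lt' two_pos]
    norm_num
  linarith

lemma leftDeriv_lt (H : PenaltyRegime A M φ ν μ ρ α β ϖ c κ r) :
    leftDerivAtOne φ < ρ := by
  refine lt_of_le_of_lt ?_ H.threshold
  have := H.generator.leftDerivAtOne_pos
  rw [penaltyThreshold]
  nlinarith [le_max_left 1 (√ν * opNorm A * √κ / (√(ν * α) * singVal M r - √2) *
    √(1 + 2 * √r / √μ))]

lemma ρ_pos (H : PenaltyRegime A M φ ν μ ρ α β ϖ c κ r) :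
    0 < ρ := H.generator.leftDerivAtOne_pos.trans H.leftDeriv_lt

lemma mul_lt_mul_gap (H : PenaltyRegime A M φ ν μ ρ α β ϖ c κ r) :
    √ν * opNorm A * √κ * √(1 + 2 * √r / √μ) * leftDerivAtOne φ <
      ρ * (√(ν * α) * singVal M r - √2) := by
  have h := H.threshold
  have hL := H.generator.leftDerivAtOne_pos
  have hg := H.gap_pos
  rw [penaltyThreshold] at h
  have h1 := (mul_le_mul_of_nonneg_right (le_max_right 1 (√ν * opNorm A * √κ /
    (√(ν * α) * singVal M r - √2) * √(1 + 2 * √r / √μ))) hL.le).trans_lt h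
  rw [div_mul_eq_mul_div, div_mul_eq_mul_div, div_lt_iff₀ hg] at h1
  exact h1

lemma Theta_balanced_factors_le (H : PenaltyRegime A M φ ν μ ρ α β ϖ c κ r) :
    ∃ (U : Matrix (Fin m) (Fin κ) ℝ) (V : Matrix (Fin n) (Fin κ) ℝ),
    Theta (lsLoss A (A M)) ν μ φ ρ κ (toFactor U V) ≤ r := by
  obtain ⟨U, V, hM, hUV, h0⟩ := exists_balanced_factors M (H.rank_eq ▸ H.r_le)
  refine ⟨U, V, ?_⟩
  rw [Theta_toFactor, smoothPart_lsLoss, hM, hUV]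
  simp only [sub_self, map_zero, norm_zero, frobNorm]
  have h1 : ∀ j : Fin κ, 1 / 2 * (theta φ (ρ * colNorm U j) + theta φ (ρ * colNorm V j)) ≤
      if (j : ℕ) < r then 1 else 0 := fun j => by
    split_ifs with hj
    · linarith [theta_le_one H.generator (ρ * colNorm U j),
        theta_le_one H.generator (ρ * colNorm V j)]
    · obtain ⟨hU, hV⟩ := h0 j (by rw [H.rank_eq]; omega)
      rw [colNorm_eq_zero.2 hU, colNorm_eq_zero.2 hV, mul_zero, theta_zero H.generator]
      norm_num
  have h2 := Finset.sum_le_sum fun j (_ : j ∈ Finset.univ) => h1 j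
  rw [Fin.sum_univ_eq_sum_range (fun j => if j < r then (1 : ℝ) else 0), ← Finset.sum_filter,
    Finset.sum_const, nsmul_eq_mul, mul_one] at h2
  have h3 : ((Finset.range κ).filter (· < r)).card ≤ r := by
    refine (Finset.card_le_card fun j hj => ?_).trans (Finset.card_range r).le
    simpa using (Finset.mem_filter.1 hj).2
  have h4 : ((((Finset.range κ).filter (· < r)).card : ℕ) : ℝ) ≤ r := by exact_mod_cast h3
  linarith

/-- Factor pairs with at most the value of the balanced solutions are balanced solutions. -/
lemma mem_balancedSolutions_of_Theta_le (H : PenaltyRegime A M φ ν μ ρ α β ϖ c κ r)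
    {U : Matrix (Fin m) (Fin κ) ℝ} {V : Matrix (Fin n) (Fin κ) ℝ}
    (h : Theta (lsLoss A (A M)) ν μ φ ρ κ (toFactor U V) ≤ r) :
    (U, V) ∈ balancedSolutions (lsLoss A (A M)) ν κ := by
  have hL := H.generator.leftDerivAtOne_pos
  have hν := H.ν_pos
  have hμ := H.μ_pos
  set L := leftDerivAtOne φ
  set τ := ρ / L with hτ
  have hτ1 : 1 < τ := (one_lt_div hL).2 H.leftDeriv_lt
  have hτ0 : 0 < τ := one_pos.trans hτ1
  set D := U * V.transpose - M with hD
  set E := U.transpose * U - V.transpose * V with hE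
  set a := colNorm U with ha
  set b := colNorm V with hb
  have ha0 : ∀ j, 0 ≤ a j := colNorm_nonneg U
  have hb0 : ∀ j, 0 ≤ b j := colNorm_nonneg V
  set pen : Fin κ → ℝ := fun j => 1 / 2 * (theta φ (ρ * a j) + theta φ (ρ * b j)) with hpen
  have hpen_ge : ∀ j, 1 / 2 * (min 1 (τ * a j) + min 1 (τ * b j)) ≤ pen j := fun j => by
    have h1 := min_le_theta H.generator H.slope (mul_nonneg H.ρ_pos.le (ha0 j))
    have h2 := min_le_theta H.generator H.slope (mul_nonneg H.ρ_pos.le (hb0 j))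
    rw [mul_div_right_comm] at h1 h2
    simp only [hpen]
    linarith
  have hpen0 : ∀ j, 0 ≤ pen j := fun j => by
    refine le_trans ?_ (hpen_ge j)
    have := ha0 j
    have := hb0 j
    positivity
  rw [Theta_toFactor, smoothPart_lsLoss] at h
  change ν / 2 * ‖A D‖ ^ 2 + μ / 4 * frobNorm E ^ 2 + ∑ j, pen j ≤ r at h
  -- The columns whose penalty is certainly at least one.
  set J : Finset (Fin κ) := Finset.univ.filter fun j => 1 ≤ τ * a j ∧ 1 ≤ τ * b j with hJ
  have hmemJ : ∀ j, j ∈ J ↔ 1 ≤ τ * a j ∧ 1 ≤ τ * b j := fun j => by simp [hJ]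
  have hsplit : ∑ j, pen j = ∑ j ∈ J, pen j + ∑ j ∈ Jᶜ, pen j := (Finset.sum_add_sum_compl J _).symm
  have hsumJ : (J.card : ℝ) ≤ ∑ j ∈ J, pen j := by
    have : ∑ j ∈ J, (1 : ℝ) ≤ ∑ j ∈ J, pen j := Finset.sum_le_sum fun j hj => by
      obtain ⟨h1, h2⟩ := (hmemJ j).1 hj
      have := hpen_ge j
      rw [min_eq_left h1, min_eq_left h2] at this
      linarith
    simpa using this
  have hA0 : 0 ≤ ν / 2 * ‖A D‖ ^ 2 := by positivity
  have hE0 : 0 ≤ μ / 4 * frobNorm E ^ 2 := by positivity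
  have hC0 : 0 ≤ ∑ j ∈ Jᶜ, pen j := Finset.sum_nonneg fun j _ => hpen0 j
  -- If `|J| ≥ r`, the penalty on `J` exhausts the budget `r`, so the loss, the imbalance and the
  -- remaining columns all vanish.
  rcases le_or_gt r J.card with hrJ | hrJ
  · have hrJ' : (r : ℝ) ≤ J.card := by exact_mod_cast hrJ
    have hAD : ν / 2 * ‖A D‖ ^ 2 = 0 := by linarith
    have hEE : μ / 4 * frobNorm E ^ 2 = 0 := by linarith
    have hCC : ∑ j ∈ Jᶜ, pen j = 0 := by linarith
    have hcard : J.card = r := by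
      have : (J.card : ℝ) ≤ r := by linarith
      exact le_antisymm (by exact_mod_cast this) hrJ
    have hoff : ∀ j ∉ J, a j = 0 ∧ b j = 0 := fun j hj => by
      have h1 := (Finset.sum_eq_zero_iff_of_nonneg fun j _ => hpen0 j).1 hCC j (by simpa using hj)
      have h2 := hpen_ge j
      have h3 : 0 ≤ min 1 (τ * a j) := le_min zero_le_one (mul_nonneg hτ0.le (ha0 j))
      have h4 : 0 ≤ min 1 (τ * b j) := le_min zero_le_one (mul_nonneg hτ0.le (hb0 j))
      constructor
      · by_contra h5
        have : 0 < min 1 (τ * a j) := lt_min one_pos (mul_pos hτ0 ((ha0 j).lt_of_ne' h5))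
        linarith
      · by_contra h5
        have : 0 < min 1 (τ * b j) := lt_min one_pos (mul_pos hτ0 ((hb0 j).lt_of_ne' h5))
        linarith
    have hsupp : ∀ {q : ℕ} (W : Matrix (Fin q) (Fin κ) ℝ), (∀ j ∉ J, colNorm W j = 0) →
        (∀ j ∈ J, 1 ≤ τ * colNorm W j) → normTwoZero W = r := fun W h1 h2 => by
      rw [normTwoZero, ← hcard, ← Set.ncard_coe_finset]
      congr 1
      ext j
      simp only [Set.mem_ofPred_eq, Finset.mem_coe]
      constructor
      · intro h3
        by_contra h4
        exact h3 (funext (colNorm_eq_zero.1 (h1 j h4)))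
      · intro h3 h4
        have h5 : colNorm W j = 0 := colNorm_eq_zero.2 (congrFun h4)
        have h6 := h2 j h3
        rw [h5] at h6
        linarith
    have hU0 : ∀ j ∉ J, ∀ i, U i j = 0 := fun j hj => colNorm_eq_zero.1 (hoff j hj).1
    have hD0 : D = 0 := by
      have h1 : D.rank ≤ 2 * r := by
        refine (rank_sub_le _ _).trans ?_
        have h2 := (Matrix.rank_mul_le_left U V.transpose).trans (rank_le_of_zero_columns hU0)
        have h3 := H.rank_eq
        omega
      have h2 := H.le_norm D h1
      have h3 : ‖A D‖ ^ 2 = 0 := by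
        rcases mul_eq_zero.1 hAD with h | h
        · linarith
        · exact h
      rw [h3] at h2
      have h4 := H.α_pos
      refine frobNorm_eq_zero.1 (pow_eq_zero_iff two_ne_zero |>.1 (le_antisymm ?_ (sq_nonneg _)))
      by_contra! h5
      linarith [mul_pos h4 h5]
    have hMeq : U * V.transpose = M := sub_eq_zero.1 hD0
    have hEeq : E = 0 := by
      rcases mul_eq_zero.1 hEE with h | h
      · linarith
      · exact frobNorm_eq_zero.1 (pow_eq_zero_iff two_ne_zero |>.1 h)
    refine ⟨⟨(H.mem_solutions _).2 hMeq, ?_⟩, sub_eq_zero.1 hEeq, ?_, ?_⟩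
    · change (U * V.transpose).rank ≤ κ
      rw [hMeq, H.rank_eq]
      exact H.r_le
    · change normTwoZero U = (U * V.transpose).rank
      rw [hMeq, H.rank_eq]
      exact hsupp U (fun j hj => (hoff j hj).1) fun j hj => ((hmemJ j).1 hj).1
    · change normTwoZero V = (U * V.transpose).rank
      rw [hMeq, H.rank_eq]
      exact hsupp V (fun j hj => (hoff j hj).2) fun j hj => ((hmemJ j).1 hj).2
  -- Otherwise delete the columns of `U` outside `J`. The product then has rank at most `|J|`, so it
  -- is at distance at least `σ_r √d` from `M`. The deleted part is controlled by `S`, and its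
  -- penalty gives `τ S ≤ d`.
  · exfalso
    set s : Fin κ → ℝ := fun j => min (a j) (b j) with hs
    set S := ∑ j ∈ Jᶜ, s j with hS
    set d : ℝ := (r : ℝ) - J.card with hd
    have hd0 : 0 < d := sub_pos.2 (by exact_mod_cast hrJ)
    have hs0 : ∀ j, 0 ≤ s j := fun j => le_min (ha0 j) (hb0 j)
    have hoff : ∀ j ∉ J, τ * s j ≤ 1 := fun j hj => by
      rw [hmemJ, not_and_or, not_le, not_le] at hj
      rcases hj with hj | hj
      · exact (mul_le_mul_of_nonneg_left (min_le_left _ _) hτ0.le).trans hj.le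
      · exact (mul_le_mul_of_nonneg_left (min_le_right _ _) hτ0.le).trans hj.le
    have hpenS : τ * S ≤ ∑ j ∈ Jᶜ, pen j := by
      rw [hS, Finset.mul_sum]
      refine Finset.sum_le_sum fun j hj => le_trans ?_ (hpen_ge j)
      have h1 := hoff j (by simpa using hj)
      have h2 : τ * s j ≤ min 1 (τ * a j) :=
        le_min h1 (mul_le_mul_of_nonneg_left (min_le_left _ _) hτ0.le)
      have h3 : τ * s j ≤ min 1 (τ * b j) :=
        le_min h1 (mul_le_mul_of_nonneg_left (min_le_right _ _) hτ0.le)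
      linarith
    have hle : ν / 2 * ‖A D‖ ^ 2 + τ * S ≤ d := by linarith
    have hS0 : 0 ≤ S := Finset.sum_nonneg fun j _ => hs0 j
    -- `B` bounds the larger norm of two paired columns outside `J`: the smaller is at most `1 / τ ≤
    -- 1`, and their squares differ by at most `‖E‖ ≤ 2√r/√μ`, since the balancing term is at most
    -- `r`.
    set B := √(1 + 2 * √r / √μ) with hB
    have hE2 : frobNorm E ≤ 2 * √r / √μ := by
      refine abs_le_of_sq_le_sq' ?_ (by positivity) |>.2
      rw [div_pow, mul_pow, Real.sq_sqrt hμ.le, Real.sq_sqrt (Nat.cast_nonneg r),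
        le_div_iff₀ hμ]
      have : (0 : ℝ) ≤ J.card := Nat.cast_nonneg _
      linarith
    have hab : ∀ j ∉ J, a j * b j ≤ s j * B := fun j hj => by
      have h1 : |a j ^ 2 - b j ^ 2| ≤ 2 * √r / √μ := by
        refine le_trans ?_ hE2
        rw [ha, hb, colNorm_sq, colNorm_sq]
        exact abs_apply_le_frobNorm E j j
      have h2 : s j ≤ 1 := by
        have := hoff j hj
        nlinarith [hs0 j]
      have h3 : s j ^ 2 ≤ 1 := pow_le_one₀ (hs0 j) h2
      obtain ⟨h4, h5⟩ := abs_le.1 h1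
      rcases le_total (a j) (b j) with hle | hle
      · have e : s j = a j := min_eq_left hle
        rw [e] at h3 ⊢
        exact mul_le_mul_of_nonneg_left (Real.le_sqrt_of_sq_le (by linarith)) (ha0 j)
      · have e : s j = b j := min_eq_right hle
        rw [e] at h3 ⊢
        rw [mul_comm]
        exact mul_le_mul_of_nonneg_left (Real.le_sqrt_of_sq_le (by linarith)) (hb0 j)
    let U' : Matrix (Fin m) (Fin κ) ℝ := Matrix.of fun i j => if j ∈ J then U i j else 0
    have hU' : ∀ j ∉ J, ∀ i, U' i j = 0 := fun j hj i => if_neg hj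
    have hrank : (U' * V.transpose).rank ≤ J.card :=
      (Matrix.rank_mul_le_left _ _).trans (rank_le_of_zero_columns hU')
    have hdiff : frobNorm (U' * V.transpose - U * V.transpose) ≤ B * S := by
      rw [← Matrix.sub_mul]
      refine (frobNorm_mul_transpose_le _ _).trans ?_
      have h1 : ∑ j ∈ J, colNorm (U' - U) j * colNorm V j = 0 := Finset.sum_eq_zero fun j hj => by
        have : colNorm (U' - U) j = 0 := colNorm_eq_zero.2 fun i => by simp [U', hj]
        rw [this, zero_mul]
      rw [← Finset.sum_add_sum_compl J, h1, zero_add, hS, Finset.mul_sum]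
      refine Finset.sum_le_sum fun j hj => ?_
      have hj' : j ∉ J := by simpa using hj
      have h2 : colNorm (U' - U) j = a j := by
        have h3 : (fun i => (U' - U) i j) = -fun i => U i j := by
          ext i
          simp [U', hj']
        rw [colNorm, h3, WithLp.toLp_neg, norm_neg]
        rfl
      rw [h2, mul_comm B]
      exact hab j hj'
    have h1 := H.le_norm (U' * V.transpose - M) ((rank_sub_le _ _).trans (by
      have := H.rank_eq
      omega))
    have h2 := sq_singVal_mul_le_frobNorm_sub_sq H.rank_eq hrank
    have h3 : ‖A (U' * V.transpose - M)‖ ≤ ‖A D‖ + opNorm A * (B * S) := by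
      have e : U' * V.transpose - M = D + (U' * V.transpose - U * V.transpose) := by
        rw [hD]
        abel
      rw [e, map_add]
      refine (norm_add_le _ _).trans (add_le_add_right ?_ _)
      exact (norm_apply_le_opNorm A _).trans (mul_le_mul_of_nonneg_left hdiff (opNorm_nonneg A))
    have h4 : √(ν * α) * singVal M r * √d ≤ √ν * ‖A (U' * V.transpose - M)‖ := by
      refine abs_le_of_sq_le_sq' ?_ (by positivity) |>.2
      rw [mul_pow, mul_pow, mul_pow, Real.sq_sqrt (mul_pos hν H.α_pos).le, Real.sq_sqrt hd0.le,
        Real.sq_sqrt hν.le]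
      have h5 := mul_le_mul_of_nonneg_left h2 H.α_pos.le
      calc ν * α * singVal M r ^ 2 * d = ν * (α * (singVal M r ^ 2 * d)) := by ring
        _ ≤ _ := mul_le_mul_of_nonneg_left (h5.trans h1) hν.le
    have h5 : √ν * ‖A D‖ ≤ √2 * √d := by
      refine abs_le_of_sq_le_sq' ?_ (by positivity) |>.2
      rw [mul_pow, mul_pow, Real.sq_sqrt hν.le, Real.sq_sqrt two_pos.le, Real.sq_sqrt hd0.le]
      nlinarith
    have h6 : (√(ν * α) * singVal M r - √2) * √d ≤ √ν * opNorm A * B * S := by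
      have := mul_le_mul_of_nonneg_left h3 (Real.sqrt_nonneg ν)
      linarith
    have h7 : √ν * opNorm A * √κ * B < τ * (√(ν * α) * singVal M r - √2) := by
      rw [hτ, div_mul_eq_mul_div, lt_div_iff₀ hL]
      exact H.mul_lt_mul_gap
    have hsd : 0 < √d := Real.sqrt_pos.2 hd0
    have hxB : 0 ≤ √ν * opNorm A * B := by
      have := opNorm_nonneg A
      positivity
    -- The threshold on `ρ` forces `√κ √d < d`, contradicting `d ≤ r ≤ κ`.
    have h8 : √ν * opNorm A * B * (√κ * √d) < √ν * opNorm A * B * d := by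
      calc √ν * opNorm A * B * (√κ * √d) = √ν * opNorm A * √κ * B * √d := by ring
        _ < τ * (√(ν * α) * singVal M r - √2) * √d := mul_lt_mul_of_pos_right h7 hsd
        _ = τ * ((√(ν * α) * singVal M r - √2) * √d) := by ring
        _ ≤ τ * (√ν * opNorm A * B * S) := mul_le_mul_of_nonneg_left h6 hτ0.le
        _ = √ν * opNorm A * B * (τ * S) := by ring
        _ ≤ √ν * opNorm A * B * d := mul_le_mul_of_nonneg_left (by linarith) hxB
    have h9 : √κ * √d < d := lt_of_mul_lt_mul_left h8 hxB
    have h10 : d ≤ κ := by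
      have : (r : ℝ) ≤ κ := by exact_mod_cast H.r_le
      have : (0 : ℝ) ≤ J.card := Nat.cast_nonneg _
      linarith
    have h11 := mul_le_mul_of_nonneg_right (Real.sqrt_le_sqrt h10) hsd.le
    rw [Real.mul_self_sqrt hd0.le] at h11
    linarith

end PenaltyRegime

end ThetaValues

/-! ### Testing regular subgradients along lines. -/

section DirectionalDerivatives

/-- The subgradient inequality at both `x + t d` and `x - t d` pins down `⟪v, d⟫`. Differentiability
in other directions plays no role, so kinks of `Θ_ρ` elsewhere are harmless. -/
lemma inner_eq_of_mem_regularSubdiff {E : Type*} [NormedAddCommGroup E] [InnerProductSpace ℝ E]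
    {g : E → ℝ} {x v d : E} (hv : v ∈ regularSubdiff g x) {g' : ℝ}
    (hg : HasDerivAt (fun t : ℝ => g (x + t • d)) g' 0) : inner ℝ v d = g' := by
  have hlim : Tendsto (fun t : ℝ => x + t • d) (𝓝 0) (𝓝 x) := by
    have : Continuous fun t : ℝ => x + t • d := by fun_prop
    simpa using this.tendsto 0
  have key : ∀ ε : ℝ, 0 < ε → ∀ᶠ t : ℝ in 𝓝 0,
      t * (inner ℝ v d - g') ≤ |t| * (ε * (1 + ‖d‖)) := by
    intro ε hε
    have h1 := hlim.eventually (hv ε hε)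
    have h2 := (hasDerivAt_iff_isLittleO.1 hg).bound hε
    filter_upwards [h1, h2] with t h1 h2
    simp only [add_sub_cancel_left, norm_smul, real_inner_smul_right, sub_zero, zero_smul, add_zero,
      smul_eq_mul, Real.norm_eq_abs] at h1 h2
    have h3 := (abs_le.1 h2).2
    linarith
  have hle : ∀ ε : ℝ, 0 < ε → |inner ℝ v d - g'| ≤ ε * (1 + ‖d‖) := by
    intro ε hε
    obtain ⟨δ, hδ, h⟩ := Metric.eventually_nhds_iff.1 (key ε hε)
    have hp := @h (δ / 2) (by rw [Real.dist_eq, sub_zero, abs_of_pos (by positivity)]; linarith)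
    have hm := @h (-(δ / 2)) (by
      rw [Real.dist_eq, sub_zero, abs_neg, abs_of_pos (by positivity)]; linarith)
    rw [abs_neg] at hm
    rw [abs_of_pos (show 0 < δ / 2 by positivity)] at hp hm
    have hδ2 : 0 < δ / 2 := by positivity
    refine abs_le.2 ⟨?_, le_of_mul_le_mul_left hp hδ2⟩
    refine le_of_mul_le_mul_left ?_ hδ2
    linarith
  have h0 : |inner ℝ v d - g'| ≤ 0 := by
    refine le_of_forall_pos_le_add fun ε hε => ?_
    have hd : 0 < 1 + ‖d‖ := by positivity
    have := hle (ε / (1 + ‖d‖)) (by positivity)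
    rwa [div_mul_cancel₀ _ hd.ne', ← zero_add ε] at this
  exact sub_eq_zero.1 (abs_nonpos_iff.1 h0)

/-- Along a line, `𝒜(U Vᵀ - M)` and `Uᵀ U - Vᵀ V` are both quadratic polynomials of this form. -/
lemma hasDerivAt_norm_quadratic_sq {E : Type*} [NormedAddCommGroup E] [InnerProductSpace ℝ E]
    (a b c : E) :
    HasDerivAt (fun t : ℝ => ‖a + t • b + t ^ 2 • c‖ ^ 2) (2 * inner ℝ a b) 0 := by
  have h1 : HasDerivAt (fun t : ℝ => a + t • b + t ^ 2 • c) b 0 := by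
    refine ((((hasDerivAt_id (0 : ℝ)).smul_const b).const_add a).add
      (((hasDerivAt_id (0 : ℝ)).pow 2).smul_const c)).congr_deriv ?_
    simp
  simpa using h1.norm_sq

variable {m n p κ r : ℕ} {A : SamplingOp m n p} {M G : Matrix (Fin m) (Fin n) ℝ}
  {φ : ℝ → EReal} {ν μ ρ α β ϖ c : ℝ}

lemma frobInner_add_left (X Y Z : Matrix (Fin m) (Fin n) ℝ) :
    frobInner (X + Y) Z = frobInner X Z + frobInner Y Z := by
  simp only [frobInner, map_add, inner_add_left]

lemma frobInner_add_right (X Y Z : Matrix (Fin m) (Fin n) ℝ) :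
    frobInner X (Y + Z) = frobInner X Y + frobInner X Z := by
  simp only [frobInner, map_add, inner_add_right]

lemma frobInner_sub_right (X Y Z : Matrix (Fin m) (Fin n) ℝ) :
    frobInner X (Y - Z) = frobInner X Y - frobInner X Z := by
  simp only [frobInner, map_sub, inner_sub_right]

lemma frobInner_smul_left (a : ℝ) (X Y : Matrix (Fin m) (Fin n) ℝ) :
    frobInner (a • X) Y = a * frobInner X Y := by
  simp only [frobInner, map_smul, real_inner_smul_left]

/-- The matrices paired with `S` and `T` are the partial gradients in `U` and `V`. -/
lemma hasDerivAt_smoothPart {U S : Matrix (Fin m) (Fin κ) ℝ} {V T : Matrix (Fin n) (Fin κ) ℝ}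
    (hG : ∀ X, frobInner G X = inner ℝ (A (U * V.transpose - M)) (A X)) :
    HasDerivAt (fun t : ℝ => smoothPart (lsLoss A (A M)) ν μ (U + t • S) (V + t • T))
      (frobInner (ν • (G * V) + μ • (U * (U.transpose * U - V.transpose * V))) S +
        frobInner (ν • (G.transpose * U) + (-μ) • (V * (U.transpose * U - V.transpose * V))) T)
      0 := by
  set E := U.transpose * U - V.transpose * V with hE
  have hEt : E.transpose = E := by
    simp [hE, Matrix.transpose_sub, Matrix.transpose_mul]
  have e1 : ∀ t : ℝ, A ((U + t • S) * (V + t • T).transpose - M) =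
      A (U * V.transpose - M) + t • A (S * V.transpose + U * T.transpose) +
        t ^ 2 • A (S * T.transpose) := fun t => by
    rw [← map_smul, ← map_smul, ← map_add, ← map_add]
    congr 1
    simp only [Matrix.transpose_add, Matrix.transpose_smul, Matrix.add_mul, Matrix.mul_add,
      Matrix.smul_mul, Matrix.mul_smul, smul_add, smul_smul, pow_two]
    abel
  have e2 : ∀ t : ℝ, matVec κ κ ((U + t • S).transpose * (U + t • S) -
      (V + t • T).transpose * (V + t • T)) =
      matVec κ κ E + t • matVec κ κ ((S.transpose * U + U.transpose * S) -
        (T.transpose * V + V.transpose * T)) +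
        t ^ 2 • matVec κ κ (S.transpose * S - T.transpose * T) := fun t => by
    rw [← LinearEquiv.map_smul, ← LinearEquiv.map_smul, ← LinearEquiv.map_add,
      ← LinearEquiv.map_add]
    congr 1
    simp only [hE, Matrix.transpose_add, Matrix.transpose_smul, Matrix.add_mul, Matrix.mul_add,
      Matrix.smul_mul, Matrix.mul_smul, smul_add, smul_smul, pow_two, smul_sub]
    abel
  have h1 := (hasDerivAt_norm_quadratic_sq (A (U * V.transpose - M))
    (A (S * V.transpose + U * T.transpose)) (A (S * T.transpose))).const_mul (ν / 2)
  have h2 := (hasDerivAt_norm_quadratic_sq (matVec κ κ E)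
    (matVec κ κ ((S.transpose * U + U.transpose * S) - (T.transpose * V + V.transpose * T)))
    (matVec κ κ (S.transpose * S - T.transpose * T))).const_mul (μ / 4)
  have h3 := h1.add h2
  simp only [← e1, ← e2] at h3
  have e3 : ∀ t : ℝ, smoothPart (lsLoss A (A M)) ν μ (U + t • S) (V + t • T) =
      ν / 2 * ‖A ((U + t • S) * (V + t • T).transpose - M)‖ ^ 2 +
      μ / 4 * ‖matVec κ κ ((U + t • S).transpose * (U + t • S) -
        (V + t • T).transpose * (V + t • T))‖ ^ 2 := fun t => smoothPart_lsLoss _ _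
  simp only [e3]
  refine h3.congr_deriv ?_
  have sym : ∀ {q : ℕ} (W Z : Matrix (Fin q) (Fin κ) ℝ),
      frobInner E (Z.transpose * W + W.transpose * Z) = 2 * frobInner (W * E) Z := fun W Z => by
    have h4 : frobInner E (Z.transpose * W) = frobInner E (W.transpose * Z) := by
      rw [← frobInner_transpose, hEt, Matrix.transpose_mul, Matrix.transpose_transpose]
    rw [frobInner_add_right, h4, frobInner_mul_left, Matrix.transpose_transpose]
    ring
  have h5 : inner ℝ (matVec κ κ E) (matVec κ κ ((S.transpose * U + U.transpose * S) -
      (T.transpose * V + V.transpose * T))) = 2 * frobInner (U * E) S - 2 * frobInner (V * E) T := by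
    rw [← sym, ← sym, ← frobInner_sub_right]
    rfl
  have h6 : frobInner G (S * V.transpose + U * T.transpose) =
      frobInner (G * V) S + frobInner (G.transpose * U) T := by
    rw [frobInner_add_right, frobInner_mul_right, Matrix.transpose_transpose, frobInner_mul_left,
      ← frobInner_transpose (U.transpose * G), Matrix.transpose_mul, Matrix.transpose_transpose,
      Matrix.transpose_transpose]
  rw [h5, ← hG, h6, frobInner_add_left, frobInner_add_left, frobInner_smul_left,
    frobInner_smul_left, frobInner_smul_left, frobInner_smul_left]
  ring

lemma toFactor_add_smul (U S : Matrix (Fin m) (Fin κ) ℝ) (V T : Matrix (Fin n) (Fin κ) ℝ) (t : ℝ) :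
    toFactor U V + t • toFactor S T = toFactor (U + t • S) (V + t • T) := rfl

lemma norm_toFactor_sq (U : Matrix (Fin m) (Fin κ) ℝ) (V : Matrix (Fin n) (Fin κ) ℝ) :
    ‖toFactor U V‖ ^ 2 = frobNorm U ^ 2 + frobNorm V ^ 2 :=
  WithLp.prod_norm_sq_eq_of_L2 _

lemma frobNorm_le_norm_toFactor_left (U : Matrix (Fin m) (Fin κ) ℝ)
    (V : Matrix (Fin n) (Fin κ) ℝ) : frobNorm U ≤ ‖toFactor U V‖ := by
  refine abs_le_of_sq_le_sq' ?_ (norm_nonneg _) |>.2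
  rw [norm_toFactor_sq]
  linarith [sq_nonneg (frobNorm V)]

lemma frobNorm_le_norm_toFactor_right (U : Matrix (Fin m) (Fin κ) ℝ)
    (V : Matrix (Fin n) (Fin κ) ℝ) : frobNorm V ≤ ‖toFactor U V‖ := by
  refine abs_le_of_sq_le_sq' ?_ (norm_nonneg _) |>.2
  rw [norm_toFactor_sq]
  linarith [sq_nonneg (frobNorm U)]

end DirectionalDerivatives

/-! ### The radius keeps the supported columns where `θ = 1`. -/

section Radius

/-- Within the given radius of a column of norm at least `s`, a column stays in the region where
the penalty is constant. -/
lemma one_le_mul_sub_of_radius_bounds {s g τ R : ℝ} (hs : 0 < s) (hg : 1 ≤ g) (hτ : 1 ≤ τ)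
    (hτg : g ≤ τ * s ^ 2) (hR : R ≤ s / 4) (hR' : 8 * s * R ≤ g ^ 2 - 1) : 1 ≤ τ * (s - R) := by
  have hsR : 0 < s - R := by linarith
  -- If `g < s²`, then `s - R ≥ 1` already and `τ ≥ 1` suffices. Otherwise `τ ≥ g / s²` reduces the
  -- claim to `s² ≤ g (s - R)`.
  rcases lt_or_ge g (s ^ 2) with h | h
  · have h1 : 1 ≤ s - R := by
      have hs1 : 1 < s := by nlinarith
      rcases le_or_gt (4 / 3) s with h2 | h2
      · linarith
      · have h3 : g ^ 2 ≤ s ^ 4 := by nlinarith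
        have h4 : s ^ 4 - 1 ≤ 8 * s * (s - 1) := by
          have : (s + 1) * (s ^ 2 + 1) ≤ 8 * s := by nlinarith
          nlinarith
        have h5 : R ≤ s - 1 := le_of_mul_le_mul_left (by linarith) (show 0 < 8 * s by linarith)
        linarith
    nlinarith
  · have key : s ^ 2 ≤ g * (s - R) := by
      rcases le_or_gt (4 / 3 * s) g with h2 | h2
      · nlinarith
      -- The worst case `R = (g² - 1) / (8 s)` requires `g (g² - 1) ≤ 8 s² (g - s)`. With `g = a²`
      -- and `3a²/4 ≤ s ≤ a`, the right side is at least its value at `s = a`.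
      · obtain ⟨a, ha, hag⟩ : ∃ a, 0 ≤ a ∧ a ^ 2 = g :=
          ⟨√g, Real.sqrt_nonneg _, Real.sq_sqrt (by linarith)⟩
        have ha1 : 1 ≤ a := by nlinarith
        have hsa : s ≤ a := abs_le_of_sq_le_sq' (hag ▸ h) ha |>.2
        have ha2 : a ≤ 4 / 3 := by
          rw [← hag] at h2
          nlinarith
        have h3 : a ^ 2 * (a ^ 2 - a) ≤ s ^ 2 * (a ^ 2 - s) := by
          have e : s ^ 2 * (a ^ 2 - s) - a ^ 2 * (a ^ 2 - a) =
              (a - s) * (a ^ 2 + a * s + s ^ 2 - a ^ 2 * (a + s)) := by ring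
          have h4 : 0 ≤ a ^ 2 + a * s + s ^ 2 - a ^ 2 * (a + s) := by
            have h5 : 3 / 4 * a ^ 2 ≤ s := by rw [hag]; linarith
            have h6 : 0 ≤ (s - 3 / 4 * a ^ 2) * (s + a - 1 / 4 * a ^ 2) :=
              mul_nonneg (by linarith) (by nlinarith)
            nlinarith
          have := mul_nonneg (sub_nonneg.2 hsa) h4
          linarith
        have h7 : g * (g ^ 2 - 1) ≤ 8 * (s ^ 2 * (g - s)) := by
          rw [← hag]
          have h8 : (a + 1) * (a ^ 2 + 1) ≤ 8 * a := by nlinarith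
          have h9 : 0 ≤ a ^ 2 * (a - 1) := mul_nonneg (sq_nonneg a) (by linarith)
          have := mul_le_mul_of_nonneg_left h8 h9
          nlinarith
        have h10 : g * (8 * s * R) ≤ g * (g ^ 2 - 1) :=
          mul_le_mul_of_nonneg_left hR' (by linarith)
        have h11 : s * (8 * (g * R)) ≤ s * (8 * (s * (g - s))) := by linarith
        have := le_of_mul_le_mul_left h11 hs
        linarith
    have h1 : s ^ 2 ≤ s ^ 2 * (τ * (s - R)) := by
      calc s ^ 2 ≤ g * (s - R) := key
        _ ≤ τ * s ^ 2 * (s - R) := mul_le_mul_of_nonneg_right hτg hsR.le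
        _ = _ := by ring
    exact le_of_mul_le_mul_left (by linarith) (show 0 < s ^ 2 by positivity)

variable {m n p κ r : ℕ} {A : SamplingOp m n p} {M : Matrix (Fin m) (Fin n) ℝ}
  {φ : ℝ → EReal} {ν μ ρ α β ϖ c : ℝ}

lemma PenaltyRegime.sqrt_α_le_opNorm (H : PenaltyRegime A M φ ν μ ρ α β ϖ c κ r) :
    √α ≤ opNorm A := by
  have hM : 0 < frobNorm M := by
    refine (frobNorm_nonneg M).lt_of_ne' (frobNorm_eq_zero.not.2 fun h => ?_)
    have := H.rank_eq
    have := H.one_le_r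
    simp only [h, Matrix.rank_zero] at *
    omega
  have h1 := H.le_norm M (by have := H.rank_eq; omega)
  have h2 := pow_le_pow_left₀ (norm_nonneg _) (norm_apply_le_opNorm A M) 2
  rw [mul_pow] at h2
  rw [Real.sqrt_le_iff]
  exact ⟨opNorm_nonneg A, le_of_mul_le_mul_right (h1.trans h2) (by positivity)⟩

lemma PenaltyRegime.klRadius_pos (H : PenaltyRegime A M φ ν μ ρ α β ϖ c κ r) :
    0 < klRadius ν μ ρ ϖ c (singVal M 1) (singVal M r) (opNorm A) := by
  have hσ := H.σr_pos
  have hσ₁ := hσ.trans_le (singVal_le_singVal_one M r)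
  have hρ := H.ρ_pos
  have hϖ := H.slope.ϖ_pos
  have hc := H.slope.c_pos
  have hμ := H.μ_pos
  have hA := opNorm_nonneg A
  refine lt_min (lt_min (by positivity) (by positivity)) ?_
  exact div_pos (by positivity) (by positivity)

/-- Columns close to a column of norm at least `√σ_r` have penalty one. -/
lemma PenaltyRegime.leftDeriv_le_mul_sub_klRadius (H : PenaltyRegime A M φ ν μ ρ α β ϖ c κ r) :
    leftDerivAtOne φ ≤ ρ * (√(singVal M r) -
      klRadius ν μ ρ ϖ c (singVal M 1) (singVal M r) (opNorm A)) := by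
  have hσ := H.σr_pos
  have hσ₁ := singVal_le_singVal_one M r
  have hρ := H.ρ_pos
  have hϖ := H.slope.ϖ_pos
  have hc := H.slope.c_pos
  have hμ := H.μ_pos
  have hν := H.ν_pos
  have hA := opNorm_nonneg A
  have hL := H.generator.leftDerivAtOne_pos
  have hR := H.klRadius_pos
  set R := klRadius ν μ ρ ϖ c (singVal M 1) (singVal M r) (opNorm A) with hRdef
  set s := √(singVal M r) with hs
  have hs2 : s ^ 2 = singVal M r := Real.sq_sqrt hσ.le
  have hs0 : 0 < s := Real.sqrt_pos.2 hσ
  set L := leftDerivAtOne φ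
  have hR1 : R ≤ s / 4 := (min_le_left _ _).trans (min_le_left _ _)
  have hR2 : R ≤ ϖ / ρ := (min_le_left _ _).trans (min_le_right _ _)
  have hR3 : R ≤ c * ρ / (4 * √ν * opNorm A + 16 * μ * singVal M 1) := min_le_right _ _
  have hden : 0 < 4 * √ν * opNorm A + 16 * μ * singVal M 1 := by
    have : 0 < singVal M 1 := hσ.trans_le hσ₁
    positivity
  rw [le_div_iff₀ hρ] at hR2
  rw [le_div_iff₀ hden] at hR3
  have hsμ : 0 < √μ := Real.sqrt_pos.2 hμ
  have hr1 : (1 : ℝ) ≤ √r := by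
    rw [Real.one_le_sqrt]
    exact_mod_cast H.one_le_r
  have hκ1 : (1 : ℝ) ≤ √κ := by
    rw [Real.one_le_sqrt]
    exact_mod_cast H.one_le_r.trans H.r_le
  set y := √r / √μ with hy
  have hB : 1 + 2 * √r / √μ = 1 + 2 * y := by rw [hy]; ring
  have hy0 : 0 ≤ y := by positivity
  -- Multiplying `R ρ ≤ ϖ` by `16 μ σ_r R ≤ c ρ` eliminates `ρ`, since `c ϖ ≤ 1`. This yields `4 s R
  -- √μ ≤ 1 ≤ √r`.
  have hRy : 4 * s * R ≤ y := by
    have h1 : R * (16 * μ * s ^ 2) ≤ c * ρ := by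
      refine le_trans (mul_le_mul_of_nonneg_left ?_ hR.le) hR3
      rw [hs2]
      have : 0 ≤ 4 * √ν * opNorm A := by positivity
      nlinarith
    have h2 : (R * ρ) * (R * (16 * μ * s ^ 2)) ≤ ϖ * (c * ρ) :=
      mul_le_mul hR2 h1 (by positivity) hϖ.le
    have h3 := H.slope.mul_le_one H.generator
    have h4 : ρ * (16 * μ * s ^ 2 * R ^ 2) ≤ ρ * 1 := by nlinarith
    have h5 := le_of_mul_le_mul_left h4 hρ
    rw [hy, le_div_iff₀ hsμ]
    refine le_trans ?_ hr1
    refine abs_le_of_sq_le_sq' ?_ zero_le_one |>.2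
    rw [mul_pow, Real.sq_sqrt hμ.le]
    linarith
  have hg1 : 1 ≤ √(1 + 2 * y) := by
    rw [Real.one_le_sqrt]
    linarith
  -- The threshold inequality, with `√κ ≥ 1`, `√α ≤ ‖𝒜‖` and `√2` dropped, allows `√ν ‖𝒜‖` to be
  -- cancelled.
  have hτg : √(1 + 2 * y) ≤ ρ / L * s ^ 2 := by
    have h1 := H.mul_lt_mul_gap
    rw [hB] at h1
    have hx : √(ν * α) ≤ √ν * opNorm A := by
      rw [Real.sqrt_mul hν.le]
      exact mul_le_mul_of_nonneg_left H.sqrt_α_le_opNorm (Real.sqrt_nonneg _)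
    have hx0 : 0 < √ν * opNorm A := by
      have := Real.sqrt_pos.2 (mul_pos hν H.α_pos)
      linarith
    have h2 : √ν * opNorm A * (√(1 + 2 * y) * L) ≤ √ν * opNorm A * (ρ * s ^ 2) := by
      calc √ν * opNorm A * (√(1 + 2 * y) * L)
          ≤ √ν * opNorm A * (√(1 + 2 * y) * L) * √κ :=
            le_mul_of_one_le_right (by positivity) hκ1
        _ = √ν * opNorm A * √κ * √(1 + 2 * y) * L := by ring
        _ ≤ ρ * (√(ν * α) * singVal M r - √2) := h1.le
        _ ≤ ρ * (√ν * opNorm A * s ^ 2) := by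
            rw [hs2]
            refine mul_le_mul_of_nonneg_left ?_ hρ.le
            have := mul_le_mul_of_nonneg_right hx hσ.le
            linarith [Real.sqrt_nonneg 2]
        _ = _ := by ring
    rw [div_mul_eq_mul_div, le_div_iff₀ hL]
    exact le_of_mul_le_mul_left h2 hx0
  have hfin := one_le_mul_sub_of_radius_bounds hs0 hg1 ((one_le_div hL).2 H.leftDeriv_lt.le) hτg hR1
    (by rw [Real.sq_sqrt (by linarith)]; linarith)
  rw [div_mul_eq_mul_div, le_div_iff₀ hL, one_mul] at hfin
  exact hfin

end Radius

/-! ### Structure and value of the balanced solutions. -/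

section NearBalanced

variable {m n p κ r : ℕ} {A : SamplingOp m n p} {M : Matrix (Fin m) (Fin n) ℝ}
  {φ : ℝ → EReal} {ν μ ρ α β ϖ c : ℝ}
  {Ub : Matrix (Fin m) (Fin κ) ℝ} {Vb : Matrix (Fin n) (Fin κ) ℝ}

/-- The support and the equations of a balanced solution. -/
structure BalancedWithSupport (M : Matrix (Fin m) (Fin n) ℝ) (r : ℕ)
    (Ub : Matrix (Fin m) (Fin κ) ℝ) (Vb : Matrix (Fin n) (Fin κ) ℝ) (J : Finset (Fin κ)) : Prop where
  card_eq : J.card = r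
  left_zero : ∀ j ∉ J, ∀ i, Ub i j = 0
  right_zero : ∀ j ∉ J, ∀ i, Vb i j = 0
  mul_eq : Ub * Vb.transpose = M
  gram_eq : Ub.transpose * Ub = Vb.transpose * Vb

lemma colNorm_eq_of_balanced (h : Ub.transpose * Ub = Vb.transpose * Vb) (j : Fin κ) :
    colNorm Ub j = colNorm Vb j := by
  rw [← sq_eq_sq₀ (colNorm_nonneg _ _) (colNorm_nonneg _ _), colNorm_sq, colNorm_sq, h]

/-- `J` indexes the nonzero columns of `Ub`. Equal Gram matrices have equal diagonals, so `Vb` has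
the same zero columns. -/
lemma PenaltyRegime.exists_support (H : PenaltyRegime A M φ ν μ ρ α β ϖ c κ r)
    (h : (Ub, Vb) ∈ balancedSolutions (lsLoss A (A M)) ν κ) :
    ∃ J, BalancedWithSupport M r Ub Vb J := by
  classical
  obtain ⟨⟨hsol, -⟩, hgram, hU, -⟩ := h
  have hM : Ub * Vb.transpose = M := (H.mem_solutions _).1 hsol
  have hU' : normTwoZero Ub = r := by rw [← H.rank_eq, ← hM]; exact hU
  have hU0 : ∀ j ∉ Finset.univ.filter fun j => Ub.col j ≠ 0, ∀ i, Ub i j = 0 := fun j hj => by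
    have h0 : Ub.col j = 0 := by simpa using hj
    exact congrFun h0
  refine ⟨Finset.univ.filter fun j => Ub.col j ≠ 0, ?_, hU0, fun j hj => ?_, hM, hgram⟩
  · rw [← hU', normTwoZero, ← Set.ncard_coe_finset]
    congr 1
    ext j
    simp
  · rw [← colNorm_eq_zero, ← colNorm_eq_of_balanced hgram, colNorm_eq_zero]
    exact hU0 j hj

namespace BalancedWithSupport

variable {J : Finset (Fin κ)}

lemma norm_mulVec_le_left (hB : BalancedWithSupport M r Ub Vb J) (x : Fin κ → ℝ) :
    ‖evec (Ub.mulVec x)‖ ≤ √(singVal M 1) * ‖evec x‖ :=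
  norm_mulVec_le_of_balanced hB.mul_eq hB.gram_eq x

lemma norm_mulVec_le_right (hB : BalancedWithSupport M r Ub Vb J) (x : Fin κ → ℝ) :
    ‖evec (Vb.mulVec x)‖ ≤ √(singVal M 1) * ‖evec x‖ :=
  norm_mulVec_eq_of_balanced hB.gram_eq x ▸ hB.norm_mulVec_le_left x

lemma le_norm_mulVec_left (hB : BalancedWithSupport M r Ub Vb J) (hr : 1 ≤ r) (hM : M.rank = r)
    {z : Fin κ → ℝ} (hz : ∀ j ∉ J, z j = 0) :
    √(singVal M r) * ‖evec z‖ ≤ ‖evec (Ub.mulVec z)‖ :=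
  le_norm_mulVec_of_balanced hB.mul_eq hB.gram_eq hr hM hB.card_eq.le hB.left_zero hz

lemma le_norm_mulVec_right (hB : BalancedWithSupport M r Ub Vb J) (hr : 1 ≤ r) (hM : M.rank = r)
    {z : Fin κ → ℝ} (hz : ∀ j ∉ J, z j = 0) :
    √(singVal M r) * ‖evec z‖ ≤ ‖evec (Vb.mulVec z)‖ :=
  norm_mulVec_eq_of_balanced hB.gram_eq z ▸ hB.le_norm_mulVec_left hr hM hz

lemma le_colNorm_left (hB : BalancedWithSupport M r Ub Vb J) (hr : 1 ≤ r) (hM : M.rank = r)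
    {j : Fin κ} (hj : j ∈ J) : √(singVal M r) ≤ colNorm Ub j := by
  classical
  have h := hB.le_norm_mulVec_left hr hM (z := Pi.single j 1) fun l hl => by
    rw [Pi.single_eq_of_ne]
    rintro rfl
    exact hl hj
  rw [Matrix.mulVec_single_one] at h
  change _ ≤ ‖evec (Ub.col j)‖
  simpa using h

lemma le_colNorm_right (hB : BalancedWithSupport M r Ub Vb J) (hr : 1 ≤ r) (hM : M.rank = r)
    {j : Fin κ} (hj : j ∈ J) : √(singVal M r) ≤ colNorm Vb j :=
  colNorm_eq_of_balanced hB.gram_eq j ▸ hB.le_colNorm_left hr hM hj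

lemma Theta_eq (hB : BalancedWithSupport M r Ub Vb J)
    (H : PenaltyRegime A M φ ν μ ρ α β ϖ c κ r) :
    Theta (lsLoss A (A M)) ν μ φ ρ κ (toFactor Ub Vb) = r := by
  have hbig := H.leftDeriv_le_mul_sub_klRadius
  have hR := H.klRadius_pos
  have hρ := H.ρ_pos
  have hone : ∀ t, √(singVal M r) ≤ t → theta φ (ρ * t) = 1 := fun t ht => by
    refine theta_eq_one H.generator (hbig.trans (mul_le_mul_of_nonneg_left ?_ hρ.le))
    linarith
  rw [Theta_toFactor, smoothPart_lsLoss, hB.mul_eq, hB.gram_eq]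
  simp only [sub_self, map_zero, norm_zero, frobNorm]
  rw [← Finset.sum_add_sum_compl J]
  have h1 : ∑ j ∈ J, 1 / 2 * (theta φ (ρ * colNorm Ub j) + theta φ (ρ * colNorm Vb j)) = r := by
    rw [← hB.card_eq, Finset.card_eq_sum_ones, Nat.cast_sum]
    refine Finset.sum_congr rfl fun j hj => ?_
    rw [hone _ (hB.le_colNorm_left H.one_le_r H.rank_eq hj),
      hone _ (hB.le_colNorm_right H.one_le_r H.rank_eq hj)]
    norm_num
  have h2 : ∑ j ∈ Jᶜ, 1 / 2 * (theta φ (ρ * colNorm Ub j) + theta φ (ρ * colNorm Vb j)) = 0 := by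
    refine Finset.sum_eq_zero fun j hj => ?_
    have hj' : j ∉ J := by simpa using hj
    rw [colNorm_eq_zero.2 (hB.left_zero j hj'), colNorm_eq_zero.2 (hB.right_zero j hj'), mul_zero,
      theta_zero H.generator]
    norm_num
  rw [h1, h2]
  norm_num

end BalancedWithSupport

end NearBalanced

/-! ### Bounds that persist within the radius. -/

section NearFactor

/-- A factor `U` within the Kurdyka-Łojasiewicz radius of a balanced factor supported on `J`. -/
structure NearFactor {m κ : ℕ} (s₁ s L ρ ϖ R : ℝ) (J : Finset (Fin κ))
    (U : Matrix (Fin m) (Fin κ) ℝ) : Prop where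
  norm_mulVec_le : ∀ x, ‖evec (U.mulVec x)‖ ≤ 5 / 4 * s₁ * ‖evec x‖
  le_norm_mulVec : ∀ z : Fin κ → ℝ, (∀ j ∉ J, z j = 0) →
    3 / 4 * s * ‖evec z‖ ≤ ‖evec (U.mulVec z)‖
  lt_mul_colNorm : ∀ j ∈ J, L < ρ * colNorm U j
  colNorm_lt : ∀ j ∉ J, colNorm U j < R
  mul_colNorm_lt : ∀ j ∉ J, ρ * colNorm U j < ϖ

/-- The factors `5/4` and `3/4` come from `R ≤ s / 4 ≤ s₁ / 4`. -/
lemma nearFactor_of_frobNorm_lt {m κ : ℕ} {s₁ s L ρ ϖ R : ℝ} {J : Finset (Fin κ)}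
    {U W : Matrix (Fin m) (Fin κ) ℝ} (hs : s ≤ s₁) (hρ : 0 < ρ) (hRs : R ≤ s / 4)
    (hRϖ : R ≤ ϖ / ρ) (hL : L ≤ ρ * (s - R))
    (hup : ∀ x, ‖evec (W.mulVec x)‖ ≤ s₁ * ‖evec x‖)
    (hlow : ∀ z : Fin κ → ℝ, (∀ j ∉ J, z j = 0) → s * ‖evec z‖ ≤ ‖evec (W.mulVec z)‖)
    (hcol : ∀ j ∈ J, s ≤ colNorm W j) (hzero : ∀ j ∉ J, ∀ i, W i j = 0)
    (hUW : frobNorm (U - W) < R) : NearFactor s₁ s L ρ ϖ R J U := by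
  have hcolR : ∀ j ∉ J, colNorm U j < R := fun j hj => by
    have h1 := colNorm_sub_le U W j
    rw [colNorm_eq_zero.2 (hzero j hj), sub_zero] at h1
    exact (h1.trans (colNorm_le_frobNorm _ _)).trans_lt hUW
  refine ⟨fun x => ?_, fun z hz => ?_, fun j hj => ?_, hcolR, fun j hj => ?_⟩
  · have h1 := (abs_le.1 (norm_mulVec_sub_le U W x)).2
    have h2 := hup x
    have h3 := mul_le_mul_of_nonneg_right (show frobNorm (U - W) ≤ s₁ / 4 by linarith)
      (norm_nonneg (evec x))
    linarith
  · have h1 := (abs_le.1 (norm_mulVec_sub_le U W z)).1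
    have h2 := hlow z hz
    have h3 := mul_le_mul_of_nonneg_right (show frobNorm (U - W) ≤ s / 4 by linarith)
      (norm_nonneg (evec z))
    linarith
  · refine hL.trans_lt (mul_lt_mul_of_pos_left ?_ hρ)
    have h1 := colNorm_sub_le W U j
    have h2 := colNorm_le_frobNorm (W - U) j
    have h3 : frobNorm (W - U) = frobNorm (U - W) := by
      rw [frobNorm, map_sub, norm_sub_rev, ← map_sub, frobNorm]
    linarith [hcol j hj]
  · have := (hcolR j hj).trans_le hRϖ
    rwa [lt_div_iff₀ hρ, mul_comm] at this

variable {m n p κ r : ℕ} {A : SamplingOp m n p} {M : Matrix (Fin m) (Fin n) ℝ}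
  {φ : ℝ → EReal} {ν μ ρ α β ϖ c : ℝ}
  {Ub U : Matrix (Fin m) (Fin κ) ℝ} {Vb V : Matrix (Fin n) (Fin κ) ℝ} {J : Finset (Fin κ)}

lemma BalancedWithSupport.nearFactors (hB : BalancedWithSupport M r Ub Vb J)
    (H : PenaltyRegime A M φ ν μ ρ α β ϖ c κ r)
    (h : ‖toFactor (U - Ub) (V - Vb)‖ <
      klRadius ν μ ρ ϖ c (singVal M 1) (singVal M r) (opNorm A)) :
    NearFactor √(singVal M 1) √(singVal M r) (leftDerivAtOne φ) ρ ϖ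
      (klRadius ν μ ρ ϖ c (singVal M 1) (singVal M r) (opNorm A)) J U ∧
    NearFactor √(singVal M 1) √(singVal M r) (leftDerivAtOne φ) ρ ϖ
      (klRadius ν μ ρ ϖ c (singVal M 1) (singVal M r) (opNorm A)) J V := by
  have hR1 : klRadius ν μ ρ ϖ c (singVal M 1) (singVal M r) (opNorm A) ≤ √(singVal M r) / 4 :=
    (min_le_left _ _).trans (min_le_left _ _)
  have hR2 : klRadius ν μ ρ ϖ c (singVal M 1) (singVal M r) (opNorm A) ≤ ϖ / ρ :=
    (min_le_left _ _).trans (min_le_right _ _)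
  have hs := Real.sqrt_le_sqrt (singVal_le_singVal_one M r)
  exact ⟨nearFactor_of_frobNorm_lt hs H.ρ_pos hR1 hR2 H.leftDeriv_le_mul_sub_klRadius
      hB.norm_mulVec_le_left (fun z hz => hB.le_norm_mulVec_left H.one_le_r H.rank_eq hz)
      (fun j hj => hB.le_colNorm_left H.one_le_r H.rank_eq hj) hB.left_zero
      ((frobNorm_le_norm_toFactor_left _ _).trans_lt h),
    nearFactor_of_frobNorm_lt hs H.ρ_pos hR1 hR2 H.leftDeriv_le_mul_sub_klRadius
      hB.norm_mulVec_le_right (fun z hz => hB.le_norm_mulVec_right H.one_le_r H.rank_eq hz)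
      (fun j hj => hB.le_colNorm_right H.one_le_r H.rank_eq hj) hB.right_zero
      ((frobNorm_le_norm_toFactor_right _ _).trans_lt h)⟩

end NearFactor

/-! ### Derivatives along the scaling of a single column. -/

section ColumnDirection

variable {m n p κ r : ℕ} {φ : ℝ → EReal} {ν μ ρ ϖ c : ℝ}

/-- The matrix that keeps only the `j`-th column. -/
def keepCol (U : Matrix (Fin m) (Fin κ) ℝ) (j : Fin κ) : Matrix (Fin m) (Fin κ) ℝ :=
  Matrix.of fun i l => if l = j then U i l else 0

lemma colNorm_keepCol_self (U : Matrix (Fin m) (Fin κ) ℝ) (j : Fin κ) :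
    colNorm (keepCol U j) j = colNorm U j := by
  simp [colNorm, keepCol]

lemma colNorm_keepCol_of_ne (U : Matrix (Fin m) (Fin κ) ℝ) {j l : Fin κ} (h : l ≠ j) :
    colNorm (keepCol U j) l = 0 :=
  colNorm_eq_zero.2 fun _ => if_neg h

lemma frobNorm_keepCol (U : Matrix (Fin m) (Fin κ) ℝ) (j : Fin κ) :
    frobNorm (keepCol U j) = colNorm U j := by
  rw [← sq_eq_sq₀ (frobNorm_nonneg _) (colNorm_nonneg _ _), frobNorm_sq_eq_sum_col,
    Finset.sum_eq_single j, colNorm_keepCol_self]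
  · intro l _ hl
    rw [colNorm_keepCol_of_ne U hl]
    norm_num
  · simp

lemma colNorm_add_smul_keepCol (U : Matrix (Fin m) (Fin κ) ℝ) (j l : Fin κ) (t : ℝ) :
    colNorm (U + t • keepCol U j) l = if l = j then |1 + t| * colNorm U l else colNorm U l := by
  split_ifs with h
  · have e : (fun i => (U + t • keepCol U j) i l) = (1 + t) • fun i => U i l := by
      ext i
      simp [keepCol, h]
      ring
    rw [colNorm, e, WithLp.toLp_smul, norm_smul, Real.norm_eq_abs, colNorm]
  · have e : (fun i => (U + t • keepCol U j) i l) = fun i => U i l := by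
      ext i
      simp [keepCol, h]
    rw [colNorm, e, colNorm]

/-- In this direction column `j` is multiplied by `1 + t`, so its norm is linear in `t` near `0` and
all other terms are constant. -/
lemma hasDerivAt_sum_theta_keepCol {U : Matrix (Fin m) (Fin κ) ℝ} {j : Fin κ}
    (hd : DifferentiableAt ℝ (theta φ) (ρ * colNorm U j)) :
    HasDerivAt (fun t : ℝ => ∑ l, theta φ (ρ * colNorm (U + t • keepCol U j) l))
      (deriv (theta φ) (ρ * colNorm U j) * (ρ * colNorm U j)) 0 := by
  have h : ∀ l ∈ Finset.univ,
      HasDerivAt (fun t : ℝ => theta φ (ρ * colNorm (U + t • keepCol U j) l))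
        (if l = j then deriv (theta φ) (ρ * colNorm U j) * (ρ * colNorm U j) else 0) 0 := by
    intro l _
    simp only [colNorm_add_smul_keepCol]
    split_ifs with hl
    · subst hl
      have h1 : HasDerivAt (fun t : ℝ => ρ * ((1 + t) * colNorm U l)) (ρ * colNorm U l) 0 := by
        have := (((hasDerivAt_id (0 : ℝ)).const_add 1).mul_const (colNorm U l)).const_mul ρ
        simpa using this
      have h2 : HasDerivAt (theta φ) (deriv (theta φ) (ρ * colNorm U l))
          (ρ * ((1 + (0 : ℝ)) * colNorm U l)) := by
        rw [add_zero, one_mul]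
        exact hd.hasDerivAt
      refine (h2.comp (0 : ℝ) h1).congr_of_eventuallyEq ?_
      filter_upwards [eventually_gt_nhds (show (-1 : ℝ) < 0 by norm_num)] with t ht
      rw [abs_of_pos (by linarith)]
      rfl
    · exact hasDerivAt_const _ _
  have := HasDerivAt.fun_sum h
  simpa using this

lemma frobInner_le_colNorm_mul {X S : Matrix (Fin m) (Fin κ) ℝ} {j : Fin κ}
    (hS : ∀ l, l ≠ j → ∀ i, S i l = 0) : |frobInner X S| ≤ colNorm X j * colNorm S j := by
  have h : frobInner X S = inner ℝ (evec (X.col j)) (evec (S.col j)) := by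
    rw [inner_evec, frobInner_eq_sum, Finset.sum_comm, Finset.sum_eq_single j]
    · rfl
    · intro l _ hl
      simp [hS l hl]
    · simp
  rw [h]
  exact abs_real_inner_le_norm _ _

lemma norm_transpose_mulVec_le {U : Matrix (Fin m) (Fin κ) ℝ} {u : ℝ}
    (hu0 : 0 ≤ u) (hu : ∀ x, ‖evec (U.mulVec x)‖ ≤ u * ‖evec x‖) (y : Fin m → ℝ) :
    ‖evec (U.transpose.mulVec y)‖ ≤ u * ‖evec y‖ := by
  have h1 : ‖evec (U.transpose.mulVec y)‖ ^ 2 ≤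
      ‖evec y‖ * ‖evec (U.mulVec (U.transpose.mulVec y))‖ := by
    refine le_trans (le_of_eq ?_) (real_inner_le_norm _ _)
    rw [norm_evec_sq, inner_evec, Matrix.dotProduct_mulVec y, ← Matrix.mulVec_transpose]
  have h2 := hu (U.transpose.mulVec y)
  have h3 := norm_nonneg (evec y)
  have h4 := norm_nonneg (evec (U.transpose.mulVec y))
  have h5 := norm_nonneg (evec (U.mulVec (U.transpose.mulVec y)))
  rcases h4.eq_or_lt with h0 | h0
  · rw [← h0]
    positivity
  · refine le_of_mul_le_mul_right ?_ h0
    nlinarith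

lemma colNorm_gram_sub_le {U : Matrix (Fin m) (Fin κ) ℝ} {V : Matrix (Fin n) (Fin κ) ℝ} {u : ℝ}
    (hu0 : 0 ≤ u)
    (hU : ∀ x, ‖evec (U.mulVec x)‖ ≤ u * ‖evec x‖) (hV : ∀ x, ‖evec (V.mulVec x)‖ ≤ u * ‖evec x‖)
    (j : Fin κ) : colNorm (U.transpose * U - V.transpose * V) j ≤
      u * (colNorm U j + colNorm V j) := by
  have h1 : colNorm (U.transpose * U - V.transpose * V) j ≤
      colNorm (U.transpose * U) j + colNorm (V.transpose * V) j :=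
    norm_sub_le (evec ((U.transpose * U).col j)) (evec ((V.transpose * V).col j))
  have h2 : colNorm (U.transpose * U) j ≤ u * colNorm U j := norm_transpose_mulVec_le hu0 hU _
  have h3 : colNorm (V.transpose * V) j ≤ u * colNorm V j := norm_transpose_mulVec_le hu0 hV _
  linarith

/-- For `S` supported on column `j`, the product `S Vᵀ` sees only `V_j`. The bound is thus
proportional to column norms that are small outside `J`. -/
lemma neg_le_frobInner_gradient {G : Matrix (Fin m) (Fin n) ℝ} {U S : Matrix (Fin m) (Fin κ) ℝ}
    {V : Matrix (Fin n) (Fin κ) ℝ} {E : Matrix (Fin κ) (Fin κ) ℝ} {j : Fin κ} {g u e μ' : ℝ}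
    (hν : 0 ≤ ν) (hg : 0 ≤ g) (hu0 : 0 ≤ u) (hG : ∀ X, -(g * frobNorm X) ≤ frobInner G X)
    (hU : ∀ x, ‖evec (U.mulVec x)‖ ≤ u * ‖evec x‖) (hE : colNorm E j ≤ e)
    (hS : ∀ l, l ≠ j → ∀ i, S i l = 0) :
    -((ν * (g * colNorm V j) + |μ'| * (u * e)) * colNorm S j) ≤
      frobInner (ν • (G * V) + μ' • (U * E)) S := by
  rw [frobInner_add_left, frobInner_smul_left, frobInner_smul_left]
  have h1 : frobInner (G * V) S = frobInner G (S * V.transpose) := by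
    rw [frobInner_mul_right, Matrix.transpose_transpose]
  have h2 : frobNorm (S * V.transpose) ≤ colNorm S j * colNorm V j := by
    refine (frobNorm_mul_transpose_le _ _).trans (le_of_eq (Finset.sum_eq_single j ?_ ?_))
    · intro l _ hl
      rw [colNorm_eq_zero.2 (hS l hl), zero_mul]
    · simp
  have h3 : -(g * (colNorm S j * colNorm V j)) ≤ frobInner (G * V) S := by
    rw [h1]
    refine le_trans (neg_le_neg ?_) (hG _)
    exact mul_le_mul_of_nonneg_left h2 hg
  have h4 : |frobInner (U * E) S| ≤ u * e * colNorm S j := by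
    refine (frobInner_le_colNorm_mul hS).trans (mul_le_mul_of_nonneg_right ?_ (colNorm_nonneg _ _))
    rw [colNorm_mul]
    exact (hU _).trans (mul_le_mul_of_nonneg_left hE hu0)
  have h5 : |μ' * frobInner (U * E) S| ≤ |μ'| * (u * e * colNorm S j) := by
    rw [abs_mul]
    exact mul_le_mul_of_nonneg_left h4 (abs_nonneg _)
  have h6 := (abs_le.1 h5).1
  have h7 := mul_le_mul_of_nonneg_left h3 hν
  linarith

end ColumnDirection

/-! ### Nonzero columns outside the support, and supported factors. -/

section Cases

variable {m n p κ r : ℕ} {A : SamplingOp m n p} {M : Matrix (Fin m) (Fin n) ℝ}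
  {φ : ℝ → EReal} {ν μ ρ α β ϖ c : ℝ}
  {U : Matrix (Fin m) (Fin κ) ℝ} {V : Matrix (Fin n) (Fin κ) ℝ} {J : Finset (Fin κ)}

lemma Theta_toFactor_eq_add (f : Matrix (Fin m) (Fin n) ℝ → ℝ) (U : Matrix (Fin m) (Fin κ) ℝ)
    (V : Matrix (Fin n) (Fin κ) ℝ) :
    Theta f ν μ φ ρ κ (toFactor U V) = smoothPart f ν μ U V +
      (1 / 2 * ∑ j, theta φ (ρ * colNorm U j) + 1 / 2 * ∑ j, theta φ (ρ * colNorm V j)) := by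
  rw [Theta_toFactor, ← mul_add, ← Finset.sum_add_distrib, Finset.mul_sum]

/-- This is the purpose of the third entry of the radius: `√ν ‖A D‖ ≤ 1` and `2 · 25/16 ≤ 4` bound
the left side by `R (√ν ‖𝒜‖ + 4 μ σ₁)`. -/
lemma PenaltyRegime.column_bound (H : PenaltyRegime A M φ ν μ ρ α β ϖ c κ r)
    {D : Matrix (Fin m) (Fin n) ℝ} (hD : ν * ‖A D‖ ^ 2 ≤ 1) {a b R : ℝ}
    (hR : R = klRadius ν μ ρ ϖ c (singVal M 1) (singVal M r) (opNorm A))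
    (ha : a ≤ R) (hb0 : 0 ≤ b) (hb : b ≤ R) :
    ν * (‖A D‖ * opNorm A * b) + μ * (5 / 4 * √(singVal M 1) *
      (5 / 4 * √(singVal M 1) * (a + b))) ≤ c * ρ / 4 := by
  have hν := H.ν_pos
  have hμ := H.μ_pos
  have hA := opNorm_nonneg A
  have hσ₁ : 0 < singVal M 1 := H.σr_pos.trans_le (singVal_le_singVal_one M r)
  have h1 : √ν * ‖A D‖ ≤ 1 := by
    refine abs_le_of_sq_le_sq' ?_ zero_le_one |>.2
    rw [mul_pow, Real.sq_sqrt hν.le]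
    linarith
  have h2 : ν * (‖A D‖ * opNorm A * b) ≤ √ν * opNorm A * R := by
    calc ν * (‖A D‖ * opNorm A * b) = (√ν * ‖A D‖) * (√ν * opNorm A * b) := by
          conv_lhs => rw [← Real.mul_self_sqrt hν.le]
          ring
      _ ≤ 1 * (√ν * opNorm A * R) :=
          mul_le_mul h1 (mul_le_mul_of_nonneg_left hb (by positivity)) (by positivity) zero_le_one
      _ = _ := one_mul _
  have h3 : μ * (5 / 4 * √(singVal M 1) * (5 / 4 * √(singVal M 1) * (a + b))) =
      25 / 16 * (μ * singVal M 1) * (a + b) := by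
    conv_rhs => rw [← Real.mul_self_sqrt hσ₁.le]
    ring
  have h4 : R * (4 * √ν * opNorm A + 16 * μ * singVal M 1) ≤ c * ρ := by
    rw [← le_div_iff₀ (by positivity), hR]
    exact min_le_right _ _
  have h5 : 25 / 16 * (μ * singVal M 1) * (a + b) ≤ 25 / 16 * (μ * singVal M 1) * (R + R) := by
    gcongr
  have h6 : 0 ≤ μ * singVal M 1 * R := mul_nonneg (by positivity) (hb0.trans hb)
  rw [h3]
  linarith

variable {v : FactorSpace m n κ}

lemma exists_gradient_bound (U : Matrix (Fin m) (Fin κ) ℝ) (V : Matrix (Fin n) (Fin κ) ℝ)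
    (A : SamplingOp m n p) (M : Matrix (Fin m) (Fin n) ℝ) :
    ∃ G : Matrix (Fin m) (Fin n) ℝ,
      (∀ X, frobInner G X = inner ℝ (A (U * V.transpose - M)) (A X)) ∧
      ∀ X, -(‖A (U * V.transpose - M)‖ * opNorm A * frobNorm X) ≤ frobInner G X := by
  obtain ⟨G, hG⟩ := exists_frobInner_eq A (A (U * V.transpose - M))
  refine ⟨G, hG, fun X => ?_⟩
  rw [hG]
  have h1 := (abs_le.1 (abs_real_inner_le_norm (A (U * V.transpose - M)) (A X))).1
  have h2 := mul_le_mul_of_nonneg_left (norm_apply_le_opNorm A X)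
    (norm_nonneg (A (U * V.transpose - M)))
  linarith

/-- The penalty supplies at least `cρ/2` per unit length of `d`, and the smooth part takes back at
most `cρ/4`. -/
lemma le_norm_of_inner_eq {v d : FactorSpace m n κ} {a x θ' y : ℝ} (ha : 0 < a)
    (hd : ‖d‖ = a) (hv : inner ℝ v d = x + 1 / 2 * (θ' * (ρ * a))) (hx : -(y * a) ≤ x)
    (hy : y ≤ c * ρ / 4) (hρ : 0 < ρ) (hθ : c ≤ θ') : c * ρ / 4 ≤ ‖v‖ := by
  have h1 := real_inner_le_norm v d
  rw [hd, hv] at h1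
  have h2 := mul_le_mul_of_nonneg_right hθ (mul_pos hρ ha).le
  have h3 := mul_le_mul_of_nonneg_right hy ha.le
  refine le_of_mul_le_mul_right ?_ ha
  linarith

lemma le_norm_of_left_column_ne_zero (H : PenaltyRegime A M φ ν μ ρ α β ϖ c κ r)
    {R : ℝ} (hR : R = klRadius ν μ ρ ϖ c (singVal M 1) (singVal M r) (opNorm A))
    (hU : NearFactor √(singVal M 1) √(singVal M r) (leftDerivAtOne φ) ρ ϖ R J U)
    (hV : NearFactor √(singVal M 1) √(singVal M r) (leftDerivAtOne φ) ρ ϖ R J V)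
    (hD : ν * ‖A (U * V.transpose - M)‖ ^ 2 ≤ 1)
    (hv : v ∈ regularSubdiff (Theta (lsLoss A (A M)) ν μ φ ρ κ) (toFactor U V))
    {j : Fin κ} (hj : j ∉ J) (hj0 : colNorm U j ≠ 0) : c * ρ / 4 ≤ ‖v‖ := by
  obtain ⟨G, hG, hGb⟩ := exists_gradient_bound U V A M
  have ha : 0 < colNorm U j := (colNorm_nonneg U j).lt_of_ne' hj0
  have hmem : ρ * colNorm U j ∈ Ioo 0 ϖ := ⟨mul_pos H.ρ_pos ha, hU.mul_colNorm_lt j hj⟩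
  have h1 := hasDerivAt_smoothPart (ν := ν) (μ := μ) (S := keepCol U j)
    (T := (0 : Matrix (Fin n) (Fin κ) ℝ)) hG
  have h2 := (hasDerivAt_sum_theta_keepCol (ρ := ρ) (H.slope.differentiable _ hmem)).const_mul (1 / 2)
  have h3 := h1.add (h2.add_const (1 / 2 * ∑ l, theta φ (ρ * colNorm V l)))
  have h4 := inner_eq_of_mem_regularSubdiff (d := toFactor (keepCol U j) 0) hv
    (h3.congr_of_eventuallyEq (Eventually.of_forall fun t => by
      simp only [toFactor_add_smul, Theta_toFactor_eq_add, Pi.add_apply, smul_zero, add_zero]))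
  have hT : ∀ X : Matrix (Fin n) (Fin κ) ℝ, frobInner X 0 = 0 := fun X => by simp [frobInner]
  rw [hT, add_zero] at h4
  have hu0 : 0 ≤ 5 / 4 * √(singVal M 1) := by positivity
  have h5 := neg_le_frobInner_gradient (V := V) (μ' := μ) H.ν_pos.le
    (mul_nonneg (norm_nonneg _) (opNorm_nonneg A)) hu0 hGb hU.norm_mulVec_le
    (colNorm_gram_sub_le hu0 hU.norm_mulVec_le hV.norm_mulVec_le j)
    (S := keepCol U j) (fun l hl _ => if_neg hl)
  rw [colNorm_keepCol_self, abs_of_pos H.μ_pos] at h5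
  refine le_norm_of_inner_eq ha ?_ h4 h5 (H.column_bound hD hR (hU.colNorm_lt j hj).le
    (colNorm_nonneg _ _) (hV.colNorm_lt j hj).le) H.ρ_pos (H.slope.le_deriv _ hmem)
  rw [← sq_eq_sq₀ (norm_nonneg _) ha.le, norm_toFactor_sq, frobNorm_keepCol]
  simp [frobNorm]

lemma le_norm_of_right_column_ne_zero (H : PenaltyRegime A M φ ν μ ρ α β ϖ c κ r)
    {R : ℝ} (hR : R = klRadius ν μ ρ ϖ c (singVal M 1) (singVal M r) (opNorm A))
    (hU : NearFactor √(singVal M 1) √(singVal M r) (leftDerivAtOne φ) ρ ϖ R J U)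
    (hV : NearFactor √(singVal M 1) √(singVal M r) (leftDerivAtOne φ) ρ ϖ R J V)
    (hD : ν * ‖A (U * V.transpose - M)‖ ^ 2 ≤ 1)
    (hv : v ∈ regularSubdiff (Theta (lsLoss A (A M)) ν μ φ ρ κ) (toFactor U V))
    {j : Fin κ} (hj : j ∉ J) (hj0 : colNorm V j ≠ 0) : c * ρ / 4 ≤ ‖v‖ := by
  obtain ⟨G, hG, hGb⟩ := exists_gradient_bound U V A M
  have ha : 0 < colNorm V j := (colNorm_nonneg V j).lt_of_ne' hj0
  have hmem : ρ * colNorm V j ∈ Ioo 0 ϖ := ⟨mul_pos H.ρ_pos ha, hV.mul_colNorm_lt j hj⟩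
  have h1 := hasDerivAt_smoothPart (ν := ν) (μ := μ) (S := (0 : Matrix (Fin m) (Fin κ) ℝ))
    (T := keepCol V j) hG
  have h2 := (hasDerivAt_sum_theta_keepCol (ρ := ρ) (H.slope.differentiable _ hmem)).const_mul (1 / 2)
  have h3 := h1.add (h2.const_add (1 / 2 * ∑ l, theta φ (ρ * colNorm U l)))
  have h4 := inner_eq_of_mem_regularSubdiff (d := toFactor 0 (keepCol V j)) hv
    (h3.congr_of_eventuallyEq (Eventually.of_forall fun t => by
      simp only [toFactor_add_smul, Theta_toFactor_eq_add, Pi.add_apply, smul_zero, add_zero]))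
  have hT : ∀ X : Matrix (Fin m) (Fin κ) ℝ, frobInner X 0 = 0 := fun X => by simp [frobInner]
  rw [hT, zero_add] at h4
  have hu0 : 0 ≤ 5 / 4 * √(singVal M 1) := by positivity
  have hGb' : ∀ X, -(‖A (U * V.transpose - M)‖ * opNorm A * frobNorm X) ≤
      frobInner G.transpose X := fun X => by
    have := hGb X.transpose
    rwa [frobNorm_transpose, ← frobInner_transpose, Matrix.transpose_transpose] at this
  have h5 := neg_le_frobInner_gradient (V := U) (μ' := -μ) H.ν_pos.le
    (mul_nonneg (norm_nonneg _) (opNorm_nonneg A)) hu0 hGb' hV.norm_mulVec_le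
    (colNorm_gram_sub_le hu0 hU.norm_mulVec_le hV.norm_mulVec_le j)
    (S := keepCol V j) (fun l hl _ => if_neg hl)
  rw [colNorm_keepCol_self, abs_neg, abs_of_pos H.μ_pos, add_comm (colNorm U j)] at h5
  refine le_norm_of_inner_eq ha ?_ h4 h5 (H.column_bound hD hR (hV.colNorm_lt j hj).le
    (colNorm_nonneg _ _) (hU.colNorm_lt j hj).le) H.ρ_pos (H.slope.le_deriv _ hmem)
  rw [← sq_eq_sq₀ (norm_nonneg _) ha.le, norm_toFactor_sq, frobNorm_keepCol]
  simp [frobNorm]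

/-- On the columns in `J` the penalty is locally constant. -/
lemma eventually_theta_add_smul_eq_one (hφ : IsPenaltyGenerator φ) (S : Matrix (Fin m) (Fin κ) ℝ)
    {j : Fin κ} (hj : leftDerivAtOne φ < ρ * colNorm U j) :
    ∀ᶠ t : ℝ in 𝓝 0, theta φ (ρ * colNorm (U + t • S) j) = 1 := by
  have hcont : Continuous fun t : ℝ => ρ * colNorm (U + t • S) j := by
    have e : ∀ t : ℝ, colNorm (U + t • S) j = ‖evec (U.col j) + t • evec (S.col j)‖ := fun t => rfl
    simp only [e]
    fun_prop
  have h0 : leftDerivAtOne φ < ρ * colNorm (U + (0 : ℝ) • S) j := by simpa using hj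
  filter_upwards [(hcont.tendsto 0).eventually (lt_mem_nhds h0)] with t ht
  exact theta_eq_one hφ ht.le

/-- Directions supported on `J` leave the zero columns at zero, so the possible kink at zero columns
is never met. -/
lemma eventually_sum_theta_add_smul_eq (hφ : IsPenaltyGenerator φ) {S : Matrix (Fin m) (Fin κ) ℝ}
    (hJ : ∀ j ∈ J, leftDerivAtOne φ < ρ * colNorm U j) (hU : ∀ j ∉ J, ∀ i, U i j = 0)
    (hS : ∀ j ∉ J, ∀ i, S i j = 0) :
    ∀ᶠ t : ℝ in 𝓝 0, ∑ j, theta φ (ρ * colNorm (U + t • S) j) = J.card := by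
  have h1 : ∀ᶠ t : ℝ in 𝓝 0, ∀ j ∈ J, theta φ (ρ * colNorm (U + t • S) j) = 1 :=
    (Filter.eventually_all_finset J).2 fun j hj => eventually_theta_add_smul_eq_one hφ S (hJ j hj)
  filter_upwards [h1] with t ht
  have h2 : ∑ j ∈ Jᶜ, theta φ (ρ * colNorm (U + t • S) j) = 0 := by
    refine Finset.sum_eq_zero fun j hj => ?_
    have hj' : j ∉ J := by simpa using hj
    have : colNorm (U + t • S) j = 0 := colNorm_eq_zero.2 fun i => by
      simp [hU j hj' i, hS j hj' i]
    rw [this, mul_zero, theta_zero hφ]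
  rw [← Finset.sum_add_sum_compl J, h2, add_zero, Finset.sum_congr rfl ht]
  simp

end Cases

/-! ### The error bound and the Kurdyka-Łojasiewicz property. -/

section ErrorBound

variable {m n p κ r : ℕ} {A : SamplingOp m n p} {M : Matrix (Fin m) (Fin n) ℝ}
  {φ : ℝ → EReal} {ν μ ρ α β ϖ c : ℝ}
  {Ub U : Matrix (Fin m) (Fin κ) ℝ} {Vb V : Matrix (Fin n) (Fin κ) ℝ} {J : Finset (Fin κ)}

/-- The bracket in the Kurdyka-Łojasiewicz constant. -/
def klBracket (α β σ₁ σr : ℝ) : ℝ :=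
  (β + α) * σr ^ 4 / (128 * √(σ₁ ^ 3) * (4 * σ₁ + σr) ^ 2) - √σ₁ * (β - α)

lemma sqrt_pow_three {x : ℝ} (hx : 0 ≤ x) : √(x ^ 3) = √x ^ 3 := by
  rw [Real.sqrt_eq_iff_mul_self_eq (by positivity) (by positivity)]
  calc x ^ 3 = (√x ^ 2) ^ 3 := by rw [Real.sq_sqrt hx]
    _ = √x ^ 3 * √x ^ 3 := by ring

/-- This is the condition on `β / α` cleared of denominators, using `√(σ₁³) √σ₁ = σ₁²`. -/
lemma klBracket_pos {σ₁ σr : ℝ} (hσr : 0 < σr) (hσ : σr ≤ σ₁) (hα : 0 < α)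
    (hcond : β / α < (128 * σ₁ ^ 2 * (4 * σ₁ + σr) ^ 2 + σr ^ 4) /
      (128 * σ₁ ^ 2 * (4 * σ₁ + σr) ^ 2 - σr ^ 4)) : 0 < klBracket α β σ₁ σr := by
  have hσ₁ : 0 < σ₁ := hσr.trans_le hσ
  have h1 : σr ^ 4 < 128 * σ₁ ^ 2 * (4 * σ₁ + σr) ^ 2 := by
    have e1 : σr ^ 2 ≤ σ₁ ^ 2 := pow_le_pow_left₀ hσr.le hσ 2
    have e2 : σr ^ 2 ≤ (4 * σ₁ + σr) ^ 2 := pow_le_pow_left₀ hσr.le (by linarith) 2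
    have e3 : σr ^ 2 * σr ^ 2 ≤ σ₁ ^ 2 * (4 * σ₁ + σr) ^ 2 := by gcongr
    have e4 : 0 < σr ^ 2 * σr ^ 2 := by positivity
    linarith
  rw [div_lt_div_iff₀ hα (sub_pos.2 h1)] at hcond
  have h2 : √(σ₁ ^ 3) * √σ₁ = σ₁ ^ 2 := by
    rw [sqrt_pow_three hσ₁.le]
    calc √σ₁ ^ 3 * √σ₁ = (√σ₁ ^ 2) ^ 2 := by ring
      _ = σ₁ ^ 2 := by rw [Real.sq_sqrt hσ₁.le]
  have h3 : 0 < √(σ₁ ^ 3) := Real.sqrt_pos.2 (by positivity)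
  rw [klBracket, sub_pos, lt_div_iff₀ (by positivity)]
  calc √σ₁ * (β - α) * (128 * √(σ₁ ^ 3) * (4 * σ₁ + σr) ^ 2)
      = 128 * (√(σ₁ ^ 3) * √σ₁) * (4 * σ₁ + σr) ^ 2 * (β - α) := by ring
    _ = 128 * σ₁ ^ 2 * (4 * σ₁ + σr) ^ 2 * (β - α) := by rw [h2]
    _ < (β + α) * σr ^ 4 := by linarith

lemma PenaltyRegime.α_le_β (H : PenaltyRegime A M φ ν μ ρ α β ϖ c κ r) : α ≤ β := by
  have hM : 0 < frobNorm M := by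
    refine (frobNorm_nonneg M).lt_of_ne' (frobNorm_eq_zero.not.2 fun h => ?_)
    have := H.rank_eq
    have := H.one_le_r
    simp only [h, Matrix.rank_zero] at *
    omega
  have hr : M.rank ≤ 2 * r := by have := H.rank_eq; omega
  exact le_of_mul_le_mul_right ((H.le_norm M hr).trans (H.norm_le M hr)) (by positivity)

/-- The error bound for the smooth part at factors supported on the columns in `J`. -/
lemma PenaltyRegime.klConstant_mul_smoothPart_le (H : PenaltyRegime A M φ ν μ ρ α β ϖ c κ r)
    (hB : BalancedWithSupport M r Ub Vb J)
    (hb : 0 ≤ klBracket α β (singVal M 1) (singVal M r)) {L R : ℝ}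
    (hU : NearFactor √(singVal M 1) √(singVal M r) L ρ ϖ R J U)
    (hV : NearFactor √(singVal M 1) √(singVal M r) L ρ ϖ R J V)
    (hdU : frobNorm (U - Ub) ≤ √(singVal M r) / 4)
    (hU0 : ∀ j ∉ J, ∀ i, U i j = 0) (hV0 : ∀ j ∉ J, ∀ i, V i j = 0)
    {G : Matrix (Fin m) (Fin n) ℝ}
    (hG : ∀ X, frobInner G X = inner ℝ (A (U * V.transpose - M)) (A X)) :
    klConstant ν μ ρ c α β (singVal M 1) (singVal M r) *
      smoothPart (lsLoss A (A M)) ν μ U V ≤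
    frobNorm (ν • (G * V) + μ • (U * (U.transpose * U - V.transpose * V))) ^ 2 +
      frobNorm (ν • (G.transpose * U) + (-μ) • (V * (U.transpose * U - V.transpose * V))) ^ 2 := by
  set E := U.transpose * U - V.transpose * V with hE
  set D := U * V.transpose - M with hD
  have hEt : E.transpose = E := by
    simp [hE, Matrix.transpose_sub, Matrix.transpose_mul]
  rw [frobNorm_gradient_sq_add ν μ G hEt, smoothPart_lsLoss]
  have hσ := H.σr_pos
  have hσ₁ := hσ.trans_le (singVal_le_singVal_one M r)
  have hν := H.ν_pos
  have hμ := H.μ_pos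
  have hα := H.α_pos
  have hαβ := H.α_le_β
  have hβ : 0 < β := hα.trans_le hαβ
  set s₁ := √(singVal M 1) with hs₁
  set s := √(singVal M r) with hs
  have hs2 : s ^ 2 = singVal M r := Real.sq_sqrt hσ.le
  have hs₁2 : s₁ ^ 2 = singVal M 1 := Real.sq_sqrt hσ₁.le
  have hs0 : 0 < s := Real.sqrt_pos.2 hσ
  have hss : s ≤ s₁ := Real.sqrt_le_sqrt (singVal_le_singVal_one M r)
  have hU_rank : U.rank ≤ r := (rank_le_of_zero_columns hU0).trans hB.card_eq.le
  have hV_rank : V.rank ≤ r := (rank_le_of_zero_columns hV0).trans hB.card_eq.le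
  have hM_rank := H.rank_eq
  -- lower bounds for the two blocks of the gradient of the loss
  have h1 : (α + β) / 2 * frobNorm (D * V) - (β - α) / 2 * (5 / 4 * s₁) * frobNorm D ≤
      frobNorm (G * V) := by
    refine le_frobNorm_adjoint_mul hαβ (by positivity) H.le_norm H.norm_le hG (fun t => ?_)
      hV.norm_mulVec_le
    -- Absorbing the perturbation into the left factor keeps the rank at most `rank V + rank M ≤
    -- 2r`.
    have e : D + t • (D * V * V.transpose) = (U + t • (D * V)) * V.transpose - M := by
      rw [Matrix.add_mul, Matrix.smul_mul, hD]
      abel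
    rw [e]
    refine (rank_sub_le _ _).trans ?_
    have := Matrix.rank_mul_le_right (U + t • (D * V)) V.transpose
    rw [Matrix.rank_transpose] at this
    omega
  have h2 : (α + β) / 2 * frobNorm (D.transpose * U) -
      (β - α) / 2 * (5 / 4 * s₁) * frobNorm D ≤ frobNorm (G.transpose * U) := by
    rw [← frobNorm_transpose D]
    -- The `U`-block is the `V`-block of the transposed problem.
    let A' : SamplingOp n m p := A ∘ₗ (Matrix.transposeLinearEquiv (Fin n) (Fin m) ℝ ℝ).toLinearMap
    have hA' : ∀ X, A' X = A X.transpose := fun _ => rfl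
    refine le_frobNorm_adjoint_mul (A := A') (k := 2 * r) hαβ (by positivity) (fun X hX => ?_)
      (fun X hX => ?_) (fun X => ?_) (fun t => ?_) hU.norm_mulVec_le
    · rw [hA', ← frobNorm_transpose X]
      exact H.le_norm _ (by rwa [Matrix.rank_transpose])
    · rw [hA', ← frobNorm_transpose X]
      exact H.norm_le _ (by rwa [Matrix.rank_transpose])
    · rw [hA', hA', Matrix.transpose_transpose, ← hG, ← frobInner_transpose,
        Matrix.transpose_transpose]
    · have e : D.transpose + t • (D.transpose * U * U.transpose) =
          (V + t • (D.transpose * U)) * U.transpose - M.transpose := by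
        rw [Matrix.add_mul, Matrix.smul_mul, hD, Matrix.transpose_sub, Matrix.transpose_mul,
          Matrix.transpose_transpose]
        abel
      rw [e]
      refine (rank_sub_le _ _).trans ?_
      have := Matrix.rank_mul_le_right (V + t • (D.transpose * U)) U.transpose
      rw [Matrix.rank_transpose] at this ⊢
      omega
  have h3 := mul_frobNorm_residual_sq_le hs0 hB.mul_eq hB.right_zero hU0 hV0
    (fun z hz => hB.le_norm_mulVec_left H.one_le_r H.rank_eq hz) hU.le_norm_mulVec
    hV.le_norm_mulVec hdU
  have hbr : klBracket α β (singVal M 1) (singVal M r) = (β + α) * (s ^ 2) ^ 4 /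
      (128 * s₁ ^ 3 * (4 * s₁ ^ 2 + s ^ 2) ^ 2) - s₁ * (β - α) := by
    rw [klBracket, sqrt_pow_three hσ₁.le, hs₁2, hs2]
  have h4 := isotropy_bracket_bound hs0 hss hα hαβ (frobNorm_nonneg D) (frobNorm_nonneg _)
    (frobNorm_nonneg _) (hbr ▸ hb) h3 h1 h2
  rw [← hbr] at h4
  set b := klBracket α β (singVal M 1) (singVal M r) with hbdef
  set γ := klConstant ν μ ρ c α β (singVal M 1) (singVal M r) with hγ
  have hγ1 : γ ≤ ν / β * b ^ 2 := (min_le_left _ _).trans (min_le_left _ _)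
  have hγ2 : γ ≤ 2 * μ * singVal M r := (min_le_left _ _).trans (min_le_right _ _)
  -- the loss
  have hD_rank : D.rank ≤ 2 * r := by
    refine (rank_sub_le _ _).trans ?_
    have := Matrix.rank_mul_le_left U V.transpose
    omega
  have h5 : γ * (ν / 2 * ‖A D‖ ^ 2) ≤
      ν ^ 2 * (frobNorm (G * V) ^ 2 + frobNorm (G.transpose * U) ^ 2) := by
    calc γ * (ν / 2 * ‖A D‖ ^ 2) ≤ ν / β * b ^ 2 * (ν / 2 * ‖A D‖ ^ 2) :=
          mul_le_mul_of_nonneg_right hγ1 (by positivity)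
      _ ≤ ν / β * b ^ 2 * (ν / 2 * (β * frobNorm D ^ 2)) := by
          have := H.norm_le D hD_rank
          gcongr
      _ = ν ^ 2 * (b ^ 2 / 2 * frobNorm D ^ 2) := by field_simp
      _ ≤ _ := mul_le_mul_of_nonneg_left h4 (sq_nonneg ν)
  -- the balancing term
  have hEcol : ∀ j, ∀ l ∉ J, E.col j l = 0 := fun j l hl => by
    simp [hE, Matrix.col, Matrix.mul_apply, hU0 l hl, hV0 l hl]
  have h6 := le_frobNorm_mul (show 0 ≤ 3 / 4 * s by positivity)
    (fun j => hU.le_norm_mulVec (E.col j) (hEcol j))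
  have h7 := le_frobNorm_mul (show 0 ≤ 3 / 4 * s by positivity)
    (fun j => hV.le_norm_mulVec (E.col j) (hEcol j))
  have h8 : ∀ x, 3 / 4 * s * frobNorm E ≤ x → 9 / 16 * (singVal M r * frobNorm E ^ 2) ≤ x ^ 2 :=
    fun x hx => by
      have := pow_le_pow_left₀ (mul_nonneg (by positivity) (frobNorm_nonneg E)) hx 2
      rw [← hs2]
      linarith
  have h9 : γ * (μ / 4 * frobNorm E ^ 2) ≤
      μ ^ 2 * (frobNorm (U * E) ^ 2 + frobNorm (V * E) ^ 2) := by
    calc γ * (μ / 4 * frobNorm E ^ 2) ≤ 2 * μ * singVal M r * (μ / 4 * frobNorm E ^ 2) :=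
          mul_le_mul_of_nonneg_right hγ2 (by positivity)
      _ = μ ^ 2 * (1 / 2 * (singVal M r * frobNorm E ^ 2)) := by ring
      _ ≤ _ := by
          refine mul_le_mul_of_nonneg_left ?_ (sq_nonneg μ)
          have h10 : 0 ≤ singVal M r * frobNorm E ^ 2 := mul_nonneg hσ.le (sq_nonneg _)
          linarith [h8 _ h6, h8 _ h7]
  linarith

/-- The test direction is the smooth gradient `(S, T)` itself. It is supported on `J`, so the
penalty is constant along it and `⟪v, (S, T)⟫ = ‖(S, T)‖²`, whence `‖v‖ ≥ ‖(S, T)‖`. -/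
lemma PenaltyRegime.le_norm_sq_of_supported (H : PenaltyRegime A M φ ν μ ρ α β ϖ c κ r)
    (hB : BalancedWithSupport M r Ub Vb J)
    (hb : 0 ≤ klBracket α β (singVal M 1) (singVal M r)) {R : ℝ}
    (hU : NearFactor √(singVal M 1) √(singVal M r) (leftDerivAtOne φ) ρ ϖ R J U)
    (hV : NearFactor √(singVal M 1) √(singVal M r) (leftDerivAtOne φ) ρ ϖ R J V)
    (hdU : frobNorm (U - Ub) ≤ √(singVal M r) / 4)
    (hU0 : ∀ j ∉ J, ∀ i, U i j = 0) (hV0 : ∀ j ∉ J, ∀ i, V i j = 0)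
    {v : FactorSpace m n κ}
    (hv : v ∈ regularSubdiff (Theta (lsLoss A (A M)) ν μ φ ρ κ) (toFactor U V)) :
    klConstant ν μ ρ c α β (singVal M 1) (singVal M r) *
      (Theta (lsLoss A (A M)) ν μ φ ρ κ (toFactor U V) - r) ≤ ‖v‖ ^ 2 := by
  obtain ⟨G, hG, -⟩ := exists_gradient_bound U V A M
  have h0 := H.klConstant_mul_smoothPart_le hB hb hU hV hdU hU0 hV0 hG
  set E := U.transpose * U - V.transpose * V with hE
  set S := ν • (G * V) + μ • (U * E) with hS
  set T := ν • (G.transpose * U) + (-μ) • (V * E) with hT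
  have hE0 : ∀ j ∉ J, ∀ i, E i j = 0 := fun j hj i => by
    simp [hE, Matrix.mul_apply, hU0 j hj, hV0 j hj]
  have hS0 : ∀ j ∉ J, ∀ i, S i j = 0 := fun j hj i => by
    simp [hS, Matrix.mul_apply, hV0 j hj, hE0 j hj]
  have hT0 : ∀ j ∉ J, ∀ i, T i j = 0 := fun j hj i => by
    simp [hT, Matrix.mul_apply, hU0 j hj, hE0 j hj]
  have h1 := hasDerivAt_smoothPart (ν := ν) (μ := μ) (S := S) (T := T) hG
  rw [← hE, ← hS, ← hT, ← frobNorm_sq, ← frobNorm_sq, ← norm_toFactor_sq] at h1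
  have hUs := eventually_sum_theta_add_smul_eq H.generator hU.lt_mul_colNorm hU0 hS0
  have hVs := eventually_sum_theta_add_smul_eq H.generator hV.lt_mul_colNorm hV0 hT0
  rw [hB.card_eq] at hUs hVs
  have hΘ : ∀ᶠ t : ℝ in 𝓝 0, Theta (lsLoss A (A M)) ν μ φ ρ κ (toFactor U V + t • toFactor S T) =
      smoothPart (lsLoss A (A M)) ν μ (U + t • S) (V + t • T) + r := by
    filter_upwards [hUs, hVs] with t h2 h3
    rw [toFactor_add_smul, Theta_toFactor_eq_add, h2, h3]
    ring
  have h2 := inner_eq_of_mem_regularSubdiff hv ((h1.add_const (r : ℝ)).congr_of_eventuallyEq hΘ)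
  have h3 := hΘ.self_of_nhds
  simp only [zero_smul, add_zero] at h3
  rw [h3, add_sub_cancel_right]
  rw [← norm_toFactor_sq] at h0
  refine h0.trans (pow_le_pow_left₀ (norm_nonneg _) ?_ 2)
  have h4 := real_inner_le_norm v (toFactor S T)
  rw [h2] at h4
  rcases (norm_nonneg (toFactor S T)).eq_or_lt with h5 | h5
  · rw [← h5]
    exact norm_nonneg v
  · refine le_of_mul_le_mul_right ?_ h5
    linarith

/-- The error bound for regular subgradients near a balanced solution. -/
lemma PenaltyRegime.le_norm_sq_of_mem_regularSubdiff (H : PenaltyRegime A M φ ν μ ρ α β ϖ c κ r)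
    (hb : 0 ≤ klBracket α β (singVal M 1) (singVal M r))
    (hW : BalancedWithSupport M r Ub Vb J) {w v : FactorSpace m n κ}
    (hpos : (r : ℝ) < Theta (lsLoss A (A M)) ν μ φ ρ κ w)
    (hlt : Theta (lsLoss A (A M)) ν μ φ ρ κ w < r + 1 / 2)
    (hw : ‖w - toFactor Ub Vb‖ < klRadius ν μ ρ ϖ c (singVal M 1) (singVal M r) (opNorm A))
    (hv : v ∈ regularSubdiff (Theta (lsLoss A (A M)) ν μ φ ρ κ) w) :
    klConstant ν μ ρ c α β (singVal M 1) (singVal M r) *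
      (Theta (lsLoss A (A M)) ν μ φ ρ κ w - r) ≤ ‖v‖ ^ 2 := by
  obtain ⟨U, V, rfl⟩ : ∃ (U : Matrix (Fin m) (Fin κ) ℝ) (V : Matrix (Fin n) (Fin κ) ℝ),
      w = toFactor U V := ⟨(matVec m κ).symm w.fst, (matVec n κ).symm w.snd, rfl⟩
  have hw' : ‖toFactor (U - Ub) (V - Vb)‖ <
      klRadius ν μ ρ ϖ c (singVal M 1) (singVal M r) (opNorm A) := hw
  obtain ⟨hU, hV⟩ := hW.nearFactors H hw'
  have hone : ∀ j ∈ J, 1 / 2 * (theta φ (ρ * colNorm U j) + theta φ (ρ * colNorm V j)) = 1 :=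
    fun j hj => by
      rw [theta_eq_one H.generator (hU.lt_mul_colNorm j hj).le,
        theta_eq_one H.generator (hV.lt_mul_colNorm j hj).le]
      norm_num
  have hpen : (r : ℝ) ≤
      ∑ j, 1 / 2 * (theta φ (ρ * colNorm U j) + theta φ (ρ * colNorm V j)) := by
    rw [← Finset.sum_add_sum_compl J, Finset.sum_congr rfl hone]
    have h1 : 0 ≤ ∑ j ∈ Jᶜ, 1 / 2 * (theta φ (ρ * colNorm U j) + theta φ (ρ * colNorm V j)) :=
      Finset.sum_nonneg fun j _ => by
        have h2 := theta_nonneg H.generator H.slope (mul_nonneg H.ρ_pos.le (colNorm_nonneg U j))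
        have h3 := theta_nonneg H.generator H.slope (mul_nonneg H.ρ_pos.le (colNorm_nonneg V j))
        linarith
    simp only [Finset.sum_const, hW.card_eq, nsmul_eq_mul, mul_one]
    linarith
  -- The penalty already accounts for `r`, so the loss term is below `1/2`.
  have hD : ν * ‖A (U * V.transpose - M)‖ ^ 2 ≤ 1 := by
    rw [Theta_toFactor, smoothPart_lsLoss] at hlt
    have : 0 ≤ μ / 4 * frobNorm (U.transpose * U - V.transpose * V) ^ 2 := by
      have := H.μ_pos
      positivity
    linarith
  -- The third entry of the constant fits exactly: `c²ρ²/8 · 1/2 = (cρ/4)²`.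
  have hcase : c * ρ / 4 ≤ ‖v‖ → klConstant ν μ ρ c α β (singVal M 1) (singVal M r) *
      (Theta (lsLoss A (A M)) ν μ φ ρ κ (toFactor U V) - r) ≤ ‖v‖ ^ 2 := fun h => by
    have hc := H.slope.c_pos
    have hρ := H.ρ_pos
    have h1 := pow_le_pow_left₀ (by positivity) h 2
    have h2 : klConstant ν μ ρ c α β (singVal M 1) (singVal M r) ≤ c ^ 2 * ρ ^ 2 / 8 :=
      min_le_right _ _
    have h3 := mul_le_mul_of_nonneg_right h2 (sub_nonneg.2 hpos.le)
    have h4 : c ^ 2 * ρ ^ 2 / 8 * (Theta (lsLoss A (A M)) ν μ φ ρ κ (toFactor U V) - r) ≤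
        c ^ 2 * ρ ^ 2 / 8 * (1 / 2) :=
      mul_le_mul_of_nonneg_left (by linarith) (by positivity)
    linarith
  by_cases hU0 : ∀ j ∉ J, colNorm U j = 0
  · by_cases hV0 : ∀ j ∉ J, colNorm V j = 0
    · refine H.le_norm_sq_of_supported hW hb hU hV ?_ (fun j hj => colNorm_eq_zero.1 (hU0 j hj))
        (fun j hj => colNorm_eq_zero.1 (hV0 j hj)) hv
      exact (frobNorm_le_norm_toFactor_left _ _).trans
        (hw'.le.trans ((min_le_left _ _).trans (min_le_left _ _)))
    · push Not at hV0
      obtain ⟨j, hj, hj0⟩ := hV0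
      exact hcase (le_norm_of_right_column_ne_zero H rfl hU hV hD hv hj hj0)
  · push Not at hU0
    obtain ⟨j, hj, hj0⟩ := hU0
    exact hcase (le_norm_of_left_column_ne_zero H rfl hU hV hD hv hj hj0)

/-- The error bound for the limiting subdifferential near a balanced solution. -/
lemma PenaltyRegime.klConstant_mul_le_distSubdiff_sq (H : PenaltyRegime A M φ ν μ ρ α β ϖ c κ r)
    (hb : 0 ≤ klBracket α β (singVal M 1) (singVal M r))
    (hW : BalancedWithSupport M r Ub Vb J) {w : FactorSpace m n κ}
    (hpos : (r : ℝ) < Theta (lsLoss A (A M)) ν μ φ ρ κ w)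
    (hlt : Theta (lsLoss A (A M)) ν μ φ ρ κ w < r + 1 / 2)
    (hw : ‖w - toFactor Ub Vb‖ < klRadius ν μ ρ ϖ c (singVal M 1) (singVal M r) (opNorm A)) :
    ENNReal.ofReal √(klConstant ν μ ρ c α β (singVal M 1) (singVal M r) *
      (Theta (lsLoss A (A M)) ν μ φ ρ κ w - r)) ≤
      distSubdiff (Theta (lsLoss A (A M)) ν μ φ ρ κ) w := by
  refine Metric.le_infEDist.2 ?_
  rintro v ⟨xs, vs, hxs, hg, hvs, hvlim⟩
  rw [edist_dist, dist_zero_left]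
  refine ENNReal.ofReal_le_ofReal (Real.sqrt_le_iff.2 ⟨norm_nonneg v, ?_⟩)
  refine le_of_tendsto_of_tendsto ((hg.sub_const (r : ℝ)).const_mul _) (hvlim.norm.pow 2) ?_
  -- The strict bounds on value and distance are open conditions and `Θ_ρ(x_k) → Θ_ρ(w)`, so the
  -- regular estimate holds for all large `k` and passes to the limit.
  have h1 := (hxs.sub_const (toFactor Ub Vb)).norm.eventually (gt_mem_nhds hw)
  filter_upwards [hg.eventually (lt_mem_nhds hpos), hg.eventually (gt_mem_nhds hlt), h1]
    with k hk1 hk2 hk3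
  exact H.le_norm_sq_of_mem_regularSubdiff hb hW hk1 hk2 hk3 (hvs k)

lemma zero_mem_limitingSubdiff_of_isMin {E : Type*} [NormedAddCommGroup E] [InnerProductSpace ℝ E]
    {g : E → ℝ} {x : E} (h : ∀ y, g x ≤ g y) : (0 : E) ∈ limitingSubdiff g x := by
  refine ⟨fun _ => x, fun _ => 0, tendsto_const_nhds, tendsto_const_nhds, fun _ ε hε => ?_,
    tendsto_const_nhds⟩
  refine Eventually.of_forall fun y => ?_
  have h1 := h y
  have h2 := mul_nonneg hε.le (norm_nonneg (y - x))
  rw [inner_zero_left]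
  linarith

lemma PenaltyRegime.klConstant_pos (H : PenaltyRegime A M φ ν μ ρ α β ϖ c κ r)
    (hb : 0 < klBracket α β (singVal M 1) (singVal M r)) :
    0 < klConstant ν μ ρ c α β (singVal M 1) (singVal M r) := by
  have hβ : 0 < β := H.α_pos.trans_le H.α_le_β
  have hν := H.ν_pos
  have hμ := H.μ_pos
  have hσ := H.σr_pos
  have hc := H.slope.c_pos
  have hρ := H.ρ_pos
  refine lt_min (lt_min ?_ (by positivity)) (by positivity)
  exact mul_pos (by positivity) (pow_pos hb 2)

lemma PenaltyRegime.hasKLExponentHalf (H : PenaltyRegime A M φ ν μ ρ α β ϖ c κ r)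
    (hb : 0 < klBracket α β (singVal M 1) (singVal M r)) {w₀ : FactorSpace m n κ}
    (hmin : ∀ w, Theta (lsLoss A (A M)) ν μ φ ρ κ w₀ ≤ Theta (lsLoss A (A M)) ν μ φ ρ κ w) :
    HasKLExponentHalf (Theta (lsLoss A (A M)) ν μ φ ρ κ) w₀ := by
  obtain ⟨U, V, rfl⟩ : ∃ (U : Matrix (Fin m) (Fin κ) ℝ) (V : Matrix (Fin n) (Fin κ) ℝ),
      w₀ = toFactor U V := ⟨(matVec m κ).symm w₀.fst, (matVec n κ).symm w₀.snd, rfl⟩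
  obtain ⟨U', V', hle⟩ := H.Theta_balanced_factors_le
  obtain ⟨J, hJ⟩ := H.exists_support (H.mem_balancedSolutions_of_Theta_le ((hmin _).trans hle))
  have hΘ := hJ.Theta_eq H
  have hγ := H.klConstant_pos hb
  set γ := klConstant ν μ ρ c α β (singVal M 1) (singVal M r)
  have hsγ : 0 < √γ := Real.sqrt_pos.2 hγ
  -- The factor `2 / √γ` makes the derivative at `δ` equal to `1 / √(γ δ)`, the reciprocal of the
  -- error bound.
  refine ⟨⟨0, zero_mem_limitingSubdiff_of_isMin hmin⟩, 2 / √γ, by positivity,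
    ENNReal.ofReal (1 / 2), by simp, Metric.ball (toFactor U V)
      (klRadius ν μ ρ ϖ c (singVal M 1) (singVal M r) (opNorm A)),
    Metric.ball_mem_nhds _ H.klRadius_pos, fun w hw hgt hlt => ?_⟩
  rw [ENNReal.ofReal_lt_ofReal_iff (by norm_num)] at hlt
  rw [hΘ] at hgt hlt ⊢
  rw [mem_ball_iff_norm] at hw
  have h1 := H.klConstant_mul_le_distSubdiff_sq hb.le hJ hgt (by linarith) hw
  set δ := Theta (lsLoss A (A M)) ν μ φ ρ κ w - r with hδ
  have hδ0 : 0 < δ := sub_pos.2 hgt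
  have hsδ : 0 < √δ := Real.sqrt_pos.2 hδ0
  have hderiv : deriv (fun s : ℝ => 2 / √γ * √s) δ = 1 / (√γ * √δ) := by
    rw [((Real.hasDerivAt_sqrt hδ0.ne').const_mul _).deriv]
    field_simp
  rw [hderiv]
  calc (1 : ENNReal) = ENNReal.ofReal (1 / (√γ * √δ)) * ENNReal.ofReal √(γ * δ) := by
        rw [← ENNReal.ofReal_mul (by positivity), Real.sqrt_mul hγ.le,
          one_div_mul_cancel (by positivity), ENNReal.ofReal_one]
    _ ≤ _ := by gcongr

end ErrorBound

end LowRankKL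

end

theorem mainTheorem2 (m n p κ r : ℕ) (hr : 1 ≤ r)
    (A : LowRankKL.SamplingOp m n p)
    (M : Matrix (Fin m) (Fin n) ℝ) (hM : M.rank = r)
    (f : Matrix (Fin m) (Fin n) ℝ → ℝ) (hf : f = LowRankKL.lsLoss A (A M))
    (ν μ ρ ϖ c : ℝ) (hν : 0 < ν) (hμ : 0 < μ)
    (φ : ℝ → EReal) (hφ : LowRankKL.IsPenaltyGenerator φ)
    (hθ : LowRankKL.SlopeAssumption φ ϖ c)
    (α β σ₁ σr : ℝ)
    (hα : α = LowRankKL.restrictedEigMin A (2 * r))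
    (hβ : β = LowRankKL.restrictedEigMax A (2 * r))
    (hσ₁ : σ₁ = LowRankKL.singVal M 1) (hσr : σr = LowRankKL.singVal M r)
    (hX : (LowRankKL.rankRegSolutions f ν ∩ {X | X.rank ≤ κ}).Nonempty)
    (hcond : β / α < (128 * σ₁ ^ 2 * (4 * σ₁ + σr) ^ 2 + σr ^ 4) /
      (128 * σ₁ ^ 2 * (4 * σ₁ + σr) ^ 2 - σr ^ 4))
    (hα_large : 4 / (ν * σr ^ 2) < α)
    (hρ : LowRankKL.penaltyThreshold φ ν μ α σr (LowRankKL.opNorm A) κ r < ρ) :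
    (∀ (Ubar : Matrix (Fin m) (Fin κ) ℝ) (Vbar : Matrix (Fin n) (Fin κ) ℝ),
      (Ubar, Vbar) ∈ LowRankKL.balancedSolutions f ν κ →
      ∀ (U : Matrix (Fin m) (Fin κ) ℝ) (V : Matrix (Fin n) (Fin κ) ℝ),
        0 < LowRankKL.Theta f ν μ φ ρ κ (LowRankKL.toFactor U V)
          - LowRankKL.Theta f ν μ φ ρ κ (LowRankKL.toFactor Ubar Vbar) →
        LowRankKL.Theta f ν μ φ ρ κ (LowRankKL.toFactor U V)
          - LowRankKL.Theta f ν μ φ ρ κ (LowRankKL.toFactor Ubar Vbar) < 1 / 2 →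
        ‖LowRankKL.toFactor (U - Ubar) (V - Vbar)‖
          < LowRankKL.klRadius ν μ ρ ϖ c σ₁ σr (LowRankKL.opNorm A) →
        ENNReal.ofReal (LowRankKL.klConstant ν μ ρ c α β σ₁ σr *
            (LowRankKL.Theta f ν μ φ ρ κ (LowRankKL.toFactor U V)
              - LowRankKL.Theta f ν μ φ ρ κ (LowRankKL.toFactor Ubar Vbar)))
          ≤ LowRankKL.distSubdiff (LowRankKL.Theta f ν μ φ ρ κ) (LowRankKL.toFactor U V) ^ 2) ∧
    0 < LowRankKL.klConstant ν μ ρ c α β σ₁ σr ∧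
    0 < LowRankKL.klRadius ν μ ρ ϖ c σ₁ σr (LowRankKL.opNorm A) ∧
    (∀ w₀ : LowRankKL.FactorSpace m n κ,
      (∀ w, LowRankKL.Theta f ν μ φ ρ κ w₀ ≤ LowRankKL.Theta f ν μ φ ρ κ w) →
        LowRankKL.HasKLExponentHalf (LowRankKL.Theta f ν μ φ ρ κ) w₀) := by
  subst hf hσ₁ hσr
  have hσ := LowRankKL.singVal_pos hr hM
  have hle : ∀ X : Matrix (Fin m) (Fin n) ℝ, X.rank ≤ 2 * r →
      α * LowRankKL.frobNorm X ^ 2 ≤ ‖A X‖ ^ 2 := fun X hX =>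
    hα ▸ LowRankKL.restrictedEigMin_mul_le A hX
  have hlarge : 4 < ν * α * LowRankKL.singVal M r ^ 2 := by
    rw [div_lt_iff₀ (by positivity)] at hα_large
    linarith
  -- The given element of `𝒳* ∩ Ω_κ` must be `M`. Hence `M` is a solution and `r ≤ κ`.
  obtain ⟨X, hX, hXκ⟩ := hX
  have hXM := LowRankKL.eq_of_mem_rankRegSolutions hν hM hle hlarge hX
  subst hXM
  have H : LowRankKL.PenaltyRegime A X φ ν μ ρ α β ϖ c κ r :=
    { one_le_r := hr
      rank_eq := hM
      r_le := hM ▸ hXκ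
      ν_pos := hν
      μ_pos := hμ
      generator := hφ
      slope := hθ
      le_norm := hle
      norm_le := fun Y hY => hβ ▸ LowRankKL.le_restrictedEigMax_mul A hY
      α_large := hlarge
      mem_solutions := fun Y =>
        ⟨LowRankKL.eq_of_mem_rankRegSolutions hν hM hle hlarge, fun h => h ▸ hX⟩
      threshold := hρ }
  have hb := LowRankKL.klBracket_pos hσ (LowRankKL.singVal_le_singVal_one X r) H.α_pos hcond
  refine ⟨fun Ubar Vbar hW U V hpos hlt hdist => ?_, H.klConstant_pos hb, H.klRadius_pos,
    fun w₀ hmin => H.hasKLExponentHalf hb hmin⟩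
  obtain ⟨J, hJ⟩ := H.exists_support hW
  rw [hJ.Theta_eq H] at hpos hlt ⊢
  have h := H.klConstant_mul_le_distSubdiff_sq hb.le hJ (w := LowRankKL.toFactor U V)
    (sub_pos.1 hpos) (by linarith) hdist
  refine le_trans (le_of_eq ?_) (pow_le_pow_left' h 2)
  rw [← ENNReal.ofReal_pow (Real.sqrt_nonneg _),
    Real.sq_sqrt (mul_nonneg (H.klConstant_pos hb).le hpos.le)]
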